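/- **Setting.** Let $N\ge 2$ be a natural number and $q\in\mathbb R\setminus\{-1,0,1\}$. Put $Q=q-q^{-1}$, $s_+=\sum_{i=0}^{N-1}q^{2i}$, $s=s_+-1=\sum_{i=1}^{N-1}q^{2i}$. Indices run over $1,\dots,N$ and repeated indices $s,t$ in $R^{st}_{kl}z_s\,\mathrm dz_t$ and similar terms are summed. Let $R^{ij}_{kl}=1$ if $i=l\neq k=j$, $=q$ if $i=j=k=l$, $=Q$ if $i=k<j=l$, $=0$ otherwise; $R^{-}$ its inverse: $(R^-)^{ij}_{kl}=1$ if $i=l\ne k=j$, $=q^{-1}$ if $i=j=k=l$, $=-Q$ if $i=k>j=l$, $=0$ otherwise; and $\check R^{ij}_{kl}=R^{lk}_{ji}$, $\grave R^{ij}_{kl}=q^{2l-2i}(R^-)^{jl}_{ik}$, $\acute R^{ij}_{kl}=R^{ki}_{lj}$. The quantum sphere $X=\mathrm S_q^{2N-1}$ is the unital complex $*$-algebra with generators $z_i,z_i^*$ and relations $z_iz_j=qz_jz_i$, $z_i^*z_j^*=q^{-1}z_j^*z_i^*$ ($i<j$), $z_iz_j^*=qz_j^*z_i$ ($i\neq j$),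 $z_iz_i^*-z_i^*z_i+q^{-1}Q\sum_{k>i}z_kz_k^*=0$, $\sum_iz_iz_i^*=1$. The Hopf algebra of $\mathrm{SU}_q(N)$ has generators $u^i_j$ with $\sum_{a,b}R^{ij}_{ab}u^a_ku^b_l=\sum_{a,b}u^i_au^j_bR^{ab}_{kl}$ and quantum determinant $1$, with $\Delta(u^i_j)=\sum_au^i_a\otimes u^a_j$ and antipode $S$; it coacts on $X$ by $\Delta_R(z_i)=\sum_jz_j\otimes u^j_i$, $\Delta_R(z_i^*)=\sum_jz_j^*\otimes S(u^i_j)$. A first order differential calculus (FODC) on $X$ is a pair $(\Gamma,\mathrm d)$ of an $X$-bimodule $\Gamma$ and a linear map $\mathrm d:X\to\Gamma$ with $\mathrm d(xy)=(\mathrm dx)y+x\,\mathrm dy$ and $\Gamma=\mathrm{Lin}\{x\,\mathrm dy\}$. It is covariant if there is a linear $\Phi:\Gamma\to\Gamma\otimes\mathrm{SU}_q(N)$ with $(\Phi\otimes\mathrm{id})\Phi=(\mathrm{id}\otimes\Delta)\Phi$, $(\mathrm{id}\otimes\varepsilon)\Phi=\mathrm{id}$, $\Phi(x\omega y)=\Delta_R(x)\Phi(\omega)\Delta_R(y)$,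 $\Phi(\mathrm dx)=(\mathrm d\otimes\mathrm{id})\Delta_R(x)$. It is a $*$-calculus if $\sum_kx_k\mathrm dy_k=0$ implies $\sum_k\mathrm d(y_k^*)x_k^*=0$. Put $\Omega_+=\sum_iz_i\,\mathrm dz_i^*$ and $\Omega_-=\sum_iq^{-2i}z_i^*\,\mathrm dz_i$. For $\Omega_0\in\Gamma$, $\Gamma/(\Omega_0)$ is the quotient of $\Gamma$ by the sub-bimodule generated by $\Omega_0$, with the induced differential. **Freely generated calculi.** The following denote FODC for which $\{\mathrm dz_i,\mathrm dz_i^*\}$ is a free left module basis, with the displayed bimodule structure. $\Gamma_{\alpha\tau}$ ($\alpha\in\mathbb R\setminus\{0,q^{-2}\}$, $\tau\in\mathbb R$): $$\begin{aligned} \mathrm dz_k\,z_l&=q\alpha (R^-)^{st}_{kl}z_s\mathrm dz_t+(q^2\alpha-1)z_k\mathrm dz_l+q^2\alpha^2(1-s\tau)z_kz_l\Omega_++q^2(1-\alpha s\tau)z_kz_l\Omega_-\\ \mathrm dz_k^*z_l^*&=q^{-1}\alpha^{-1}\check R^{st}_{kl}z_s^*\mathrm dz_t^*+(q^{-2}\alpha^{-1}-1)z_k^*\mathrm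 dz_l^*+(1-s\tau)z_k^*z_l^*\Omega_++\alpha^{-2}(1-\alpha s\tau)z_k^*z_l^*\Omega_-\\ \mathrm dz_k\,z_l^*&=q^{-1}\alpha^{-1}\grave R^{st}_{kl}z_s^*\mathrm dz_t+(q^2\alpha-1)z_k\mathrm dz_l^*-q^2\alpha(1-s_+\tau)z_kz_l^*\Omega_+-\alpha^{-1}(1-q^2\alpha s_+\tau)z_kz_l^*\Omega_-\\&\quad-q^{2k}\delta_{kl}(\alpha\tau\Omega_++\tau\Omega_-)\\ \mathrm dz_k^*z_l&=q\alpha\acute R^{st}_{kl}z_s\mathrm dz_t^*+(q^{-2}\alpha^{-1}-1)z_k^*\mathrm dz_l-q^2\alpha(1-s_+\tau)z_k^*z_l\Omega_+-\alpha^{-1}(1-q^2\alpha s_+\tau)z_k^*z_l\Omega_-\\&\quad-q^{2N}\delta_{kl}(\alpha\tau\Omega_++\tau\Omega_-) \end{aligned}$$ $\Gamma'_{\alpha\omega}$ ($\alpha\in\mathbb R\setminus\{0,q^{-2}\}$, $\omega\in\mathbb R\setminus\{0\}$): $$\begin{aligned} \mathrm dz_k\,z_l&=q\alpha (R^-)^{st}_{kl}z_s\mathrm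 dz_t+(q^2\alpha-1)z_k\mathrm dz_l+\omega z_kz_l\Omega_++(\alpha^{-1}\omega-q^2(\alpha-1))z_kz_l\Omega_-\\ \mathrm dz_k^*z_l^*&=q^{-1}\alpha^{-1}\check R^{st}_{kl}z_s^*\mathrm dz_t^*+(q^{-2}\alpha^{-1}-1)z_k^*\mathrm dz_l^*+(q^2\alpha\omega^{-1}-(\alpha^{-1}-1))z_k^*z_l^*\Omega_++q^2\omega^{-1}z_k^*z_l^*\Omega_-\\ \mathrm dz_k\,z_l^*&=q^{-1}\alpha^{-1}\grave R^{st}_{kl}z_s^*\mathrm dz_t+(q^2\alpha-1)z_k\mathrm dz_l^*-q^2\alpha z_kz_l^*\Omega_+-\alpha^{-1}z_kz_l^*\Omega_-\\ \mathrm dz_k^*z_l&=q\alpha\acute R^{st}_{kl}z_s\mathrm dz_t^*+(q^{-2}\alpha^{-1}-1)z_k^*\mathrm dz_l-q^2\alpha z_k^*z_l\Omega_+-\alpha^{-1}z_k^*z_l\Omega_- \end{aligned}$$ $\Gamma''_{\omega\psi}$ ($\omega\in\mathbb R\setminus\{0\}$, $\psi\in\mathbb R$): $$\begin{aligned} \mathrm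 dz_k\,z_l&=q^{-1}(R^-)^{st}_{kl}z_s\mathrm dz_t+\omega z_kz_l\Omega_++(q^2\omega\psi-1)z_kz_l\Omega_-\\ \mathrm dz_k^*z_l^*&=q\check R^{st}_{kl}z_s^*\mathrm dz_t^*+(\psi-q^2)z_k^*z_l^*\Omega_++q^2\omega^{-1}z_k^*z_l^*\Omega_-\\ \mathrm dz_k\,z_l^*&=q\grave R^{st}_{kl}z_s^*\mathrm dz_t-z_kz_l^*\Omega_+-q^2z_kz_l^*\Omega_-\\ \mathrm dz_k^*z_l&=q^{-1}\acute R^{st}_{kl}z_s\mathrm dz_t^*-z_k^*z_l\Omega_+-q^2z_k^*z_l\Omega_- \end{aligned}$$ $\Gamma'''_{\varrho\tau}$ ($\varrho,\tau\in\mathbb R\setminus\{0\}$): $$\begin{aligned} \mathrm dz_k\,z_l&=q^{-1}(R^-)^{st}_{kl}z_s\mathrm dz_t-q^{-2}\tfrac\varrho\tau(s\varrho-1)z_kz_l\Omega_+-\tfrac\varrho\tau(s\tau-q^2)z_kz_l\Omega_-\\ \mathrm dz_k^*z_l^*&=q\check R^{st}_{kl}z_s^*\mathrm dz_t^*-\tfrac\tau\varrho(s\varrho-1)z_k^*z_l^*\Omega_+-q^2\tfrac\tau\varrho(s\tau-q^2)z_k^*z_l^*\Omega_-\\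 \mathrm dz_k\,z_l^*&=q\grave R^{st}_{kl}z_s^*\mathrm dz_t-q^{2k}\delta_{kl}(q^{-2}\varrho\Omega_++\tau\Omega_-)+(s_+\varrho-1)z_kz_l^*\Omega_++q^2(s_+\tau-1)z_kz_l^*\Omega_-\\ \mathrm dz_k^*z_l&=q^{-1}\acute R^{st}_{kl}z_s\mathrm dz_t^*-\delta_{kl}(q^{2N-2}\varrho\Omega_++q^{2N}\tau\Omega_-)+(s_+\varrho-1)z_k^*z_l\Omega_++q^2(s_+\tau-1)z_k^*z_l\Omega_- \end{aligned}$$ **Calculi with one relation.** The following denote covariant FODC which are generated as left modules by $\{\mathrm dz_i,\mathrm dz_i^*\}$, in which all left module relations between these generators are generated by the one relation $\Omega_++\lambda\Omega_-=0$ (if $\lambda\in\mathbb C$) or $\Omega_-=0$ (if $\lambda=\infty$), with the displayed bimodule structure. $\tilde\Gamma_\lambda$ ($\lambda\ne0,q^2,\infty$): $$\begin{aligned} \mathrm dz_kz_l&=q\lambda^{-1}(R^-)^{st}_{kl}z_s\mathrm dz_t+(q^2\lambda^{-1}-1)z_k\mathrm dz_l+q^2\lambda^{-1}(\lambda^{-1}-1)z_kz_l\Omega_+\\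 \mathrm dz_k^*z_l^*&=q^{-1}\lambda\check R^{st}_{kl}z_s^*\mathrm dz_t^*+(q^{-2}\lambda-1)z_k^*\mathrm dz_l^*-(\lambda-1)z_k^*z_l^*\Omega_+\\ \mathrm dz_kz_l^*&=q^{-1}\lambda\grave R^{st}_{kl}z_s^*\mathrm dz_t+(q^2\lambda^{-1}-1)z_k\mathrm dz_l^*-(q^2\lambda^{-1}-1)z_kz_l^*\Omega_+\\ \mathrm dz_k^*z_l&=q\lambda^{-1}\acute R^{st}_{kl}z_s\mathrm dz_t^*+(q^{-2}\lambda-1)z_k^*\mathrm dz_l-(q^2\lambda^{-1}-1)z_k^*z_l\Omega_+ \end{aligned}$$ $\tilde\Gamma'_\lambda$ ($\lambda\neq0,\infty$): $$\begin{aligned} \mathrm dz_kz_l&=q^{-1}(R^-)^{st}_{kl}z_s\mathrm dz_t-\lambda^{-1}(q^4\lambda^{-1}-1)z_kz_l\Omega_+\\ \mathrm dz_k^*z_l^*&=q\check R^{st}_{kl}z_s^*\mathrm dz_t^*-q^{-2}\lambda(q^4\lambda^{-1}-1)z_k^*z_l^*\Omega_+\\ \mathrm dz_kz_l^*&=q\grave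 R^{st}_{kl}z_s^*\mathrm dz_t+(q^2\lambda^{-1}-1)z_kz_l^*\Omega_+\\ \mathrm dz_k^*z_l&=q^{-1}\acute R^{st}_{kl}z_s\mathrm dz_t^*+(q^2\lambda^{-1}-1)z_k^*z_l\Omega_+ \end{aligned}$$ $\tilde\Gamma''_\lambda$ ($\lambda\in\mathbb C\cup\{\infty\}$): $\mathrm dz_kz_l=q^{-1}(R^-)^{st}_{kl}z_s\mathrm dz_t$, $\mathrm dz_k^*z_l^*=q\check R^{st}_{kl}z_s^*\mathrm dz_t^*$, and $$\mathrm dz_kz_l^*=q\grave R^{st}_{kl}z_s^*\mathrm dz_t+q^{2k}\delta_{kl}A+z_kz_l^*B,\qquad \mathrm dz_k^*z_l=q^{-1}\acute R^{st}_{kl}z_s\mathrm dz_t^*+q^{2N}\delta_{kl}A+z_k^*z_lB,$$ where $A=q^{-2}s^{-1}(q^4\lambda^{-1}-1)\Omega_+$, $B=-s^{-1}(q^{2N+2}\lambda^{-1}-1)\Omega_+$ if $\lambda\ne0,\infty$; $A=-q^2s^{-1}\Omega_-$, $B=q^{2N+2}s^{-1}\Omega_-$ if $\lambda=0$; $A=-q^{-2}s^{-1}\Omega_+$,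 $B=s^{-1}\Omega_+$ if $\lambda=\infty$. **Corollary.** In each equality below "$=$" means: the factor calculus on the left has the properties that characterise the calculus on the right (in particular it is covariant), and it is isomorphic, as a FODC, to every calculus with these properties. 1. For $\alpha\in\mathbb R\setminus\{0,q^{-2}\}$, $\tau\in\mathbb R$, $\omega\in\mathbb R\setminus\{0\}$: $\;\Gamma_{\alpha\tau}/(\Omega_++\alpha^{-1}\Omega_-)=\Gamma'_{\alpha\omega}/(\Omega_++\alpha^{-1}\Omega_-)=\tilde\Gamma_{\alpha^{-1}}$. 2. For $\omega\in\mathbb R\setminus\{0\}$, $\psi\in\mathbb R$ and each of the (complex) solutions $\lambda=\lambda_1,\lambda_2$ of $q^{-4}\omega\lambda^2-q^{-2}\omega\psi\lambda+1=0$: $\;\Gamma''_{\omega\psi}/(\Omega_++\lambda\Omega_-)=\tilde\Gamma'_{\lambda}$. 3. For $\varrho\in\mathbb R\setminus\{0,s^{-1}\}$, $\tau\in\mathbb R\setminus\{0\}$, $\lambda_1=q^2\tau/\varrho$, $\lambda_2=q^2(s\tau-q^2)/(s\varrho-1)$: $\;\Gamma'''_{\varrho\tau}/(\Omega_++\lambda_1\Omega_-)=\tilde\Gamma'_{\lambda_1}$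 and $\Gamma'''_{\varrho\tau}/(\Omega_++\lambda_2\Omega_-)=\tilde\Gamma''_{\lambda_2}$; moreover $\lambda_1=\lambda_2=q^4$ if $\tau=q^2\varrho$. 4. For $\varrho=s^{-1}$, $\tau\in\mathbb R\setminus\{0,q^2s^{-1}\}$, $\lambda_1=q^2\tau/\varrho$: $\;\Gamma'''_{\varrho\tau}/(\Omega_++\lambda_1\Omega_-)=\tilde\Gamma'_{\lambda_1}$ and $\Gamma'''_{\varrho\tau}/(\Omega_-)=\tilde\Gamma''_\infty$. 5. For $\varrho=q^{-2}\tau=s^{-1}$ and every $\lambda\in\mathbb R$: $\;\Gamma'''_{\varrho\tau}/(\Omega_++\lambda\Omega_-)=\tilde\Gamma''_\lambda$ and $\Gamma'''_{\varrho\tau}/(\Omega_-)=\tilde\Gamma''_\infty$. In 1, 3, 4 and 5, and in 2 whenever $\lambda$ is real, the factor calculus is a $*$-calculus. -/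

import Mathlib

open scoped TensorProduct BigOperators
open MulOpposite

universe u v

noncomputable section

namespace QSphere

/-! ## R-matrices.  Indices are `Fin N` (so index `i` stands for the classical index `i + 1`). -/

/-- `Q = q - q⁻¹`. -/
def bigQ (q : ℝ) : ℂ := (q : ℂ) - (q : ℂ)⁻¹

/-- `s₊ = ∑_{i=0}^{N-1} q^{2i}`. -/
def sPlus (N : ℕ) (q : ℝ) : ℝ := ∑ i ∈ Finset.range N, q ^ (2 * i)

/-- `s₊ - 1 = ∑_{i=1}^{N-1} q^{2i}`. -/
def sPrime (N : ℕ) (q : ℝ) : ℝ := sPlus N q - 1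

/-- The R-matrix; `rMat q i j k l` is `R^{ij}_{kl}`. -/
def rMat {N : ℕ} (q : ℝ) (i j k l : Fin N) : ℂ :=
  if i = l ∧ l ≠ k ∧ k = j then 1
  else if i = j ∧ j = k ∧ k = l then (q : ℂ)
  else if i = k ∧ k < j ∧ j = l then bigQ q
  else 0

/-- The inverse R-matrix. -/
def rInv {N : ℕ} (q : ℝ) (i j k l : Fin N) : ℂ :=
  if i = l ∧ l ≠ k ∧ k = j then 1
  else if i = j ∧ j = k ∧ k = l then (q : ℂ)⁻¹
  else if i = k ∧ j < k ∧ j = l then -bigQ q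
  else 0

/-- The matrix `R` for two conjugated indices: `Rᶜ^{ij}_{kl} = R^{lk}_{ji}`. -/
def rConj {N : ℕ} (q : ℝ) (i j k l : Fin N) : ℂ := rMat q l k j i

/-- `(Rˡ)⁻^{ij}_{kl} = q^{2l-2i} (R⁻)^{jl}_{ik}`. -/
def rLeftInv {N : ℕ} (q : ℝ) (i j k l : Fin N) : ℂ :=
  (q : ℂ) ^ (2 * (l : ℤ) - 2 * (i : ℤ)) * rInv q j l i k

/-- `(Rʳ)^{ij}_{kl} = R^{ki}_{lj}`. -/
def rRight {N : ℕ} (q : ℝ) (i j k l : Fin N) : ℂ := rMat q k i l j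

/-! ## The quantum sphere -/

/-- The generators: `Sum.inl i` is `z_i`, `Sum.inr i` is `z_i^*`. -/
abbrev Gen (N : ℕ) : Type := Fin N ⊕ Fin N

/-- `z_i` in the free algebra. -/
def fz {N : ℕ} (i : Fin N) : FreeAlgebra ℂ (Gen N) := FreeAlgebra.ι ℂ (Sum.inl i)

/-- `z_i^*` in the free algebra. -/
def fzs {N : ℕ} (i : Fin N) : FreeAlgebra ℂ (Gen N) := FreeAlgebra.ι ℂ (Sum.inr i)

/-- The defining relations of the quantum sphere `S_q^{2N-1}`. -/
inductive SphereRel (N : ℕ) (q : ℝ) :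
    FreeAlgebra ℂ (Gen N) → FreeAlgebra ℂ (Gen N) → Prop
  | zz (i j : Fin N) (h : i < j) : SphereRel N q (fz i * fz j) ((q : ℂ) • (fz j * fz i))
  | ss (i j : Fin N) (h : i < j) : SphereRel N q (fzs j * fzs i) ((q : ℂ) • (fzs i * fzs j))
  | zs (i j : Fin N) (h : i ≠ j) : SphereRel N q (fz i * fzs j) ((q : ℂ) • (fzs j * fz i))
  | diag (i : Fin N) : SphereRel N q
      (fz i * fzs i - fzs i * fz i
        + ((q : ℂ)⁻¹ * bigQ q) • ∑ k ∈ Finset.univ.filter (fun k => i < k), fz k * fzs k) 0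
  | sphere : SphereRel N q (∑ i, fz i * fzs i) 1

/-- The algebra `X = S_q^{2N-1}`. -/
def Sphere (N : ℕ) (q : ℝ) : Type := RingQuot (SphereRel N q)

instance (N : ℕ) (q : ℝ) : Ring (Sphere N q) := inferInstanceAs (Ring (RingQuot (SphereRel N q)))

instance (N : ℕ) (q : ℝ) : Algebra ℂ (Sphere N q) :=
  inferInstanceAs (Algebra ℂ (RingQuot (SphereRel N q)))

namespace Sphere

variable {N : ℕ} {q : ℝ}

/-- The canonical map from the free algebra. -/
def mk (N : ℕ) (q : ℝ) : FreeAlgebra ℂ (Gen N) →ₐ[ℂ] Sphere N q :=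
  RingQuot.mkAlgHom ℂ (SphereRel N q)

/-- The generators of the quantum sphere. -/
def gen (N : ℕ) (q : ℝ) (g : Gen N) : Sphere N q := mk N q (FreeAlgebra.ι ℂ g)

/-- The generator `z_i`. -/
def z (q : ℝ) (i : Fin N) : Sphere N q := gen N q (Sum.inl i)

/-- The generator `z_i^*`. -/
def zs (q : ℝ) (i : Fin N) : Sphere N q := gen N q (Sum.inr i)

theorem mk_rel {a b : FreeAlgebra ℂ (Gen N)} (h : SphereRel N q a b) : mk N q a = mk N q b :=
  RingQuot.mkAlgHom_rel ℂ h

theorem mk_fz (i : Fin N) : mk N q (fz i) = z q i := rfl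

theorem mk_fzs (i : Fin N) : mk N q (fzs i) = zs q i := rfl

theorem hom_ext {B : Type*} [Semiring B] [Algebra ℂ B] (f g : Sphere N q →ₐ[ℂ] B)
    (h : ∀ x, f (gen N q x) = g (gen N q x)) : f = g := by
  refine RingQuot.ringQuot_ext' ℂ f g ?_
  exact FreeAlgebra.hom_ext (funext h)

/-- The opposite algebra with complex-conjugated scalar multiplication; algebra maps into it are
the conjugate-linear antimultiplicative maps. -/
def ConjOp (N : ℕ) (q : ℝ) : Type := (Sphere N q)ᵐᵒᵖ

instance : Ring (ConjOp N q) := inferInstanceAs (Ring (Sphere N q)ᵐᵒᵖ)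

instance : Algebra ℂ (ConjOp N q) :=
  Algebra.compHom (Sphere N q)ᵐᵒᵖ (starRingEnd ℂ)

/-- An element of the sphere as an element of `ConjOp`. -/
def toConj (x : Sphere N q) : ConjOp N q := (op x : (Sphere N q)ᵐᵒᵖ)

/-- An element of `ConjOp` as an element of the sphere. -/
def ofConj (x : ConjOp N q) : Sphere N q := unop (x : (Sphere N q)ᵐᵒᵖ)

theorem toConj_smul (c : ℂ) (x : Sphere N q) :
    c • toConj x = toConj (starRingEnd ℂ c • x) := rfl

theorem toConj_mul (x y : Sphere N q) : toConj x * toConj y = toConj (y * x) := rfl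

theorem toConj_add (x y : Sphere N q) : toConj x + toConj y = toConj (x + y) := rfl

theorem toConj_sub (x y : Sphere N q) : toConj x - toConj y = toConj (x - y) := rfl

theorem toConj_sum {ι : Type*} (s : Finset ι) (f : ι → Sphere N q) :
    ∑ k ∈ s, toConj (f k) = toConj (∑ k ∈ s, f k) :=
  (map_sum (opAddEquiv : Sphere N q ≃+ (Sphere N q)ᵐᵒᵖ) _ _).symm

/-- The star operation on the free algebra, with values in the sphere. -/
def starPre (N : ℕ) (q : ℝ) : FreeAlgebra ℂ (Gen N) →ₐ[ℂ] ConjOp N q :=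
  FreeAlgebra.lift ℂ (fun g : Gen N => toConj (gen N q g.swap))

theorem starPre_fz (i : Fin N) : starPre N q (fz i) = toConj (zs q i) := by
  rw [starPre, fz, FreeAlgebra.lift_ι_apply]; rfl

theorem starPre_fzs (i : Fin N) : starPre N q (fzs i) = toConj (z q i) := by
  rw [starPre, fzs, FreeAlgebra.lift_ι_apply]; rfl

theorem conj_bigQ (q : ℝ) : starRingEnd ℂ (bigQ q) = bigQ q := by
  simp [bigQ]

theorem starPre_rel {a b : FreeAlgebra ℂ (Gen N)} (h : SphereRel N q a b) :
    starPre N q a = starPre N q b := by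
  have key := mk_rel h
  cases h with
  | zz i j h =>
    have := mk_rel (SphereRel.ss (q := q) i j h)
    simp only [map_mul, map_smul, mk_fzs] at this
    simp only [map_mul, map_smul, starPre_fz, toConj_mul, toConj_smul, Complex.conj_ofReal, this]
  | ss i j h =>
    have := mk_rel (SphereRel.zz (q := q) i j h)
    simp only [map_mul, map_smul, mk_fz] at this
    simp only [map_mul, map_smul, starPre_fzs, toConj_mul, toConj_smul, Complex.conj_ofReal, this]
  | zs i j h =>
    have := mk_rel (SphereRel.zs (q := q) j i h.symm)
    simp only [map_mul, map_smul, mk_fz, mk_fzs] at this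
    simp only [map_mul, map_smul, starPre_fz, starPre_fzs, toConj_mul, toConj_smul,
      Complex.conj_ofReal, this]
  | diag i =>
    simp only [map_add, map_sub, map_mul, map_smul, map_sum, map_zero, mk_fz, mk_fzs] at key
    simp only [map_add, map_sub, map_mul, map_smul, map_sum, map_zero, starPre_fz, starPre_fzs,
      toConj_mul, toConj_smul, toConj_sum, toConj_add, toConj_sub, Complex.conj_ofReal, map_inv₀,
      conj_bigQ, key]
    rfl
  | sphere =>
    simp only [map_sum, map_mul, map_one, mk_fz, mk_fzs] at key
    simp only [map_sum, map_mul, map_one, starPre_fz, starPre_fzs, toConj_mul, toConj_sum, key]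
    rfl

/-- The star operation as a conjugate-linear antimultiplicative map. -/
def starHom (N : ℕ) (q : ℝ) : Sphere N q →ₐ[ℂ] ConjOp N q :=
  RingQuot.liftAlgHom ℂ ⟨starPre N q, fun _ _ h => starPre_rel h⟩

/-- The underlying function of the star operation. -/
def starFun (x : Sphere N q) : Sphere N q := ofConj (starHom N q x)

theorem starFun_gen (g : Gen N) : starFun (gen N q g) = gen N q g.swap := by
  have h : starHom N q (gen N q g) = starPre N q (FreeAlgebra.ι ℂ g) :=
    RingQuot.liftAlgHom_mkAlgHom_apply ℂ (starPre N q) (fun _ _ h => starPre_rel h) _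
  rw [starFun, h, starPre, FreeAlgebra.lift_ι_apply]; rfl

theorem starFun_add (x y : Sphere N q) : starFun (x + y) = starFun x + starFun y :=
  congrArg ofConj (map_add (starHom N q) x y)

theorem starFun_mul (x y : Sphere N q) : starFun (x * y) = starFun y * starFun x :=
  congrArg ofConj (map_mul (starHom N q) x y)

theorem starFun_smul (c : ℂ) (x : Sphere N q) :
    starFun (c • x) = starRingEnd ℂ c • starFun x :=
  congrArg ofConj (map_smul (starHom N q) c x)

theorem starFun_one : starFun (1 : Sphere N q) = 1 :=
  congrArg ofConj (map_one (starHom N q))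

theorem starFun_zero : starFun (0 : Sphere N q) = 0 :=
  congrArg ofConj (map_zero (starHom N q))

/-- The star operation applied twice, as an algebra map. -/
def starTwice (N : ℕ) (q : ℝ) : Sphere N q →ₐ[ℂ] Sphere N q where
  toFun x := starFun (starFun x)
  map_one' := by simp only [starFun_one]
  map_mul' x y := by simp only [starFun_mul]
  map_zero' := by simp only [starFun_zero]
  map_add' x y := by simp only [starFun_add]
  commutes' c := by
    simp only [Algebra.algebraMap_eq_smul_one, starFun_smul, starFun_one, Complex.conj_conj]

theorem starFun_starFun (x : Sphere N q) : starFun (starFun x) = x := by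
  have : starTwice N q = AlgHom.id ℂ _ := by
    apply hom_ext
    intro g
    change starFun (starFun _) = _
    simp only [starFun_gen, Sum.swap_swap]; rfl
  exact congrArg (fun f : Sphere N q →ₐ[ℂ] Sphere N q => f x) this

/-- The star structure of the quantum sphere: `star z_i = z_i^*`. -/
instance : StarRing (Sphere N q) where
  star := starFun
  star_involutive := starFun_starFun
  star_mul := starFun_mul
  star_add := starFun_add

instance : StarModule ℂ (Sphere N q) where
  star_smul c x := starFun_smul c x

theorem star_z (i : Fin N) : star (z q i) = zs q i := starFun_gen _

theorem star_zs (i : Fin N) : star (zs q i) = z q i := starFun_gen _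

end Sphere

/-! ## The coordinate algebra of the quantum group `SU_q(N)` -/

/-- Generators: `Sum.inl (i, j)` is `u^i_j`, `Sum.inr (i, j)` is `S(u^i_j)`. -/
abbrev GenSU (N : ℕ) : Type := (Fin N × Fin N) ⊕ (Fin N × Fin N)

/-- `u^i_j` in the free algebra. -/
def fu {N : ℕ} (i j : Fin N) : FreeAlgebra ℂ (GenSU N) := FreeAlgebra.ι ℂ (Sum.inl (i, j))

/-- `S(u^i_j)` in the free algebra. -/
def fv {N : ℕ} (i j : Fin N) : FreeAlgebra ℂ (GenSU N) := FreeAlgebra.ι ℂ (Sum.inr (i, j))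

/-- The `q`-antisymmetric tensor: `(-q)^{ℓ(k)}` if `k` is a permutation, and `0` otherwise. -/
def qEps {N : ℕ} (q : ℝ) (k : Fin N → Fin N) : ℂ :=
  if Function.Injective k then
    (-(q : ℂ)) ^ (Finset.univ.filter
      (fun p : Fin N × Fin N => p.1 < p.2 ∧ k p.2 < k p.1)).card
  else 0

/-- The relations of `SU_q(N)`: `R u₁ u₂ = u₁ u₂ R`, the entries `S(u^i_j)` form the inverse of the
matrix `u`, and the quantum determinant is `1`.  The case `k = id` of `det` says
`∑_σ (-q)^{ℓ(σ)} u^1_{σ(1)} ⋯ u^N_{σ(N)} = 1`; the other cases express the same fact for permuted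
and for repeated rows. -/
inductive SURel (N : ℕ) (q : ℝ) :
    FreeAlgebra ℂ (GenSU N) → FreeAlgebra ℂ (GenSU N) → Prop
  | rtt (i j k l : Fin N) : SURel N q
      (∑ a, ∑ b, rMat q i j a b • (fu a k * fu b l))
      (∑ a, ∑ b, rMat q a b k l • (fu i a * fu j b))
  | mul_inv (i j : Fin N) : SURel N q (∑ a, fu i a * fv a j) (if i = j then 1 else 0)
  | inv_mul (i j : Fin N) : SURel N q (∑ a, fv i a * fu a j) (if i = j then 1 else 0)
  | det (k : Fin N → Fin N) : SURel N q
      (∑ m : Fin N → Fin N, qEps q m • (List.ofFn (fun p => fu (k p) (m p))).prod)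
      (qEps q k • (1 : FreeAlgebra ℂ (GenSU N)))

/-- The algebra `A` of the quantum group `SU_q(N)`. -/
def SUq (N : ℕ) (q : ℝ) : Type := RingQuot (SURel N q)

instance (N : ℕ) (q : ℝ) : Ring (SUq N q) := inferInstanceAs (Ring (RingQuot (SURel N q)))

instance (N : ℕ) (q : ℝ) : Algebra ℂ (SUq N q) :=
  inferInstanceAs (Algebra ℂ (RingQuot (SURel N q)))

namespace SUq

variable {N : ℕ}

/-- `u^i_j`. -/
def mat (q : ℝ) (i j : Fin N) : SUq N q := RingQuot.mkAlgHom ℂ (SURel N q) (fu i j)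

/-- `S(u^i_j)`. -/
def inv (q : ℝ) (i j : Fin N) : SUq N q := RingQuot.mkAlgHom ℂ (SURel N q) (fv i j)

/-- `Δ` is the comultiplication: `Δ(u^i_j) = ∑ u^i_a ⊗ u^a_j`. -/
def IsComul {q : ℝ} (Δ : SUq N q →ₐ[ℂ] SUq N q ⊗[ℂ] SUq N q) : Prop :=
  (∀ i j, Δ (mat q i j) = ∑ a, mat q i a ⊗ₜ[ℂ] mat q a j) ∧
  (∀ i j, Δ (inv q i j) = ∑ a, inv q a j ⊗ₜ[ℂ] inv q i a)

/-- `ε` is the counit. -/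
def IsCounit {q : ℝ} (ε : SUq N q →ₐ[ℂ] ℂ) : Prop :=
  (∀ i j, ε (mat q i j) = if i = j then 1 else 0) ∧
  (∀ i j, ε (inv q i j) = if i = j then 1 else 0)

/-- `δ` is the right coaction on the sphere: `δ(z_i) = ∑ z_j ⊗ u^j_i`,
`δ(z_i^*) = ∑ z_j^* ⊗ S(u^i_j)`. -/
def IsCoaction {q : ℝ} (δ : Sphere N q →ₐ[ℂ] Sphere N q ⊗[ℂ] SUq N q) : Prop :=
  (∀ i, δ (Sphere.z q i) = ∑ j, Sphere.z q j ⊗ₜ[ℂ] mat q j i) ∧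
  (∀ i, δ (Sphere.zs q i) = ∑ j, Sphere.zs q j ⊗ₜ[ℂ] inv q i j)

end SUq

/-! ## First order differential calculi -/

/-- A first order differential calculus on a complex algebra `X`: an `X`-bimodule with a derivation
`d` such that the `x • d y` span it.  The right action of `y` is `op y • ω`. -/
structure FODC (X : Type v) [Ring X] [Algebra ℂ X] where
  /-- the space of one-forms -/
  form : Type u
  [grp : AddCommGroup form]
  [modC : Module ℂ form]
  [modL : Module X form]
  [modR : Module Xᵐᵒᵖ form]
  [bimod : SMulCommClass X Xᵐᵒᵖ form]
  [towL : IsScalarTower ℂ X form]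
  [towR : IsScalarTower ℂ Xᵐᵒᵖ form]
  /-- the differential -/
  d : X →ₗ[ℂ] form
  leibniz : ∀ x y, d (x * y) = op y • d x + x • d y
  span_eq_top : Submodule.span ℂ (Set.range fun p : X × X => p.1 • d p.2) = ⊤

namespace FODC

attribute [instance] grp modC modL modR bimod towL towR

section General

variable {X : Type v} [Ring X] [Algebra ℂ X]

/-- Isomorphism of first order differential calculi: a bimodule isomorphism respecting `d`. -/
def Isomorphic (C D : FODC.{u} X) : Prop :=
  ∃ e : C.form ≃ₗ[X] D.form,
    (∀ (x : X) (w : C.form), e (op x • w) = op x • e w) ∧ ∀ x, e (C.d x) = D.d x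

/-- `*`-calculus: `∑ x_k d y_k = 0` implies `∑ d(y_k^*) x_k^* = 0`. -/
def IsStarCalculus [StarRing X] (C : FODC.{u} X) : Prop :=
  ∀ (n : ℕ) (x y : Fin n → X), ∑ k, x k • C.d (y k) = 0 →
    ∑ k, op (star (x k)) • C.d (star (y k)) = 0

/-- The sub-bimodule generated by a one-form `ω`, as the left submodule spanned by the `ω y`. -/
def subBimodule (C : FODC.{u} X) (ω : C.form) : Submodule X C.form :=
  Submodule.span X (Set.range fun y : X => op y • ω)

/-- Right multiplication as a left linear map. -/
def rmul (C : FODC.{u} X) (y : Xᵐᵒᵖ) : C.form →ₗ[X] C.form where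
  toFun w := y • w
  map_add' := smul_add y
  map_smul' x w := (smul_comm x y w).symm

theorem subBimodule_le (C : FODC.{u} X) (ω : C.form) (y : Xᵐᵒᵖ) :
    C.subBimodule ω ≤ (C.subBimodule ω).comap (C.rmul y) := by
  refine Submodule.span_le.2 ?_
  rintro _ ⟨x, rfl⟩
  refine Submodule.subset_span ⟨x * unop y, ?_⟩
  change op (x * unop y) • ω = y • op x • ω
  rw [smul_smul]
  rfl

/-- Right multiplication on the quotient. -/
def quotRmul (C : FODC.{u} X) (ω : C.form) (y : Xᵐᵒᵖ) :
    (C.form ⧸ C.subBimodule ω) →ₗ[X] (C.form ⧸ C.subBimodule ω) :=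
  (C.subBimodule ω).mapQ (C.subBimodule ω) (C.rmul y) (C.subBimodule_le ω y)

/-- The right module structure on the quotient by a sub-bimodule. -/
abbrev quotModule (C : FODC.{u} X) (ω : C.form) :
    Module Xᵐᵒᵖ (C.form ⧸ C.subBimodule ω) where
  smul y w := C.quotRmul ω y w
  one_smul w := by
    obtain ⟨w, rfl⟩ := Submodule.Quotient.mk_surjective _ w
    exact congrArg Submodule.Quotient.mk (one_smul Xᵐᵒᵖ w)
  mul_smul a b w := by
    obtain ⟨w, rfl⟩ := Submodule.Quotient.mk_surjective _ w
    exact congrArg Submodule.Quotient.mk (mul_smul a b w)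
  smul_zero a := map_zero (C.quotRmul ω a)
  smul_add a := map_add (C.quotRmul ω a)
  add_smul a b w := by
    obtain ⟨w, rfl⟩ := Submodule.Quotient.mk_surjective _ w
    exact congrArg Submodule.Quotient.mk (add_smul a b w)
  zero_smul w := by
    obtain ⟨w, rfl⟩ := Submodule.Quotient.mk_surjective _ w
    exact congrArg Submodule.Quotient.mk (zero_smul Xᵐᵒᵖ w)

/-- The induced differential on the quotient. -/
def quotD (C : FODC.{u} X) (ω : C.form) : X →ₗ[ℂ] (C.form ⧸ C.subBimodule ω) :=
  ((C.subBimodule ω).mkQ.restrictScalars ℂ) ∘ₗ C.d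

theorem quotD_span (C : FODC.{u} X) (ω : C.form) :
    Submodule.span ℂ (Set.range fun p : X × X => p.1 • C.quotD ω p.2) = ⊤ := by
  have hs : LinearMap.range ((C.subBimodule ω).mkQ.restrictScalars ℂ) = ⊤ :=
    LinearMap.range_eq_top.2 (Submodule.mkQ_surjective (C.subBimodule ω))
  have h := congrArg (Submodule.map ((C.subBimodule ω).mkQ.restrictScalars ℂ)) C.span_eq_top
  rw [Submodule.map_span, ← Set.range_comp, Submodule.map_top, hs] at h
  exact h

/-- Factorisation of a calculus by the relation `ω = 0`: the quotient by the sub-bimodule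
generated by `ω`, with the induced differential. -/
def factor (C : FODC.{u} X) (ω : C.form) : FODC.{u} X :=
  letI := C.quotModule ω
  { form := C.form ⧸ C.subBimodule ω
    bimod := ⟨fun x y w => ((C.quotRmul ω y).map_smul x w).symm⟩
    towR := ⟨fun c y w => by
      obtain ⟨w, rfl⟩ := Submodule.Quotient.mk_surjective _ w
      exact congrArg Submodule.Quotient.mk (smul_assoc c y w)⟩
    d := C.quotD ω
    leibniz := fun x y => congrArg Submodule.Quotient.mk (C.leibniz x y)
    span_eq_top := C.quotD_span ω }

/-- The left action `X × form → form` as a bilinear map. -/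
def actL (C : FODC.{u} X) : X →ₗ[ℂ] C.form →ₗ[ℂ] C.form :=
  (Algebra.lsmul ℂ ℂ C.form : X →ₐ[ℂ] Module.End ℂ C.form).toLinearMap

/-- The right action as a bilinear map. -/
def actR (C : FODC.{u} X) : X →ₗ[ℂ] C.form →ₗ[ℂ] C.form :=
  (Algebra.lsmul ℂ ℂ C.form : Xᵐᵒᵖ →ₐ[ℂ] Module.End ℂ C.form).toLinearMap ∘ₗ
    (opLinearEquiv ℂ : X ≃ₗ[ℂ] Xᵐᵒᵖ).toLinearMap

/-- The left action of `X ⊗ A` on `form ⊗ A`. -/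
def tensorActL (C : FODC.{u} X) (A : Type*) [Ring A] [Algebra ℂ A] :
    X ⊗[ℂ] A →ₗ[ℂ] C.form ⊗[ℂ] A →ₗ[ℂ] C.form ⊗[ℂ] A :=
  TensorProduct.map₂ C.actL (LinearMap.mul ℂ A)

/-- The right action of `X ⊗ A` on `form ⊗ A`. -/
def tensorActR (C : FODC.{u} X) (A : Type*) [Ring A] [Algebra ℂ A] :
    X ⊗[ℂ] A →ₗ[ℂ] C.form ⊗[ℂ] A →ₗ[ℂ] C.form ⊗[ℂ] A :=
  TensorProduct.map₂ C.actR (LinearMap.mul ℂ A).flip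

end General

/-! ### Calculi on the quantum sphere -/

variable {N : ℕ} {q : ℝ}

/-- Covariance with respect to `SU_q(N)`: there is a coaction `Φ` on the one-forms which is
compatible with the coaction `δ` on the sphere, the bimodule structure and the differential.  The
maps `Δ`, `ε`, `δ` are determined by their values on generators. -/
def IsCovariant (C : FODC.{u} (Sphere N q)) : Prop :=
  ∃ (Δ : SUq N q →ₐ[ℂ] SUq N q ⊗[ℂ] SUq N q) (ε : SUq N q →ₐ[ℂ] ℂ)
    (δ : Sphere N q →ₐ[ℂ] Sphere N q ⊗[ℂ] SUq N q)
    (Φ : C.form →ₗ[ℂ] C.form ⊗[ℂ] SUq N q),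
    SUq.IsComul Δ ∧ SUq.IsCounit ε ∧ SUq.IsCoaction δ ∧
    (∀ w, TensorProduct.assoc ℂ C.form (SUq N q) (SUq N q)
        (LinearMap.rTensor (SUq N q) Φ (Φ w)) =
      LinearMap.lTensor C.form Δ.toLinearMap (Φ w)) ∧
    (∀ w, TensorProduct.rid ℂ C.form (LinearMap.lTensor C.form ε.toLinearMap (Φ w)) = w) ∧
    (∀ (x y : Sphere N q) (w : C.form), Φ (x • op y • w) =
      C.tensorActL (SUq N q) (δ x) (C.tensorActR (SUq N q) (δ y) (Φ w))) ∧
    (∀ x, Φ (C.d x) = LinearMap.rTensor (SUq N q) C.d (δ x))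

/-- `Ω₊ = ∑ z_i d z_i^*`. -/
def omegaPlus (C : FODC.{u} (Sphere N q)) : C.form :=
  ∑ i, Sphere.z q i • C.d (Sphere.zs q i)

/-- `Ω₋ = ∑ q^{-2i} z_i^* d z_i`, the classical index being `i + 1`. -/
def omegaMinus (C : FODC.{u} (Sphere N q)) : C.form :=
  ∑ i : Fin N, (q : ℂ) ^ (-2 * ((i : ℤ) + 1)) • (Sphere.zs q i • C.d (Sphere.z q i))

/-- The invariant one-form `μ Ω₊ + ν Ω₋`. -/
def omega (C : FODC.{u} (Sphere N q)) (μ ν : ℂ) : C.form :=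
  μ • C.omegaPlus + ν • C.omegaMinus

end FODC

/-- Coefficients of a bimodule structure; the numbers `1, 2, 3, 4` refer to the products
`dz_k z_l`, `dz_k^* z_l^*`, `dz_k z_l^*`, `dz_k^* z_l`. Omitted coefficients are `0`. -/
structure Coeffs where
  a1 : ℂ
  b1 : ℂ := 0
  c1 : ℂ := 0
  e1 : ℂ := 0
  a2 : ℂ
  b2 : ℂ := 0
  c2 : ℂ := 0
  e2 : ℂ := 0
  a3 : ℂ
  b3 : ℂ := 0
  c3 : ℂ := 0
  d3 : ℂ := 0
  e3 : ℂ := 0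
  f3 : ℂ := 0
  a4 : ℂ
  b4 : ℂ := 0
  c4 : ℂ := 0
  d4 : ℂ := 0
  e4 : ℂ := 0
  f4 : ℂ := 0

namespace FODC

variable {N : ℕ} {q : ℝ}

open Sphere in
/-- The bimodule structure of `C` is given by the coefficients `κ`. -/
structure HasBimoduleStructure (C : FODC.{u} (Sphere N q)) (κ : Coeffs) : Prop where
  rel_zz : ∀ k l, op (z q l) • C.d (z q k) =
    κ.a1 • ∑ s, ∑ t, rInv q s t k l • (z q s • C.d (z q t))
      + κ.b1 • (z q k • C.d (z q l))
      + κ.c1 • ((z q k * z q l) • C.omegaPlus) + κ.e1 • ((z q k * z q l) • C.omegaMinus)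
  rel_ss : ∀ k l, op (zs q l) • C.d (zs q k) =
    κ.a2 • ∑ s, ∑ t, rConj q s t k l • (zs q s • C.d (zs q t))
      + κ.b2 • (zs q k • C.d (zs q l))
      + κ.c2 • ((zs q k * zs q l) • C.omegaPlus) + κ.e2 • ((zs q k * zs q l) • C.omegaMinus)
  rel_zs : ∀ k l, op (zs q l) • C.d (z q k) =
    κ.a3 • ∑ s, ∑ t, rLeftInv q s t k l • (zs q s • C.d (z q t))
      + κ.b3 • (z q k • C.d (zs q l))
      + κ.c3 • ((z q k * zs q l) • C.omegaPlus) + κ.e3 • ((z q k * zs q l) • C.omegaMinus)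
      + (if k = l then (q : ℂ) ^ (2 * ((k : ℕ) + 1)) else 0) •
          (κ.d3 • C.omegaPlus + κ.f3 • C.omegaMinus)
  rel_sz : ∀ k l, op (z q l) • C.d (zs q k) =
    κ.a4 • ∑ s, ∑ t, rRight q s t k l • (z q s • C.d (zs q t))
      + κ.b4 • (zs q k • C.d (z q l))
      + κ.c4 • ((zs q k * z q l) • C.omegaPlus) + κ.e4 • ((zs q k * z q l) • C.omegaMinus)
      + (if k = l then (1 : ℂ) else 0) • (κ.d4 • C.omegaPlus + κ.f4 • C.omegaMinus)

/-- The differentials of the generators `z_i, z_i^*`. -/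
def dgen (C : FODC.{u} (Sphere N q)) (g : Gen N) : C.form := C.d (Sphere.gen N q g)

/-- `C` is the calculus with bimodule structure `κ` for which `{dz_i, dz_i^*}` is a free left
module basis.  These data determine `C` up to isomorphism; covariance and the `*`-property are not
required here. -/
structure IsFreeCalculus (C : FODC.{u} (Sphere N q)) (κ : Coeffs) : Prop where
  linearIndependent : LinearIndependent (Sphere N q) C.dgen
  span_dgen : Submodule.span (Sphere N q) (Set.range C.dgen) = ⊤
  bimodule : C.HasBimoduleStructure κ

/-- The coefficient family of `μ Ω₊ + ν Ω₋` with respect to `dz_i, dz_i^*`. -/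
def omegaVec (N : ℕ) (q : ℝ) (μ ν : ℂ) : Gen N → Sphere N q
  | Sum.inl i => (ν * (q : ℂ) ^ (-2 * ((i : ℤ) + 1))) • Sphere.zs q i
  | Sum.inr i => μ • Sphere.z q i

/-- `C` is the covariant calculus with bimodule structure `κ` which is generated as a left module
by `{dz_i, dz_i^*}` and in which all left module relations between these generators are
generated by the single relation `μ Ω₊ + ν Ω₋ = 0`. -/
structure IsOneRelationCalculus (C : FODC.{u} (Sphere N q)) (μ ν : ℂ) (κ : Coeffs) : Prop where
  covariant : C.IsCovariant
  span_dgen : Submodule.span (Sphere N q) (Set.range C.dgen) = ⊤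
  relations : LinearMap.ker (Fintype.linearCombination (Sphere N q) C.dgen) =
    Submodule.span (Sphere N q) {omegaVec N q μ ν}
  bimodule : C.HasBimoduleStructure κ

/-- The factorisation `C / (μ Ω₊ + ν Ω₋)` is the calculus with bimodule structure `κ` and the
single left module relation `μ Ω₊ + ν Ω₋ = 0`: it has the characterising properties of that
calculus, and it is isomorphic to every calculus which has them. -/
def FactorEq (C : FODC.{u} (Sphere N q)) (μ ν : ℂ) (κ : Coeffs) : Prop :=
  (C.factor (C.omega μ ν)).IsOneRelationCalculus μ ν κ ∧
  ∀ D : FODC.{u} (Sphere N q), D.IsOneRelationCalculus μ ν κ →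
    (C.factor (C.omega μ ν)).Isomorphic D

/-- The factorisation `C / (μ Ω₊ + ν Ω₋)` is a `*`-calculus. -/
def FactorStar (C : FODC.{u} (Sphere N q)) (μ ν : ℂ) : Prop :=
  (C.factor (C.omega μ ν)).IsStarCalculus

end FODC

/-! ## The families of calculi -/

/-- `Γ_{ατ}`. -/
def coeffGamma (N : ℕ) (q α τ : ℝ) : Coeffs where
  a1 := q * α
  b1 := q ^ 2 * α - 1
  c1 := q ^ 2 * α ^ 2 * (1 - sPrime N q * τ)
  e1 := q ^ 2 * (1 - α * sPrime N q * τ)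
  a2 := (q : ℂ)⁻¹ * (α : ℂ)⁻¹
  b2 := ((q : ℂ) ^ 2)⁻¹ * (α : ℂ)⁻¹ - 1
  c2 := 1 - sPrime N q * τ
  e2 := ((α : ℂ) ^ 2)⁻¹ * (1 - α * sPrime N q * τ)
  a3 := (q : ℂ)⁻¹ * (α : ℂ)⁻¹
  b3 := q ^ 2 * α - 1
  c3 := -(q ^ 2 * α * (1 - sPlus N q * τ))
  d3 := -(α * τ)
  e3 := -((α : ℂ)⁻¹ * (1 - q ^ 2 * α * sPlus N q * τ))
  f3 := -τ
  a4 := q * α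
  b4 := ((q : ℂ) ^ 2)⁻¹ * (α : ℂ)⁻¹ - 1
  c4 := -(q ^ 2 * α * (1 - sPlus N q * τ))
  d4 := -(q ^ (2 * N) * α * τ)
  e4 := -((α : ℂ)⁻¹ * (1 - q ^ 2 * α * sPlus N q * τ))
  f4 := -(q ^ (2 * N) * τ)

/-- `Γ'_{αω}` for real `α`. -/
def coeffGamma' (q α ω : ℝ) : Coeffs where
  a1 := q * α
  b1 := q ^ 2 * α - 1
  c1 := ω
  e1 := (α : ℂ)⁻¹ * ω - q ^ 2 * (α - 1)
  a2 := (q : ℂ)⁻¹ * (α : ℂ)⁻¹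
  b2 := ((q : ℂ) ^ 2)⁻¹ * (α : ℂ)⁻¹ - 1
  c2 := q ^ 2 * α * (ω : ℂ)⁻¹ - ((α : ℂ)⁻¹ - 1)
  e2 := q ^ 2 * (ω : ℂ)⁻¹
  a3 := (q : ℂ)⁻¹ * (α : ℂ)⁻¹
  b3 := q ^ 2 * α - 1
  c3 := -(q ^ 2 * α)
  e3 := -(α : ℂ)⁻¹
  a4 := q * α
  b4 := ((q : ℂ) ^ 2)⁻¹ * (α : ℂ)⁻¹ - 1
  c4 := -(q ^ 2 * α)
  e4 := -(α : ℂ)⁻¹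

/-- `Γ''_{ωψ}`. -/
def coeffGamma'' (q ω ψ : ℝ) : Coeffs where
  a1 := (q : ℂ)⁻¹
  c1 := ω
  e1 := q ^ 2 * ω * ψ - 1
  a2 := q
  c2 := ψ - q ^ 2
  e2 := q ^ 2 * (ω : ℂ)⁻¹
  a3 := q
  c3 := -1
  e3 := -q ^ 2
  a4 := (q : ℂ)⁻¹
  c4 := -1
  e4 := -q ^ 2

/-- `Γ'''_{ϱτ}`. -/
def coeffGamma''' (N : ℕ) (q ϱ τ : ℝ) : Coeffs where
  a1 := (q : ℂ)⁻¹
  c1 := -(((q : ℂ) ^ 2)⁻¹ * (ϱ / τ) * (sPrime N q * ϱ - 1))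
  e1 := -(ϱ / τ * (sPrime N q * τ - q ^ 2))
  a2 := q
  c2 := -(τ / ϱ * (sPrime N q * ϱ - 1))
  e2 := -(q ^ 2 * (τ / ϱ) * (sPrime N q * τ - q ^ 2))
  a3 := q
  c3 := sPlus N q * ϱ - 1
  d3 := -(((q : ℂ) ^ 2)⁻¹ * ϱ)
  e3 := q ^ 2 * (sPlus N q * τ - 1)
  f3 := -τ
  a4 := (q : ℂ)⁻¹
  c4 := sPlus N q * ϱ - 1
  d4 := -(q ^ (2 * N - 2) * ϱ)
  e4 := q ^ 2 * (sPlus N q * τ - 1)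
  f4 := -(q ^ (2 * N) * τ)

/-- `Γ̃_λ`, with relation `Ω₊ + lam Ω₋ = 0`. -/
def coeffTilde (q : ℝ) (lam : ℂ) : Coeffs where
  a1 := q * lam⁻¹
  b1 := q ^ 2 * lam⁻¹ - 1
  c1 := q ^ 2 * lam⁻¹ * (lam⁻¹ - 1)
  a2 := (q : ℂ)⁻¹ * lam
  b2 := ((q : ℂ) ^ 2)⁻¹ * lam - 1
  c2 := -(lam - 1)
  a3 := (q : ℂ)⁻¹ * lam
  b3 := q ^ 2 * lam⁻¹ - 1
  c3 := -(q ^ 2 * lam⁻¹ - 1)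
  a4 := q * lam⁻¹
  b4 := ((q : ℂ) ^ 2)⁻¹ * lam - 1
  c4 := -(q ^ 2 * lam⁻¹ - 1)

/-- `Γ̃'_λ`, with relation `Ω₊ + lam Ω₋ = 0`. -/
def coeffTilde' (q : ℝ) (lam : ℂ) : Coeffs where
  a1 := (q : ℂ)⁻¹
  c1 := -(lam⁻¹ * (q ^ 4 * lam⁻¹ - 1))
  a2 := q
  c2 := -(((q : ℂ) ^ 2)⁻¹ * lam * (q ^ 4 * lam⁻¹ - 1))
  a3 := q
  c3 := q ^ 2 * lam⁻¹ - 1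
  a4 := (q : ℂ)⁻¹
  c4 := q ^ 2 * lam⁻¹ - 1

/-- `Γ̃''_λ` for `lam ≠ 0, ∞`, with relation `Ω₊ + lam Ω₋ = 0`. -/
def coeffTilde''Generic (N : ℕ) (q : ℝ) (lam : ℂ) : Coeffs where
  a1 := (q : ℂ)⁻¹
  a2 := q
  a3 := q
  c3 := -((sPrime N q : ℂ)⁻¹ * (q ^ (2 * N + 2) * lam⁻¹ - 1))
  d3 := ((q : ℂ) ^ 2)⁻¹ * (sPrime N q : ℂ)⁻¹ * (q ^ 4 * lam⁻¹ - 1)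
  a4 := (q : ℂ)⁻¹
  c4 := -((sPrime N q : ℂ)⁻¹ * (q ^ (2 * N + 2) * lam⁻¹ - 1))
  d4 := q ^ (2 * N - 2) * (sPrime N q : ℂ)⁻¹ * (q ^ 4 * lam⁻¹ - 1)

/-- `Γ̃''_0`, with relation `Ω₊ = 0`. -/
def coeffTilde''Zero (N : ℕ) (q : ℝ) : Coeffs where
  a1 := (q : ℂ)⁻¹
  a2 := q
  a3 := q
  e3 := q ^ (2 * N + 2) * (sPrime N q : ℂ)⁻¹
  f3 := -(q ^ 2 * (sPrime N q : ℂ)⁻¹)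
  a4 := (q : ℂ)⁻¹
  e4 := q ^ (2 * N + 2) * (sPrime N q : ℂ)⁻¹
  f4 := -(q ^ (2 * N + 2) * (sPrime N q : ℂ)⁻¹)

open Classical in
/-- `Γ̃''_λ` for complex `lam`, with relation `Ω₊ + lam Ω₋ = 0`. -/
def coeffTilde'' (N : ℕ) (q : ℝ) (lam : ℂ) : Coeffs :=
  if lam = 0 then coeffTilde''Zero N q else coeffTilde''Generic N q lam

/-- `Γ̃''_∞`, with relation `Ω₋ = 0`. -/
def coeffTilde''Inf (N : ℕ) (q : ℝ) : Coeffs where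
  a1 := (q : ℂ)⁻¹
  a2 := q
  a3 := q
  c3 := (sPrime N q : ℂ)⁻¹
  d3 := -(((q : ℂ) ^ 2)⁻¹ * (sPrime N q : ℂ)⁻¹)
  a4 := (q : ℂ)⁻¹
  c4 := (sPrime N q : ℂ)⁻¹
  d4 := -(q ^ (2 * N - 2) * (sPrime N q : ℂ)⁻¹)

end QSphere

end

set_option linter.unusedSimpArgs false

noncomputable section

namespace QSphere

variable {N : ℕ} {q : ℝ}

/-! Right multiplication by `z_l` or `z_l^*` sends each of the forms Ω₊, Ω₋ to a combination of `z_l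
Ω₊`, `z_l Ω₋`, `dz_l` (respectively with `z_l^*`). This follows from the R-matrix form of the sphere
relations together with `∑ z_i z_i^* = 1` and `∑ q^{-2i} z_i^* z_i = 1` (indices from 0). Hence `Ω =
μ Ω₊ + ν Ω₋` generates a sub-bimodule already as a left module as soon as the `dz_l`-terms cancel
and (μ, ν) is an eigenvector of the remaining 2×2 matrices; these scalar conditions are
`Coeffs.Generates`. For Γ and Γ' the `dz_l`-terms select `λ = α⁻¹`. For Γ'' and Γ''' these terms are
absent and the eigenvector condition is a quadratic equation in λ. For Γ''' its roots are λ₁ and λ₂;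
at `ϱ = s⁻¹` the second root moves to ∞, and at `ϱ = q⁻²τ = s⁻¹` the equation becomes void, so every
λ is allowed.

If the condition holds, the quotient of a free calculus has the one relation `Ω = 0` between the
differentials of the generators (`relations_factor`). Multiples of this relation may be used to
rewrite the table of commutation rules (`Coeffs.EquivMod`), which produces the table of the target
calculus (`IsFreeCalculus.factor_isPresented`). It then suffices to study calculi given by
generators, one relation and a table (`IsPresented`).

Uniqueness: the relation determines the left module, the table determines the right action on
generators, and the Leibniz rule determines d (`IsPresented.isomorphic`).

Covariance: the coaction is prescribed on the free left module by its values on differentials of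
generators. It descends because Ω is coinvariant, and it respects the right action because each
coefficient matrix of the table intertwines the corresponding products of `u` and `S(u)`
(`IsPresented.isCovariant`). These intertwiners come from the RTT relation by cancelling `u` against
`S(u)` and by inverting matrices.

The `*`-property: a map J reversing left and right multiplication is prescribed on the free module
by `J(dg) = d(g^*)`. Differentiating the two sphere identities gives `J Ω± = -Ω±`, so for real μ, ν
it descends. What remains is `J(dg h) = h^* d(g^*)` for generators; putting both sides in normal
order reduces it to the scalar identities `Coeffs.IsStar`. -/

/-! ### Tail sums and explicit entries of the R-matrices. -/

theorem sum_tail_succ {M : Type*} [AddCommMonoid M] (f : Fin N → M) (n : ℕ) (hn : n < N) :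
    (∑ i : Fin N, if n ≤ (i : ℕ) then f i else 0) =
      f ⟨n, hn⟩ + ∑ i : Fin N, if n + 1 ≤ (i : ℕ) then f i else 0 := by
  have h : ∀ i : Fin N, (if n ≤ (i : ℕ) then f i else 0) =
      (if i = ⟨n, hn⟩ then f i else 0) + (if n + 1 ≤ (i : ℕ) then f i else 0) := by
    intro i
    by_cases h1 : i = ⟨n, hn⟩
    · subst h1; simp
    · have h2 : (i : ℕ) ≠ n := fun h => h1 (Fin.ext h)
      by_cases h3 : n ≤ (i : ℕ)
      · have : n + 1 ≤ (i : ℕ) := by omega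
        simp [h1, h3, this]
      · have : ¬ n + 1 ≤ (i : ℕ) := by omega
        simp [h1, h3, this]
  simp only [h, Finset.sum_add_distrib, Finset.sum_ite_eq', Finset.mem_univ, if_true]

/-- Tail sums are determined by their downward recursion. -/
theorem sum_tail_eq {M : Type*} [AddCommMonoid M] (f : Fin N → M) (g : ℕ → M) (hN : g N = 0)
    (hg : ∀ (n : ℕ) (hn : n < N), g n = f ⟨n, hn⟩ + g (n + 1)) (n : ℕ) (hn : n ≤ N) :
    (∑ i : Fin N, if n ≤ (i : ℕ) then f i else 0) = g n := by
  induction hn using Nat.decreasingInduction with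
  | self =>
    rw [hN]
    refine Finset.sum_eq_zero fun i _ => if_neg (by omega)
  | of_succ k hk ih => rw [sum_tail_succ f k hk, ih, hg k hk]

theorem sum_lt_eq {M : Type*} [AddCommMonoid M] (f : Fin N → M) (g : ℕ → M) (hN : g N = 0)
    (hg : ∀ (n : ℕ) (hn : n < N), g n = f ⟨n, hn⟩ + g (n + 1)) (l : Fin N) :
    (∑ i : Fin N, if l < i then f i else 0) = g (l + 1) := by
  rw [← sum_tail_eq f g hN hg (l + 1) l.2]
  rfl

theorem sum_all_eq {M : Type*} [AddCommMonoid M] (f : Fin N → M) (g : ℕ → M) (hN : g N = 0)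
    (hg : ∀ (n : ℕ) (hn : n < N), g n = f ⟨n, hn⟩ + g (n + 1)) :
    (∑ i : Fin N, f i) = g 0 := by
  rw [← sum_tail_eq f g hN hg 0 (Nat.zero_le _)]
  simp

/-- The weight `q^{2i}`. -/
def wt (q : ℝ) (i : Fin N) : ℂ := (q : ℂ) ^ (2 * (i : ℕ))

theorem wt_ne_zero (hq : q ≠ 0) (i : Fin N) : wt q i ≠ 0 :=
  pow_ne_zero _ (by exact_mod_cast hq)

/-- Additive form with nested conditionals, so that double sums against the matrix collapse by
evaluating Kronecker deltas. -/
theorem rMat_eq (i j k l : Fin N) : rMat q i j k l =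
    (if k = j then if l = i then if i = j then (q : ℂ) else 1 else 0 else 0) +
    (if k = i then if l = j then if i < j then bigQ q else 0 else 0 else 0) := by
  grind [rMat]

theorem rInv_eq (i j k l : Fin N) : rInv q i j k l =
    (if k = j then if l = i then if i = j then (q : ℂ)⁻¹ else 1 else 0 else 0) +
    (if k = i then if l = j then if j < i then -bigQ q else 0 else 0 else 0) := by
  grind [rInv]

/-- This is the Hecke condition `R - R⁻ = Q · id`; it transfers intertwining properties from R to
its inverse. -/
theorem rInv_eq_rMat (i j k l : Fin N) : rInv q i j k l =
    rMat q i j k l - (if k = i then if l = j then bigQ q else 0 else 0) := by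
  rw [rInv_eq, rMat_eq]
  have : bigQ q = (q : ℂ) - (q : ℂ)⁻¹ := rfl
  rcases lt_trichotomy i j with h | h | h
  · have h1 : ¬ j < i := not_lt.2 h.le
    split_ifs <;> simp_all
  · subst h
    split_ifs <;> simp_all
  · have h1 : ¬ i < j := not_lt.2 h.le
    split_ifs <;> simp_all

theorem rRight_eq (s t k l : Fin N) : rRight q s t k l =
    (if k = l then if s = t then if s = k then (q : ℂ) else if k < s then bigQ q else 0 else 0
      else if s = l then if t = k then 1 else 0 else 0) := by
  grind [rRight, rMat]

theorem rLeftInv_eq (hq : q ≠ 0) (s t k l : Fin N) : rLeftInv q s t k l =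
    (if k = l then if s = t then if s = k then (q : ℂ)⁻¹
        else if k < s then - (bigQ q * wt q k * (wt q s)⁻¹) else 0 else 0
      else if s = l then if t = k then 1 else 0 else 0) := by
  have hq' : (q : ℂ) ≠ 0 := by exact_mod_cast hq
  have hw : ∀ a b : Fin N, (q : ℂ) ^ (2 * (a : ℤ) - 2 * (b : ℤ)) = wt q a * (wt q b)⁻¹ := by
    intro a b
    rw [zpow_sub₀ hq', wt, wt, div_eq_mul_inv]
    norm_cast
  have := mul_inv_cancel₀ (wt_ne_zero hq s)
  rw [rLeftInv, hw, rInv]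
  grind

theorem rConj_eq (s t k l : Fin N) : rConj q s t k l =
    (if t = k then if s = l then if k = l then (q : ℂ) else 1 else 0 else 0) +
    (if t = l then if s = k then if l < k then bigQ q else 0 else 0 else 0) := by
  rw [rConj, rMat_eq]
  simp only [eq_comm (a := l) (b := k)]

section RSums

variable {M : Type*} [AddCommGroup M] [Module ℂ M]

theorem sum_rMat_left (k l : Fin N) (f : Fin N → Fin N → M) :
    ∑ a, ∑ b, rMat q a b k l • f a b =
      (if k = l then (q : ℂ) else 1) • f l k + (if k < l then bigQ q else 0) • f k l := by
  simp only [rMat_eq, add_smul, ite_smul, zero_smul, Finset.sum_add_distrib, Finset.sum_ite_eq,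
    Finset.mem_univ, if_true, Finset.sum_ite_irrel, Finset.sum_const_zero]
  simp only [eq_comm (a := l) (b := k)]

theorem sum_rInv (k l : Fin N) (f : Fin N → Fin N → M) :
    ∑ s, ∑ t, rInv q s t k l • f s t =
      (if k = l then (q : ℂ)⁻¹ else 1) • f l k - (if l < k then bigQ q else 0) • f k l := by
  simp only [rInv_eq, add_smul, ite_smul, zero_smul, Finset.sum_add_distrib, Finset.sum_ite_eq,
    Finset.mem_univ, if_true, Finset.sum_ite_irrel, Finset.sum_const_zero]
  simp only [eq_comm (a := l) (b := k), neg_smul, sub_eq_add_neg]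
  split_ifs <;> simp

theorem sum_rConj (k l : Fin N) (f : Fin N → Fin N → M) :
    ∑ s, ∑ t, rConj q s t k l • f s t =
      (if k = l then (q : ℂ) else 1) • f l k + (if l < k then bigQ q else 0) • f k l := by
  rw [Finset.sum_comm]
  simp only [rConj_eq, add_smul, ite_smul, zero_smul, Finset.sum_add_distrib, Finset.sum_ite_eq',
    Finset.mem_univ, if_true, Finset.sum_ite_irrel, Finset.sum_const_zero]

theorem sum_rRight (k l : Fin N) (f : Fin N → Fin N → M) :
    ∑ s, ∑ t, rRight q s t k l • f s t =
      if k = l then (q : ℂ) • f k k + ∑ s, if k < s then bigQ q • f s s else 0 else f l k := by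
  by_cases h : k = l
  · subst h
    have hz : ∀ (p : Prop) [Decidable p] (c : ℂ) (x : M),
        (if p then c else 0) • x = if p then c • x else 0 := by
      intro p _ c x; split_ifs <;> simp
    have h1 : ∀ s : Fin N, (if s = k then (q : ℂ) else if k < s then bigQ q else 0) • f s s =
        (if s = k then (q : ℂ) • f k k else 0) + if k < s then bigQ q • f s s else 0 := by
      intro s
      by_cases hs : s = k
      · subst hs; simp
      · simp [hs]
    simp only [rRight_eq, if_true, hz, Finset.sum_ite_eq, Finset.mem_univ, h1,
      Finset.sum_add_distrib, Finset.sum_ite_eq']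
  · simp [rRight_eq, h, ite_smul, Finset.sum_ite_irrel]

theorem sum_rLeftInv (hq : q ≠ 0) (k l : Fin N) (f : Fin N → Fin N → M) :
    ∑ s, ∑ t, rLeftInv q s t k l • f s t =
      if k = l then (q : ℂ)⁻¹ • f k k -
        ∑ s, (if k < s then (bigQ q * wt q k * (wt q s)⁻¹) • f s s else 0) else f l k := by
  by_cases h : k = l
  · subst h
    have hz : ∀ (p : Prop) [Decidable p] (c : ℂ) (x : M),
        (if p then c else 0) • x = if p then c • x else 0 := by
      intro p _ c x; split_ifs <;> simp
    have h1 : ∀ s : Fin N, (if s = k then (q : ℂ)⁻¹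
        else if k < s then - (bigQ q * wt q k * (wt q s)⁻¹) else 0) • f s s =
        (if s = k then (q : ℂ)⁻¹ • f k k else 0) -
          if k < s then (bigQ q * wt q k * (wt q s)⁻¹) • f s s else 0 := by
      intro s
      by_cases hs : s = k
      · subst hs; simp
      · by_cases h2 : k < s <;> simp [hs, h2]
    simp only [rLeftInv_eq hq, if_true, hz, Finset.sum_ite_eq, Finset.mem_univ, h1,
      Finset.sum_sub_distrib, Finset.sum_ite_eq']
  · simp [rLeftInv_eq hq, h, ite_smul, Finset.sum_ite_irrel]

end RSums

/-! ### Inverse pairs and partial traces of the R-matrices. -/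

/-- Off the diagonal both matrices are flips. On the diagonal both are triangular, and the only
entries that are not immediate, those with `k < s`, vanish by a telescoping geometric sum. -/
theorem sum_rRight_mul_rLeftInv (hq : q ≠ 0) (k l s t : Fin N) :
    ∑ a, ∑ b, rRight q a b k l * rLeftInv q s t a b = if k = s ∧ l = t then 1 else 0 := by
  have hq' : (q : ℂ) ≠ 0 := by exact_mod_cast hq
  have hs := wt_ne_zero hq s
  have := sum_rRight (q := q) k l (fun a b => rLeftInv q s t a b)
  simp only [smul_eq_mul] at this
  rw [this]
  by_cases hkl : k = l
  · subst hkl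
    rw [if_pos rfl]
    by_cases hst : s = t
    · subst hst
      rcases lt_trichotomy s k with h | h | h
      · rw [rLeftInv_eq hq, Finset.sum_eq_zero]
        · simp [h.ne, h.ne', h.not_gt]
        · intro a _
          split_ifs with ha
          · rw [rLeftInv_eq hq]
            simp [(h.trans ha).ne, (h.trans ha).not_gt]
          · rfl
      · subst h
        rw [Finset.sum_eq_zero]
        · simp [rLeftInv_eq hq, hq']
        · intro a _
          split_ifs with ha
          · rw [rLeftInv_eq hq]
            simp [ha.ne, ha.not_gt]
          · rfl
      -- Closed form of the tail from n: it starts with `Q q⁻¹` at `n = s`, and each step downwards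
      -- adds a term `-Q² q^{2n-2s}`, where `q⁻¹(1 - q²) = -Q`.
      · rw [sum_lt_eq _ (fun n : ℕ => if n ≤ (s : ℕ) then
            bigQ q * (q : ℂ)⁻¹ * (q : ℂ) ^ (2 * n) * (wt q s)⁻¹ else 0)]
        · have h1 : (k : ℕ) + 1 ≤ (s : ℕ) := h
          rw [rLeftInv_eq hq, if_pos h1]
          simp only [h.ne', h, h.ne, if_true, if_false, false_and]
          rw [wt, pow_mul, pow_mul]
          field_simp
          ring
        · rw [if_neg]; have := s.2; omega
        · intro n hn
          rw [rLeftInv_eq hq]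
          have hsn : s = (⟨n, hn⟩ : Fin N) ↔ (s : ℕ) = n := by rw [Fin.ext_iff]
          have hns : (⟨n, hn⟩ : Fin N) < s ↔ n < (s : ℕ) := Iff.rfl
          simp only [hsn, hns, if_true]
          rcases lt_trichotomy n (s : ℕ) with h1 | h1 | h1
          · have h2 : n + 1 ≤ (s : ℕ) := h1
            simp only [h1, h1.le, h1.ne', h2, if_true, if_false]
            rw [show wt q (⟨n, hn⟩ : Fin N) = (q : ℂ) ^ (2 * n) from rfl, mul_add, pow_add]
            generalize (wt q s)⁻¹ = w
            rw [bigQ]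
            field_simp
            ring
          · have h2 : ¬ n + 1 ≤ (s : ℕ) := by omega
            have h3 : (q : ℂ) ^ (2 * n) = wt q s := by rw [wt, h1]
            rw [if_pos h1.le, if_pos h1.symm, if_neg h2, h3, add_zero, mul_assoc,
              mul_inv_cancel₀ hs, mul_one]
          · have h2 : ¬ n ≤ (s : ℕ) := by omega
            have h3 : ¬ n + 1 ≤ (s : ℕ) := by omega
            have h4 : ¬ n < (s : ℕ) := by omega
            simp [h1.ne, h2, h3, h4]
    · have h1 : ¬ (k = s ∧ k = t) := fun h => hst (h.1.symm.trans h.2)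
      simp [rLeftInv_eq hq, hst, h1]
  · rw [if_neg hkl, rLeftInv_eq hq, if_neg (Ne.symm hkl)]
    grind

theorem sum_rLeftInv_mul_rRight (hq : q ≠ 0) (k l s t : Fin N) :
    ∑ a, ∑ b, rLeftInv q a b k l * rRight q s t a b = if k = s ∧ l = t then 1 else 0 := by
  -- A one-sided inverse of a finite square matrix is two-sided, so no second summation is needed.
  let T : Matrix (Fin N × Fin N) (Fin N × Fin N) ℂ := fun x y => rRight q y.1 y.2 x.1 x.2
  let S : Matrix (Fin N × Fin N) (Fin N × Fin N) ℂ := fun x y => rLeftInv q y.1 y.2 x.1 x.2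
  have h : T * S = 1 := by
    ext x y
    rw [Matrix.mul_apply, Fintype.sum_prod_type, sum_rRight_mul_rLeftInv hq, Matrix.one_apply]
    simp only [Prod.ext_iff]
  have h2 := congrFun (congrFun (mul_eq_one_comm.1 h : S * T = 1) (k, l)) (s, t)
  rw [Matrix.mul_apply, Fintype.sum_prod_type, Matrix.one_apply] at h2
  simpa only [Prod.mk.injEq] using h2

/-- The sum telescopes because `Q q^{2a} = q⁻¹ (q^{2(a+1)} - q^{2a})`. -/
theorem sum_lt_bigQ_wt (hq : q ≠ 0) (k : Fin N) :
    (∑ a, if k < a then bigQ q * wt q a else 0) =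
      (q : ℂ)⁻¹ * (q : ℂ) ^ (2 * N) - q * wt q k := by
  have hq' : (q : ℂ) ≠ 0 := by exact_mod_cast hq
  rw [sum_lt_eq _ (fun n : ℕ => (q : ℂ)⁻¹ * ((q : ℂ) ^ (2 * N) - (q : ℂ) ^ (2 * n)))]
  · rw [wt, mul_add, pow_add]; field_simp; try ring
  · simp
  · intro n hn
    rw [wt, bigQ, mul_add, pow_add]; field_simp; ring

theorem sum_lt_bigQ_wt_inv (hq : q ≠ 0) (k : Fin N) :
    (∑ a, if k < a then bigQ q * (wt q a)⁻¹ else 0) =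
      (q : ℂ)⁻¹ * (wt q k)⁻¹ - q * ((q : ℂ) ^ (2 * N))⁻¹ := by
  have hq' : (q : ℂ) ≠ 0 := by exact_mod_cast hq
  rw [sum_lt_eq _ (fun n : ℕ => (q : ℂ) * (((q : ℂ) ^ (2 * n))⁻¹ - ((q : ℂ) ^ (2 * N))⁻¹))]
  · rw [wt, mul_add, pow_add]; field_simp; try ring
  · simp
  · intro n hn
    rw [wt, bigQ, mul_add, pow_add]
    generalize ((q : ℂ) ^ (2 * N))⁻¹ = c
    field_simp; ring

theorem sum_gt_bigQ_wt (hq : q ≠ 0) (k : Fin N) :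
    (∑ a, if a < k then bigQ q * wt q a else 0) = (q : ℂ)⁻¹ * wt q k - (q : ℂ)⁻¹ := by
  have hq' : (q : ℂ) ≠ 0 := by exact_mod_cast hq
  have h := sum_all_eq (fun a : Fin N => bigQ q * wt q a)
    (fun n : ℕ => (q : ℂ)⁻¹ * ((q : ℂ) ^ (2 * N) - (q : ℂ) ^ (2 * n))) (by simp) (by
      intro n hn
      rw [wt, bigQ, mul_add, pow_add]; field_simp; ring)
  have h1 : ∀ a : Fin N, bigQ q * wt q a = (if a < k then bigQ q * wt q a else 0) +
      (if a = k then bigQ q * wt q a else 0) + (if k < a then bigQ q * wt q a else 0) := by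
    intro a
    rcases lt_trichotomy a k with h | h | h
    · simp [h, h.ne, h.not_gt]
    · simp [h]
    · simp [h, h.ne', h.not_gt]
  rw [Finset.sum_congr rfl fun a _ => h1 a] at h
  simp only [Finset.sum_add_distrib, Finset.sum_ite_eq', Finset.mem_univ, if_true,
    sum_lt_bigQ_wt hq, mul_zero, pow_zero] at h
  rw [eq_sub_iff_add_eq]
  have h2 : bigQ q = q - (q : ℂ)⁻¹ := rfl
  linear_combination h - wt q k * h2

/-- This and `sum_rLeftInv_upper` are the partial traces from which the weights `q^{±2i}` arise,
both in the antipode identities and in the behaviour of the Kronecker delta terms under the star. -/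
theorem sum_rLeftInv_lower (hq : q ≠ 0) (j n : Fin N) :
    ∑ x, rLeftInv q x x j n =
      if j = n then (q : ℂ) * ((q : ℂ) ^ (2 * N))⁻¹ * wt q j else 0 := by
  have h := sum_rLeftInv hq j n (fun s t => if s = t then (1 : ℂ) else 0)
  simp only [smul_eq_mul, mul_ite, mul_one, mul_zero, Finset.sum_ite_eq, Finset.mem_univ, if_true]
    at h
  rw [h]
  split_ifs with h1 h2
  · have h3 := sum_lt_bigQ_wt_inv hq j
    have h4 : ∀ s : Fin N, (if j < s then bigQ q * wt q j * (wt q s)⁻¹ else 0) =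
        wt q j * if j < s then bigQ q * (wt q s)⁻¹ else 0 := by
      intro s; split_ifs <;> ring
    simp only [h4, ← Finset.mul_sum, h3]
    have := wt_ne_zero hq j
    have hq' : (q : ℂ) ≠ 0 := by exact_mod_cast hq
    field_simp
    ring
  · exact absurd h2.symm h1
  · rfl

theorem sum_rLeftInv_upper (hq : q ≠ 0) (m k : Fin N) :
    ∑ p, rLeftInv q m k p p = if m = k then (q : ℂ)⁻¹ * (wt q m)⁻¹ else 0 := by
  split_ifs with h
  · subst h
    have h1 : ∀ p : Fin N, rLeftInv q m m p p = (if p = m then (q : ℂ)⁻¹ else 0) -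
        (wt q m)⁻¹ * if p < m then bigQ q * wt q p else 0 := by
      intro p
      rw [rLeftInv_eq hq]
      rcases lt_trichotomy p m with h | h | h
      · simp [h, h.ne, h.ne']; ring
      · simp [h]
      · simp [h.ne, h.ne', h.not_gt]
    simp only [h1, Finset.sum_sub_distrib, Finset.sum_ite_eq', Finset.mem_univ, if_true,
      ← Finset.mul_sum, sum_gt_bigQ_wt hq]
    have := wt_ne_zero hq m
    have hq' : (q : ℂ) ≠ 0 := by exact_mod_cast hq
    field_simp
    ring
  · refine Finset.sum_eq_zero fun p _ => ?_
    simp [rLeftInv_eq hq, h]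

theorem sum_comm_pair {ι κ M : Type*} [Fintype ι] [Fintype κ] [AddCommMonoid M]
    (F : ι → ι → κ → κ → M) :
    ∑ a, ∑ b, ∑ s, ∑ t, F a b s t = ∑ s, ∑ t, ∑ a, ∑ b, F a b s t := by
  have h := Finset.sum_comm (s := Finset.univ) (t := Finset.univ)
    (f := fun (x : ι × ι) (y : κ × κ) => F x.1 x.2 y.1 y.2)
  simpa only [Fintype.sum_prod_type] using h

/-- A family of coefficients intertwining `P` commutes with the coaction given by `P`. -/
theorem sum_tmul_intertwine {M A : Type*} [AddCommGroup M] [Module ℂ M] [Ring A] [Algebra ℂ A]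
    {R : Fin N → Fin N → Fin N → Fin N → ℂ} {P P' : Fin N → Fin N → Fin N → Fin N → A}
    (hP : ∀ s t k l, ∑ a, ∑ b, R s t a b • P a b k l = ∑ a, ∑ b, R a b k l • P' s t a b)
    (e : Fin N → Fin N → M) (k l : Fin N) :
    ∑ a, ∑ b, (∑ s, ∑ t, R s t a b • e s t) ⊗ₜ[ℂ] P a b k l =
      ∑ s, ∑ t, R s t k l • ∑ a, ∑ b, e a b ⊗ₜ[ℂ] P' a b s t := by
  simp only [TensorProduct.sum_tmul, Finset.smul_sum]
  rw [sum_comm_pair, sum_comm_pair (fun a b s t => R a b k l • e s t ⊗ₜ[ℂ] P' s t a b)]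
  refine Finset.sum_congr rfl fun s _ => Finset.sum_congr rfl fun t _ => ?_
  simp only [TensorProduct.smul_tmul, ← TensorProduct.tmul_smul, ← TensorProduct.tmul_sum, hP]

/-! ### The quantum group: structure maps and intertwiners. -/

namespace SUq

theorem rtt (i j k l : Fin N) :
    ∑ a, ∑ b, rMat q i j a b • (mat q a k * mat q b l) =
      ∑ a, ∑ b, rMat q a b k l • (mat q i a * mat q j b) := by
  have h := RingQuot.mkAlgHom_rel ℂ (SURel.rtt (q := q) i j k l)
  simp only [map_sum, map_smul, map_mul] at h
  exact h

theorem sum_mat_mul_inv (i j : Fin N) :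
    ∑ a, mat q i a * inv q a j = if i = j then 1 else 0 := by
  have h := RingQuot.mkAlgHom_rel ℂ (SURel.mul_inv (q := q) i j)
  simp only [map_sum, map_mul, apply_ite (RingQuot.mkAlgHom ℂ (SURel N q)), map_one, map_zero] at h
  exact h

theorem sum_inv_mul_mat (i j : Fin N) :
    ∑ a, inv q i a * mat q a j = if i = j then 1 else 0 := by
  have h := RingQuot.mkAlgHom_rel ℂ (SURel.inv_mul (q := q) i j)
  simp only [map_sum, map_mul, apply_ite (RingQuot.mkAlgHom ℂ (SURel N q)), map_one, map_zero] at h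
  exact h

theorem det (k : Fin N → Fin N) :
    ∑ m : Fin N → Fin N, qEps q m • (List.ofFn (fun p => mat q (k p) (m p))).prod =
      qEps q k • (1 : SUq N q) := by
  have h := RingQuot.mkAlgHom_rel ℂ (SURel.det (q := q) k)
  simp only [map_sum, map_smul, map_one, map_list_prod, List.map_ofFn] at h
  exact h

/-- Algebra maps out of `SUq`. -/
theorem exists_hom {B : Type*} [Ring B] [Algebra ℂ B] (U V : Fin N → Fin N → B)
    (hrtt : ∀ i j k l, ∑ a, ∑ b, rMat q i j a b • (U a k * U b l) =
      ∑ a, ∑ b, rMat q a b k l • (U i a * U j b))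
    (huv : ∀ i j, ∑ a, U i a * V a j = if i = j then 1 else 0)
    (hvu : ∀ i j, ∑ a, V i a * U a j = if i = j then 1 else 0)
    (hdet : ∀ k : Fin N → Fin N,
      ∑ m : Fin N → Fin N, qEps q m • (List.ofFn (fun p => U (k p) (m p))).prod =
        qEps q k • (1 : B)) :
    ∃ f : SUq N q →ₐ[ℂ] B, (∀ i j, f (mat q i j) = U i j) ∧ ∀ i j, f (inv q i j) = V i j := by
  let f0 : FreeAlgebra ℂ (GenSU N) →ₐ[ℂ] B :=
    FreeAlgebra.lift ℂ (Sum.elim (fun p => U p.1 p.2) (fun p => V p.1 p.2))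
  have hu : ∀ i j, f0 (fu i j) = U i j := fun i j => by
    simp only [f0, fu, FreeAlgebra.lift_ι_apply, Sum.elim_inl]
  have hv : ∀ i j, f0 (fv i j) = V i j := fun i j => by
    simp only [f0, fv, FreeAlgebra.lift_ι_apply, Sum.elim_inr]
  have hrel : ∀ ⦃a b⦄, SURel N q a b → f0 a = f0 b := by
    intro a b h
    cases h with
    | rtt i j k l => simpa only [map_sum, map_smul, map_mul, hu] using hrtt i j k l
    | mul_inv i j =>
      simpa only [map_sum, map_mul, hu, hv, apply_ite f0, map_one, map_zero] using huv i j
    | inv_mul i j =>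
      simpa only [map_sum, map_mul, hu, hv, apply_ite f0, map_one, map_zero] using hvu i j
    | det k =>
      simpa only [map_sum, map_smul, map_one, map_list_prod, List.map_ofFn, Function.comp_def, hu]
        using hdet k
  refine ⟨RingQuot.liftAlgHom ℂ ⟨f0, hrel⟩, fun i j => ?_, fun i j => ?_⟩
  · exact (RingQuot.liftAlgHom_mkAlgHom_apply ℂ f0 hrel _).trans (hu i j)
  · exact (RingQuot.liftAlgHom_mkAlgHom_apply ℂ f0 hrel _).trans (hv i j)

theorem prod_ofFn_sum {B ι : Type*} [Semiring B] [Fintype ι] (n : ℕ) (F : Fin n → ι → B) :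
    (List.ofFn fun p => ∑ a, F p a).prod =
      ∑ m : Fin n → ι, (List.ofFn fun p => F p (m p)).prod := by
  induction n with
  | zero => simp
  | succ n ih =>
    rw [List.ofFn_succ, List.prod_cons, ih, Finset.sum_mul_sum,
      ← (Fin.consEquiv fun _ : Fin (n + 1) => ι).sum_comp, Fintype.sum_prod_type]
    simp [Fin.consEquiv, List.ofFn_succ]

theorem prod_ofFn_tmul {A B : Type*} [Ring A] [Ring B] [Algebra ℂ A] [Algebra ℂ B] (n : ℕ)
    (x : Fin n → A) (y : Fin n → B) :
    (List.ofFn fun p => x p ⊗ₜ[ℂ] y p).prod = (List.ofFn x).prod ⊗ₜ[ℂ] (List.ofFn y).prod := by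
  induction n with
  | zero => simp [Algebra.TensorProduct.one_def]
  | succ n ih => simp [List.ofFn_succ, ih]

theorem exists_comul (N : ℕ) (q : ℝ) :
    ∃ Δ : SUq N q →ₐ[ℂ] SUq N q ⊗[ℂ] SUq N q, IsComul Δ := by
  refine exists_hom (fun i j => ∑ a, mat q i a ⊗ₜ[ℂ] mat q a j)
    (fun i j => ∑ a, inv q a j ⊗ₜ[ℂ] inv q i a) ?_ ?_ ?_ ?_
  · intro i j k l
    have h1 : ∀ a b k l : Fin N,
        (∑ c, mat q a c ⊗ₜ[ℂ] mat q c k) * (∑ d, mat q b d ⊗ₜ[ℂ] mat q d l) =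
        ∑ c, ∑ d, (mat q a c * mat q b d) ⊗ₜ[ℂ] (mat q c k * mat q d l) := by
      intro a b k l
      simp only [Finset.sum_mul_sum, Algebra.TensorProduct.tmul_mul_tmul]
    -- RTT is applied once in each tensor leg: here in the second, and in the first by the rewriting
    -- with `← rtt` below.
    have h2 := sum_tmul_intertwine (rtt (N := N) (q := q))
      (fun a b => mat q i a * mat q j b) k l
    simp only [h1]
    rw [← h2]
    simp only [← rtt, TensorProduct.sum_tmul, Finset.smul_sum, TensorProduct.smul_tmul']
    rw [sum_comm_pair]
  · intro i j
    have h1 : ∀ a, (∑ c, mat q i c ⊗ₜ[ℂ] mat q c a) * (∑ d, inv q d j ⊗ₜ[ℂ] inv q a d) =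
        ∑ c, ∑ d, (mat q i c * inv q d j) ⊗ₜ[ℂ] (mat q c a * inv q a d) := by
      intro a
      simp only [Finset.sum_mul_sum, Algebra.TensorProduct.tmul_mul_tmul]
    simp only [h1]
    rw [Finset.sum_comm]
    simp only [Finset.sum_comm (s := Finset.univ) (t := Finset.univ)
      (f := fun (a d : Fin N) => (mat q i _ * inv q d j) ⊗ₜ[ℂ] (mat q _ a * inv q a d)),
      ← TensorProduct.tmul_sum, sum_mat_mul_inv, TensorProduct.tmul_ite,
      Finset.sum_ite_eq, Finset.mem_univ, if_true]
    rw [← TensorProduct.sum_tmul, sum_mat_mul_inv, TensorProduct.ite_tmul,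
      Algebra.TensorProduct.one_def]
  · intro i j
    have h1 : ∀ a, (∑ c, inv q c a ⊗ₜ[ℂ] inv q i c) * (∑ d, mat q a d ⊗ₜ[ℂ] mat q d j) =
        ∑ c, ∑ d, (inv q c a * mat q a d) ⊗ₜ[ℂ] (inv q i c * mat q d j) := by
      intro a
      simp only [Finset.sum_mul_sum, Algebra.TensorProduct.tmul_mul_tmul]
    simp only [h1]
    rw [Finset.sum_comm]
    simp only [Finset.sum_comm (s := Finset.univ) (t := Finset.univ)
      (f := fun (a d : Fin N) => (inv q _ a * mat q a d) ⊗ₜ[ℂ] (inv q i _ * mat q d j)),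
      ← TensorProduct.sum_tmul, sum_inv_mul_mat, TensorProduct.ite_tmul,
      Finset.sum_ite_eq, Finset.mem_univ, if_true]
    rw [← TensorProduct.tmul_sum, sum_inv_mul_mat, TensorProduct.tmul_ite,
      Algebra.TensorProduct.one_def]
  · intro k
    -- Expanding introduces an intermediate row tuple between `k` and `m`. Summing over `m` uses the
    -- determinant relation with that tuple as rows, and the remaining sum uses it for `k`. This is
    -- why the relation is needed for arbitrary, also repeated, rows.
    simp only [prod_ofFn_sum, prod_ofFn_tmul, Finset.smul_sum]
    rw [Finset.sum_comm]
    simp only [← TensorProduct.tmul_smul, ← TensorProduct.tmul_sum, det, Algebra.TensorProduct.one_def]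
    simp only [TensorProduct.tmul_smul, TensorProduct.smul_tmul', ← TensorProduct.sum_tmul, det]

theorem exists_counit (N : ℕ) (q : ℝ) : ∃ ε : SUq N q →ₐ[ℂ] ℂ, IsCounit ε := by
  refine exists_hom (fun i j => if i = j then 1 else 0) (fun i j => if i = j then 1 else 0) ?_ ?_ ?_ ?_
  · intro i j k l
    simp
  · intro i j; simp
  · intro i j; simp
  · intro k
    simp only [List.prod_ofFn]
    rw [Finset.sum_eq_single k]
    · simp
    · intro m _ hm
      obtain ⟨p, hp⟩ := Function.ne_iff.1 hm
      rw [Finset.prod_eq_zero (Finset.mem_univ p) (if_neg (Ne.symm hp)), smul_zero]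
    · simp

/-- Contraction with V cancels the left factor U. Together with `sum_sandwich_right` it converts
quadratic relations in `u` into relations involving `S(u)`. -/
theorem sum_sandwich_left {B : Type*} [Ring B] [Algebra ℂ B] {U V : Fin N → Fin N → B}
    (hvu : ∀ i j, ∑ a, V i a * U a j = if i = j then 1 else 0) (m : Fin N)
    (c : Fin N → Fin N → ℂ) (X : Fin N → B) :
    ∑ i, V m i * ∑ a, ∑ b, c a b • (U i a * X b) = ∑ b, c m b • X b := by
  have h : ∀ i, V m i * ∑ a, ∑ b, c a b • (U i a * X b) =
      ∑ a, ∑ b, c a b • ((V m i * U i a) * X b) := by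
    intro i
    simp only [Finset.mul_sum, mul_smul_comm, mul_assoc]
  simp only [h]
  rw [Finset.sum_comm]
  have h2 : ∀ a, ∑ i, ∑ b, c a b • ((V m i * U i a) * X b) =
      ∑ b, c a b • ((if m = a then 1 else 0) * X b) := by
    intro a
    rw [Finset.sum_comm]
    simp only [← Finset.smul_sum, ← Finset.sum_mul, hvu]
  simp only [h2, ite_mul, one_mul, zero_mul, smul_ite, smul_zero, Finset.sum_ite_irrel,
    Finset.sum_const_zero, Finset.sum_ite_eq, Finset.mem_univ, if_true]

theorem sum_sandwich_right {B : Type*} [Ring B] [Algebra ℂ B] {U V : Fin N → Fin N → B}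
    (huv : ∀ i j, ∑ a, U i a * V a j = if i = j then 1 else 0) (n : Fin N)
    (c : Fin N → Fin N → ℂ) (X : Fin N → B) :
    ∑ l, (∑ a, ∑ b, c a b • (X a * U b l)) * V l n = ∑ a, c a n • X a := by
  have h : ∀ l, (∑ a, ∑ b, c a b • (X a * U b l)) * V l n =
      ∑ a, ∑ b, c a b • (X a * (U b l * V l n)) := by
    intro l
    simp only [Finset.sum_mul, smul_mul_assoc, mul_assoc]
  simp only [h]
  rw [Finset.sum_comm]
  refine Finset.sum_congr rfl fun a _ => ?_
  rw [Finset.sum_comm]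
  simp only [← Finset.smul_sum, ← Finset.mul_sum, huv]
  simp

/-- The mixed relation between `S(u)` and `u`. -/
theorem rtt_mixed (m j k n : Fin N) :
    ∑ i, ∑ a, rMat q i j a n • (inv q m i * mat q a k) =
      ∑ b, ∑ l, rMat q m b k l • (mat q j b * inv q l n) := by
  -- The RTT relation is multiplied by `S(u)` on both sides. On one side of the relation this
  -- cancels the right factor, on the other the left factor.
  have h1 : ∑ i, ∑ l, inv q m i * (∑ a, ∑ b, rMat q i j a b • (mat q a k * mat q b l)) *
      inv q l n = ∑ i, ∑ a, rMat q i j a n • (inv q m i * mat q a k) := by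
    refine Finset.sum_congr rfl fun i _ => ?_
    simp only [mul_assoc, ← Finset.mul_sum]
    rw [sum_sandwich_right sum_mat_mul_inv n (fun a b => rMat q i j a b) (fun a => mat q a k)]
    simp only [Finset.mul_sum, mul_smul_comm]
  have h2 : ∑ l, ∑ i, inv q m i * (∑ a, ∑ b, rMat q a b k l • (mat q i a * mat q j b)) *
      inv q l n = ∑ l, ∑ b, rMat q m b k l • (mat q j b * inv q l n) := by
    refine Finset.sum_congr rfl fun l _ => ?_
    rw [← Finset.sum_mul,
      sum_sandwich_left sum_inv_mul_mat m (fun a b => rMat q a b k l) (fun b => mat q j b)]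
    simp only [Finset.sum_mul, smul_mul_assoc]
  rw [← h1, Finset.sum_comm (f := fun b l => rMat q m b k l • (mat q j b * inv q l n)), ← h2,
    Finset.sum_comm]
  simp only [rtt]

/-- The relation between the entries `S(u)`. -/
theorem rtt_inv (s m n p : Fin N) :
    ∑ i, ∑ j, rMat q i j p n • (inv q s j * inv q m i) =
      ∑ k, ∑ l, rMat q m s k l • (inv q l n * inv q k p) := by
  -- The same sandwich, applied to the mixed relation, removes the remaining factors `u`.
  have h1 : ∑ j, ∑ k, inv q s j * (∑ i, ∑ a, rMat q i j a n • (inv q m i * mat q a k)) *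
      inv q k p = ∑ j, ∑ i, rMat q i j p n • (inv q s j * inv q m i) := by
    refine Finset.sum_congr rfl fun j _ => ?_
    simp only [mul_assoc, ← Finset.mul_sum]
    rw [sum_sandwich_right sum_mat_mul_inv p (fun i a => rMat q i j a n) (fun i => inv q m i)]
    simp only [Finset.mul_sum, mul_smul_comm]
  have h2 : ∑ k, ∑ j, inv q s j * (∑ b, ∑ l, rMat q m b k l • (mat q j b * inv q l n)) *
      inv q k p = ∑ k, ∑ l, rMat q m s k l • (inv q l n * inv q k p) := by
    refine Finset.sum_congr rfl fun k _ => ?_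
    rw [← Finset.sum_mul,
      sum_sandwich_left sum_inv_mul_mat s (fun b l => rMat q m b k l) (fun l => inv q l n)]
    simp only [Finset.sum_mul, smul_mul_assoc]
  rw [Finset.sum_comm, ← h1, ← h2, Finset.sum_comm]
  simp only [rtt_mixed]

/-- By the Hecke condition `R⁻` differs from R by a multiple of the identity, which intertwines
trivially. -/
theorem rInv_intertwine (s t k l : Fin N) :
    ∑ a, ∑ b, rInv q s t a b • (mat q a k * mat q b l) =
      ∑ a, ∑ b, rInv q a b k l • (mat q s a * mat q t b) := by
  simp only [rInv_eq_rMat, sub_smul, Finset.sum_sub_distrib, rtt]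
  congr 1
  simp [Finset.sum_ite_irrel, ite_smul]

theorem rConj_intertwine (s t k l : Fin N) :
    ∑ a, ∑ b, rConj q s t a b • (inv q k a * inv q l b) =
      ∑ a, ∑ b, rConj q a b k l • (inv q a s * inv q b t) := by
  have h := rtt_inv (q := q) k l s t
  simp only [rConj]
  rw [Finset.sum_comm, h, Finset.sum_comm]

theorem rRight_intertwine (s t k l : Fin N) :
    ∑ a, ∑ b, rRight q s t a b • (inv q k a * mat q b l) =
      ∑ a, ∑ b, rRight q a b k l • (mat q s a * inv q b t) :=
  rtt_mixed k s l t

/-- The inverse of an intertwiner is an intertwiner in the opposite direction, and `rLeftInv` is the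
inverse of `rRight`. -/
theorem rLeftInv_intertwine (hq : q ≠ 0) (s t k l : Fin N) :
    ∑ a, ∑ b, rLeftInv q s t a b • (mat q a k * inv q l b) =
      ∑ a, ∑ b, rLeftInv q a b k l • (inv q a s * mat q t b) := by
  -- The argument is carried out with matrices over the noncommutative algebra indexed by pairs; the
  -- scalar matrices are embedded through `c`, whose values are central.
  let c : ℂ →+* SUq N q := algebraMap ℂ (SUq N q)
  let R : Matrix (Fin N × Fin N) (Fin N × Fin N) (SUq N q) :=
    Matrix.of fun x y => c (rRight q x.1 x.2 y.1 y.2)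
  let L : Matrix (Fin N × Fin N) (Fin N × Fin N) (SUq N q) :=
    Matrix.of fun x y => c (rLeftInv q x.1 x.2 y.1 y.2)
  let V : Matrix (Fin N × Fin N) (Fin N × Fin N) (SUq N q) :=
    Matrix.of fun x y => inv q y.1 x.1 * mat q x.2 y.2
  let U : Matrix (Fin N × Fin N) (Fin N × Fin N) (SUq N q) :=
    Matrix.of fun x y => mat q x.1 y.1 * inv q y.2 x.2
  have hsm : ∀ (r : ℂ) (x : SUq N q), c r * x = r • x := fun r x => (Algebra.smul_def r x).symm
  have hms : ∀ (r : ℂ) (x : SUq N q), x * c r = r • x := fun r x =>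
    (Algebra.commutes r x).symm.trans (hsm r x)
  have hRV : R * V = U * R := by
    ext x y
    simp only [Matrix.mul_apply, Fintype.sum_prod_type, R, U, V, Matrix.of_apply, hsm, hms]
    exact rRight_intertwine _ _ _ _
  have hLR : L * R = 1 := by
    ext x y
    have h := sum_rRight_mul_rLeftInv hq y.1 y.2 x.1 x.2
    simp only [Matrix.mul_apply, Fintype.sum_prod_type, R, L, Matrix.of_apply, Matrix.one_apply,
      ← map_mul,
      ← map_sum, mul_comm (rLeftInv _ _ _ _ _), h, Prod.ext_iff, apply_ite c, map_one, map_zero,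
      eq_comm]
  have hRL : R * L = 1 := by
    ext x y
    have h := sum_rLeftInv_mul_rRight hq y.1 y.2 x.1 x.2
    simp only [Matrix.mul_apply, Fintype.sum_prod_type, R, L, Matrix.of_apply, Matrix.one_apply,
      ← map_mul,
      ← map_sum, mul_comm (rRight _ _ _ _ _), h, Prod.ext_iff, apply_ite c, map_one, map_zero,
      eq_comm]
  have h : L * U = V * L := by
    calc L * U = L * (U * R) * L := by rw [mul_assoc, mul_assoc, hRL, mul_one]
      _ = V * L := by rw [← hRV, ← mul_assoc, hLR, one_mul]
  have h2 := congrFun (congrFun h (s, t)) (k, l)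
  simpa only [Matrix.mul_apply, Fintype.sum_prod_type, U, V, L, Matrix.of_apply, hsm, hms] using h2

/-- In the intertwining relation for `rLeftInv` the two upper indices are identified and summed. One
side collapses by `S(u) u = 1`, and on the other the partial trace supplies the weights. The
ordinary inverse relation does not apply because the contraction is in the opposite order. -/
theorem sum_wt_mul_inv (hq : q ≠ 0) (k l : Fin N) :
    ∑ a, wt q a • (mat q a k * inv q l a) = if k = l then wt q k • 1 else 0 := by
  have hq' : (q : ℂ) ≠ 0 := by exact_mod_cast hq
  have h : ∑ s, ∑ a, ∑ b, rLeftInv q s s a b • (mat q a k * inv q l b) =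
      ∑ s, ∑ a, ∑ b, rLeftInv q a b k l • (inv q a s * mat q s b) :=
    Finset.sum_congr rfl fun s _ => rLeftInv_intertwine hq s s k l
  have h1 : ∑ s, ∑ a, ∑ b, rLeftInv q s s a b • (mat q a k * inv q l b) =
      ∑ a, ∑ b, (∑ s, rLeftInv q s s a b) • (mat q a k * inv q l b) := by
    simp only [Finset.sum_smul]
    rw [Finset.sum_comm]
    exact Finset.sum_congr rfl fun a _ => Finset.sum_comm
  have h2 : ∑ s, ∑ a, ∑ b, rLeftInv q a b k l • (inv q a s * mat q s b) =
      ∑ a, ∑ b, rLeftInv q a b k l • ∑ s, (inv q a s * mat q s b) := by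
    simp only [Finset.smul_sum]
    rw [Finset.sum_comm]
    exact Finset.sum_congr rfl fun a _ => Finset.sum_comm
  rw [h1, h2] at h
  simp only [sum_rLeftInv_lower hq, sum_inv_mul_mat, ite_smul, zero_smul, Finset.sum_ite_eq,
    Finset.mem_univ, if_true, smul_ite, smul_zero] at h
  rw [← Finset.sum_smul, sum_rLeftInv_lower hq] at h
  simp only [mul_smul, ← Finset.smul_sum] at h
  have hne : (q : ℂ) * ((q : ℂ) ^ (2 * N))⁻¹ ≠ 0 :=
    mul_ne_zero hq' (inv_ne_zero (pow_ne_zero _ hq'))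
  rw [ite_smul, zero_smul, mul_smul, mul_smul] at h
  have h3 := congrArg (fun x => ((q : ℂ) * ((q : ℂ) ^ (2 * N))⁻¹)⁻¹ • x) h
  simp only [← mul_smul, smul_ite, smul_zero, ← mul_assoc, inv_mul_cancel₀ hne, one_mul, one_smul]
    at h3
  simpa [mul_assoc] using h3

/-- The counterpart of `sum_wt_mul_inv` with the lower indices identified; it is what makes Ω₋, with
its weights, coinvariant. -/
theorem sum_wt_inv_mul_mat (hq : q ≠ 0) (a b : Fin N) :
    ∑ i, (wt q i)⁻¹ • (inv q i a * mat q b i) = if a = b then (wt q a)⁻¹ • 1 else 0 := by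
  have hq' : (q : ℂ) ≠ 0 := by exact_mod_cast hq
  have h : ∑ p, ∑ s, ∑ t, rLeftInv q a b s t • (mat q s p * inv q p t) =
      ∑ p, ∑ s, ∑ t, rLeftInv q s t p p • (inv q s a * mat q b t) :=
    Finset.sum_congr rfl fun p _ => rLeftInv_intertwine hq a b p p
  have h1 : ∑ p, ∑ s, ∑ t, rLeftInv q a b s t • (mat q s p * inv q p t) =
      ∑ s, ∑ t, rLeftInv q a b s t • ∑ p, (mat q s p * inv q p t) := by
    simp only [Finset.smul_sum]
    rw [Finset.sum_comm]
    exact Finset.sum_congr rfl fun a _ => Finset.sum_comm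
  have h2 : ∑ p, ∑ s, ∑ t, rLeftInv q s t p p • (inv q s a * mat q b t) =
      ∑ s, ∑ t, (∑ p, rLeftInv q s t p p) • (inv q s a * mat q b t) := by
    simp only [Finset.sum_smul]
    rw [Finset.sum_comm]
    exact Finset.sum_congr rfl fun a _ => Finset.sum_comm
  rw [h1, h2] at h
  simp only [sum_rLeftInv_upper hq, sum_mat_mul_inv, ite_smul, zero_smul, Finset.sum_ite_eq,
    Finset.mem_univ, if_true, smul_ite, smul_zero] at h
  rw [← Finset.sum_smul, sum_rLeftInv_upper hq] at h
  simp only [mul_smul, ← Finset.smul_sum] at h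
  rw [ite_smul, zero_smul, mul_smul] at h
  have h3 := congrArg (fun x => (q : ℂ) • x) h
  simp only [← mul_smul, smul_ite, smul_zero, ← mul_assoc, mul_inv_cancel₀ hq', one_mul, one_smul]
    at h3
  exact h3.symm

end SUq

/-! ### The quantum sphere: relations in R-matrix form and the coaction. -/

namespace Sphere

theorem z_mul_z {i j : Fin N} (h : i < j) : z q i * z q j = (q : ℂ) • (z q j * z q i) := by
  have := mk_rel (SphereRel.zz (q := q) i j h)
  simpa only [map_mul, map_smul, mk_fz] using this

theorem zs_mul_zs {i j : Fin N} (h : i < j) : zs q j * zs q i = (q : ℂ) • (zs q i * zs q j) := by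
  have := mk_rel (SphereRel.ss (q := q) i j h)
  simpa only [map_mul, map_smul, mk_fzs] using this

theorem z_mul_zs {i j : Fin N} (h : i ≠ j) : z q i * zs q j = (q : ℂ) • (zs q j * z q i) := by
  have := mk_rel (SphereRel.zs (q := q) i j h)
  simpa only [map_mul, map_smul, mk_fz, mk_fzs] using this

theorem sum_z_mul_zs (N : ℕ) (q : ℝ) : ∑ i : Fin N, z q i * zs q i = 1 := by
  have := mk_rel (SphereRel.sphere (N := N) (q := q))
  simpa only [map_sum, map_mul, map_one, mk_fz, mk_fzs] using this

theorem zs_mul_z_self (i : Fin N) : zs q i * z q i =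
    z q i * zs q i + ((q : ℂ)⁻¹ * bigQ q) • ∑ k, if i < k then z q k * zs q k else 0 := by
  have := mk_rel (SphereRel.diag (q := q) i)
  simp only [map_add, map_sub, map_mul, map_smul, map_sum, map_zero, mk_fz, mk_fzs,
    Finset.sum_filter, apply_ite (mk N q)] at this
  rw [sub_add_eq_add_sub, sub_eq_zero] at this
  exact this.symm

/-- In this form the quadratic relations say that `z ⊗ z` is an eigenvector of R for the eigenvalue
q, a statement preserved by every intertwined coaction. -/
theorem sum_rMat_z_mul_z (hq : q ≠ 0) (k l : Fin N) :
    ∑ s, ∑ t, rMat q s t k l • (z q s * z q t) = (q : ℂ) • (z q k * z q l) := by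
  have hq' : (q : ℂ) ≠ 0 := by exact_mod_cast hq
  rw [sum_rMat_left]
  rcases lt_trichotomy k l with h | h | h
  · rw [z_mul_z h, smul_smul, smul_smul, ← add_smul, if_neg h.ne, if_pos h, bigQ]
    congr 1
    field_simp
    ring
  · simp [h]
  · simp [h.ne', h.not_gt, z_mul_z h]

theorem sum_rConj_zs_mul_zs (hq : q ≠ 0) (k l : Fin N) :
    ∑ s, ∑ t, rConj q s t k l • (zs q s * zs q t) = (q : ℂ) • (zs q k * zs q l) := by
  have hq' : (q : ℂ) ≠ 0 := by exact_mod_cast hq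
  rw [sum_rConj]
  rcases lt_trichotomy k l with h | h | h
  · simp [h.ne, h.not_gt, zs_mul_zs h]
  · simp [h]
  · rw [zs_mul_zs h, smul_smul, smul_smul, ← add_smul, if_neg h.ne', if_pos h, bigQ]
    congr 1
    field_simp
    ring

theorem sum_rRight_z_mul_zs (hq : q ≠ 0) (k l : Fin N) :
    ∑ s, ∑ t, rRight q s t k l • (z q s * zs q t) = (q : ℂ) • (zs q k * z q l) := by
  have hq' : (q : ℂ) ≠ 0 := by exact_mod_cast hq
  rw [sum_rRight]
  split_ifs with h
  · subst h
    rw [zs_mul_z_self, smul_add, smul_smul, mul_inv_cancel_left₀ hq', Finset.smul_sum]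
    simp only [smul_ite, smul_zero]
  · exact z_mul_zs (Ne.symm h)

/-- Algebra maps out of the sphere. -/
theorem exists_hom {B : Type*} [Ring B] [Algebra ℂ B] (hq : q ≠ 0) (Z W : Fin N → B)
    (hz : ∀ k l, ∑ s, ∑ t, rMat q s t k l • (Z s * Z t) = (q : ℂ) • (Z k * Z l))
    (hw : ∀ k l, ∑ s, ∑ t, rConj q s t k l • (W s * W t) = (q : ℂ) • (W k * W l))
    (hzw : ∀ k l, ∑ s, ∑ t, rRight q s t k l • (Z s * W t) = (q : ℂ) • (W k * Z l))
    (hsum : ∑ i, Z i * W i = 1) :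
    ∃ f : Sphere N q →ₐ[ℂ] B, (∀ i, f (z q i) = Z i) ∧ ∀ i, f (zs q i) = W i := by
  have hq' : (q : ℂ) ≠ 0 := by exact_mod_cast hq
  let f0 : FreeAlgebra ℂ (Gen N) →ₐ[ℂ] B := FreeAlgebra.lift ℂ (Sum.elim Z W)
  have hu : ∀ i, f0 (fz i) = Z i := fun i => by
    simp only [f0, fz, FreeAlgebra.lift_ι_apply, Sum.elim_inl]
  have hv : ∀ i, f0 (fzs i) = W i := fun i => by
    simp only [f0, fzs, FreeAlgebra.lift_ι_apply, Sum.elim_inr]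
  have hrel : ∀ ⦃a b⦄, SphereRel N q a b → f0 a = f0 b := by
    intro a b h
    cases h with
    | zz i j h =>
      have := hz j i
      rw [sum_rMat_left, if_neg h.ne', if_neg h.not_gt, zero_smul, add_zero, one_smul] at this
      simpa only [map_mul, map_smul, hu] using this
    | ss i j h =>
      have := hw i j
      rw [sum_rConj, if_neg h.ne, if_neg h.not_gt, zero_smul, add_zero, one_smul] at this
      simpa only [map_mul, map_smul, hv] using this
    | zs i j h =>
      have := hzw j i
      rw [sum_rRight, if_neg h.symm] at this
      simpa only [map_mul, map_smul, hu, hv] using this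
    | diag i =>
      have := congrArg (fun x => (q : ℂ)⁻¹ • x) (hzw i i)
      simp only [sum_rRight, if_true, smul_add, smul_smul, inv_mul_cancel₀ hq', one_smul,
        Finset.smul_sum, smul_ite, smul_zero] at this
      simp only [map_add, map_sub, map_mul, map_smul, map_sum, map_zero, hu, hv,
        Finset.sum_filter, apply_ite f0, Finset.smul_sum, smul_ite, smul_zero]
      rw [sub_add_eq_add_sub, sub_eq_zero, ← this]
    | sphere => simpa only [map_sum, map_mul, map_one, hu, hv] using hsum
  refine ⟨RingQuot.liftAlgHom ℂ ⟨f0, hrel⟩, fun i => ?_, fun i => ?_⟩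
  · exact (RingQuot.liftAlgHom_mkAlgHom_apply ℂ f0 hrel _).trans (hu i)
  · exact (RingQuot.liftAlgHom_mkAlgHom_apply ℂ f0 hrel _).trans (hv i)

theorem exists_coaction (hq : q ≠ 0) :
    ∃ δ : Sphere N q →ₐ[ℂ] Sphere N q ⊗[ℂ] SUq N q, SUq.IsCoaction δ := by
  refine exists_hom hq (fun i => ∑ j, z q j ⊗ₜ[ℂ] SUq.mat q j i)
    (fun i => ∑ j, zs q j ⊗ₜ[ℂ] SUq.inv q i j) ?_ ?_ ?_ ?_
  · intro k l
    have h := sum_tmul_intertwine (SUq.rtt (N := N) (q := q)) (fun a b => z q a * z q b) k l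
    simp only [Finset.sum_mul_sum, Algebra.TensorProduct.tmul_mul_tmul]
    rw [← h]
    simp only [sum_rMat_z_mul_z hq, Finset.smul_sum, TensorProduct.smul_tmul']
  · intro k l
    have h := sum_tmul_intertwine (SUq.rConj_intertwine (N := N) (q := q))
      (fun a b => zs q a * zs q b) k l
    simp only [Finset.sum_mul_sum, Algebra.TensorProduct.tmul_mul_tmul]
    rw [← h]
    simp only [sum_rConj_zs_mul_zs hq, Finset.smul_sum, TensorProduct.smul_tmul']
  · intro k l
    have h := sum_tmul_intertwine (SUq.rRight_intertwine (N := N) (q := q))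
      (fun a b => z q a * zs q b) k l
    simp only [Finset.sum_mul_sum, Algebra.TensorProduct.tmul_mul_tmul]
    rw [← h]
    simp only [sum_rRight_z_mul_zs hq, Finset.smul_sum, TensorProduct.smul_tmul']
  · simp only [Finset.sum_mul_sum, Algebra.TensorProduct.tmul_mul_tmul]
    rw [Finset.sum_comm]
    have h : ∀ a : Fin N, ∑ i, ∑ b, (z q a * zs q b) ⊗ₜ[ℂ] (SUq.mat q a i * SUq.inv q i b) =
        (z q a * zs q a) ⊗ₜ[ℂ] 1 := by
      intro a
      rw [Finset.sum_comm]
      simp only [← TensorProduct.tmul_sum, SUq.sum_mat_mul_inv, TensorProduct.tmul_ite,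
        Finset.sum_ite_eq, Finset.mem_univ, if_true]
    simp only [h]
    rw [← TensorProduct.sum_tmul, sum_z_mul_zs, Algebra.TensorProduct.one_def]

/-- Replacing `z_i^* z_i` by the diagonal relation, the coefficients of the tail of `z_k z_k^*` add
up by `1 - q⁻² + q⁻² q^{-2n} q^{2n} = 1`, so the identity propagates downwards in n. At `n = 0` it
gives the second form of the sphere relation. -/
theorem sum_tail_zs_mul_z (hq : q ≠ 0) (n : ℕ) (hn : n ≤ N) :
    (∑ i : Fin N, if n ≤ (i : ℕ) then (wt q i)⁻¹ • (zs q i * z q i) else 0) =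
      ((q : ℂ) ^ (2 * n))⁻¹ • ∑ i : Fin N, if n ≤ (i : ℕ) then z q i * zs q i else 0 := by
  have hq' : (q : ℂ) ≠ 0 := by exact_mod_cast hq
  refine sum_tail_eq _ (fun n : ℕ => ((q : ℂ) ^ (2 * n))⁻¹ •
    ∑ i : Fin N, if n ≤ (i : ℕ) then z q i * zs q i else 0) ?_ ?_ n hn
  · rw [Finset.sum_eq_zero, smul_zero]
    exact fun i _ => if_neg (by omega)
  · intro n hn
    rw [sum_tail_succ _ n hn, zs_mul_z_self, wt, bigQ]
    simp only [smul_add, smul_smul]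
    have h : (∑ k : Fin N, if (⟨n, hn⟩ : Fin N) < k then z q k * zs q k else 0) =
        ∑ k : Fin N, if n + 1 ≤ (k : ℕ) then z q k * zs q k else 0 := rfl
    rw [h, add_assoc, ← add_smul]
    congr 2
    rw [mul_add, pow_add]
    field_simp
    ring

theorem sum_wt_inv_zs_mul_z (hq : q ≠ 0) :
    ∑ i : Fin N, (wt q i)⁻¹ • (zs q i * z q i) = 1 := by
  have h := sum_tail_zs_mul_z (N := N) hq 0 (Nat.zero_le _)
  simpa [sum_z_mul_zs] using h

end Sphere

/-- The weight `q^{-2(i+1)}` occurring in `Ω₋`. -/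
theorem zpow_weight (hq : q ≠ 0) (i : Fin N) :
    (q : ℂ) ^ (-2 * ((i : ℤ) + 1)) = ((q : ℂ) ^ 2)⁻¹ * (wt q i)⁻¹ := by
  have hq' : (q : ℂ) ≠ 0 := by exact_mod_cast hq
  rw [wt, ← mul_inv, ← pow_add, show (-2 * ((i : ℤ) + 1)) = -((2 + 2 * (i : ℕ) : ℕ) : ℤ) by
    push_cast; ring, zpow_neg, zpow_natCast]

namespace Sphere

theorem sum_rLeftInv_zs_mul_z (hq : q ≠ 0) (k l : Fin N) :
    ∑ s, ∑ t, rLeftInv q s t k l • (zs q s * z q t) = (q : ℂ)⁻¹ • (z q k * zs q l) := by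
  have hq' : (q : ℂ) ≠ 0 := by exact_mod_cast hq
  have h : ∀ s t : Fin N, zs q s * z q t =
      (q : ℂ)⁻¹ • ∑ a, ∑ b, rRight q a b s t • (z q a * zs q b) := by
    intro s t
    rw [sum_rRight_z_mul_zs hq, smul_smul, inv_mul_cancel₀ hq', one_smul]
  have h2 : ∑ s, ∑ t, rLeftInv q s t k l • ∑ a, ∑ b, rRight q a b s t • (z q a * zs q b) =
      ∑ a, ∑ b, (∑ s, ∑ t, rLeftInv q s t k l * rRight q a b s t) • (z q a * zs q b) := by
    simp only [Finset.smul_sum, Finset.sum_smul, smul_smul]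
    rw [sum_comm_pair]
  simp only [h, smul_comm _ (q : ℂ)⁻¹, ← Finset.smul_sum, h2, sum_rLeftInv_mul_rRight hq]
  simp [ite_and, Finset.sum_ite_irrel]

/-- Up to the weights, the entries of `R⁻` with these index positions are those of `rLeftInv`, so
this is the mixed sphere relation again. -/
theorem sum_rInv_zs_mul_z (hq : q ≠ 0) (l t : Fin N) :
    ∑ i, ∑ s, rInv q s t i l • (((wt q i)⁻¹ • zs q i) * z q s) =
      ((q : ℂ)⁻¹ * (wt q t)⁻¹) • (z q l * zs q t) := by
  have hq' : (q : ℂ) ≠ 0 := by exact_mod_cast hq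
  rw [mul_comm, mul_smul, ← sum_rLeftInv_zs_mul_z hq]
  simp only [Finset.smul_sum]
  refine Finset.sum_congr rfl fun i _ => Finset.sum_congr rfl fun s _ => ?_
  have hi := wt_ne_zero hq i
  have ht := wt_ne_zero hq t
  rw [smul_mul_assoc, smul_smul, smul_smul, rLeftInv, zpow_sub₀ hq',
    show (q : ℂ) ^ (2 * (t : ℤ)) = wt q t by rw [wt]; norm_cast,
    show (q : ℂ) ^ (2 * (i : ℤ)) = wt q i by rw [wt]; norm_cast]
  congr 1
  field_simp

theorem sum_rConj_z_mul_zs (hq : q ≠ 0) (l t : Fin N) :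
    ∑ i, ∑ s, rConj q s t i l • (z q i * zs q s) = (q : ℂ) • (zs q l * z q t) :=
  sum_rRight_z_mul_zs hq l t

theorem sum_rLeftInv_zs_mul_zs (hq : q ≠ 0) (l t : Fin N) :
    ∑ i, ∑ s, rLeftInv q s t i l • (((wt q i)⁻¹ • zs q i) * zs q s) =
      ((q : ℂ)⁻¹ * (wt q t)⁻¹) • (zs q l * zs q t) := by
  have hq' : (q : ℂ) ≠ 0 := by exact_mod_cast hq
  -- On the support of the entry the index pairs (i, s) and (l, t) agree up to order, so the weights
  -- combine to the single factor `q^{-2t}`. What is left is `rConj` minus Q times the identity,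
  -- with eigenvalue `q - Q = q⁻¹`.
  have h1 : ∀ i s : Fin N, rLeftInv q s t i l • (((wt q i)⁻¹ • zs q i) * zs q s) =
      (wt q t)⁻¹ • (rConj q i s l t • (zs q i * zs q s) -
        if i = l then if s = t then bigQ q • (zs q i * zs q s) else 0 else 0) := by
    intro i s
    have hs := wt_ne_zero hq s
    have ht := wt_ne_zero hq t
    have hi := wt_ne_zero hq i
    rw [rLeftInv, zpow_sub₀ hq',
      show (q : ℂ) ^ (2 * (l : ℤ)) = wt q l by rw [wt]; norm_cast,
      show (q : ℂ) ^ (2 * (s : ℤ)) = wt q s by rw [wt]; norm_cast, rInv_eq_rMat, rConj,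
      smul_mul_assoc, smul_smul]
    have h2 : (if i = l then if s = t then bigQ q • (zs q i * zs q s) else 0 else 0) =
        (if s = t then if i = l then bigQ q else 0 else 0) • (zs q i * zs q s) := by
      split_ifs <;> simp
    rw [h2, ← sub_smul, smul_smul, rMat_eq]
    congr 1
    split_ifs <;> (try subst_vars) <;> first | (field_simp; done) | simp_all
  simp only [h1, ← Finset.smul_sum, Finset.sum_sub_distrib, sum_rConj_zs_mul_zs hq]
  simp only [Finset.sum_ite_irrel, Finset.sum_const_zero, Finset.sum_ite_eq', Finset.mem_univ,
    if_true, ← sub_smul, smul_smul]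
  congr 1
  rw [bigQ]; ring

end Sphere

/-! ### Right multiplication of the invariant forms by generators. -/

namespace FODC

section General

variable {X : Type v} [Ring X] [Algebra ℂ X] (C : FODC.{u} X)

theorem op_smul_smul (x y : X) (w : C.form) : op y • x • w = x • op y • w :=
  (smul_comm x (op y) w).symm

theorem op_smul_csmul (c : ℂ) (y : X) (w : C.form) : op y • c • w = c • op y • w :=
  (smul_comm c (op y) w).symm

theorem smul_csmul (c : ℂ) (x : X) (w : C.form) : x • c • w = c • x • w :=
  (smul_comm c x w).symm

theorem op_mul_smul (x y : X) (w : C.form) : op (x * y) • w = op y • op x • w := by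
  rw [op_mul, mul_smul]

theorem op_csmul_smul (c : ℂ) (y : X) (w : C.form) : op (c • y) • w = c • op y • w := by
  rw [op_smul, smul_assoc]

theorem sum_smul_sum (x y : Fin N → X) (e : Fin N → C.form) (c : Fin N → Fin N → Fin N → ℂ) :
    ∑ i, x i • ∑ s, ∑ t, c s t i • (y s • e t) =
      ∑ t, (∑ i, ∑ s, c s t i • (x i * y s)) • e t := by
  simp only [Finset.smul_sum, Finset.sum_smul, smul_csmul, smul_assoc, mul_smul]
  rw [Finset.sum_comm (f := fun t i => ∑ s, c s t i • x i • y s • e t)]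
  exact Finset.sum_congr rfl fun i _ => Finset.sum_comm

end General

variable {C : FODC.{u} (Sphere N q)} {κ : Coeffs}

open Sphere

/-- The R-matrix term contracted with `z_i` is evaluated by the sphere relations and returns a
multiple of `z_l Ω₊`. The terms with `z_i z_i^*` reduce by `∑ z_i z_i^* = 1`, which is how `dz_l`
appears. The three variants below follow the same pattern; for Ω₋ the weighted identity takes the
place of the sphere equation. -/
theorem HasBimoduleStructure.omegaPlus_mul_z (h : C.HasBimoduleStructure κ) (hq : q ≠ 0)
    (l : Fin N) : op (z q l) • C.omegaPlus =
      (q * κ.a4 + κ.c4 + κ.d4) • (z q l • C.omegaPlus) + (κ.e4 + κ.f4) • (z q l • C.omegaMinus) +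
        κ.b4 • C.d (z q l) := by
  have h1 : ∑ i, z q i • ∑ s, ∑ t, rRight q s t i l • (z q s • C.d (zs q t)) =
      (q : ℂ) • (z q l • C.omegaPlus) := by
    rw [sum_smul_sum C (fun i => z q i) (fun s => z q s) (fun t => C.d (zs q t))]
    have h2 : ∀ t, ∑ i, ∑ s, rRight q s t i l • (z q i * z q s) = (q : ℂ) • (z q l * z q t) :=
      fun t => sum_rMat_z_mul_z hq l t
    simp only [h2, omegaPlus, Finset.smul_sum, smul_assoc, mul_smul]
  have h3 : ∀ w : C.form, ∑ i : Fin N, z q i • (zs q i • w) = w := by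
    intro w
    simp only [← mul_smul, ← Finset.sum_smul, sum_z_mul_zs, one_smul]
  have h4 : ∀ w : C.form, ∑ i : Fin N, z q i • (zs q i * z q l) • w = z q l • w := by
    intro w
    simp only [← mul_smul, ← mul_assoc, ← Finset.sum_smul, ← Finset.sum_mul, sum_z_mul_zs, one_mul]
  conv_lhs => rw [omegaPlus]
  simp only [Finset.smul_sum, op_smul_smul, h.rel_sz]
  simp only [smul_add, smul_csmul, Finset.sum_add_distrib, ← Finset.smul_sum, h1, h3, h4, ite_smul,
    one_smul, zero_smul, smul_ite, smul_zero, Finset.sum_ite_eq', Finset.mem_univ, if_true]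
  generalize z q l • C.omegaPlus = u
  generalize z q l • C.omegaMinus = v
  module

theorem HasBimoduleStructure.omegaPlus_mul_zs (h : C.HasBimoduleStructure κ) (hq : q ≠ 0)
    (l : Fin N) : op (zs q l) • C.omegaPlus =
      (q * κ.a2 + κ.c2) • (zs q l • C.omegaPlus) + κ.e2 • (zs q l • C.omegaMinus) +
        κ.b2 • C.d (zs q l) := by
  have h1 : ∑ i, z q i • ∑ s, ∑ t, rConj q s t i l • (zs q s • C.d (zs q t)) =
      (q : ℂ) • (zs q l • C.omegaPlus) := by
    rw [sum_smul_sum C (fun i => z q i) (fun s => zs q s) (fun t => C.d (zs q t))]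
    simp only [sum_rConj_z_mul_zs hq, omegaPlus, Finset.smul_sum, smul_assoc, mul_smul]
  have h3 : ∀ w : C.form, ∑ i : Fin N, z q i • (zs q i • w) = w := by
    intro w
    simp only [← mul_smul, ← Finset.sum_smul, sum_z_mul_zs, one_smul]
  have h4 : ∀ w : C.form, ∑ i : Fin N, z q i • (zs q i * zs q l) • w = zs q l • w := by
    intro w
    simp only [← mul_smul, ← mul_assoc, ← Finset.sum_smul, ← Finset.sum_mul, sum_z_mul_zs, one_mul]
  conv_lhs => rw [omegaPlus]
  simp only [Finset.smul_sum, op_smul_smul, h.rel_ss]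
  simp only [smul_add, smul_csmul, Finset.sum_add_distrib, ← Finset.smul_sum, h1, h3, h4]
  generalize zs q l • C.omegaPlus = u
  generalize zs q l • C.omegaMinus = v
  module

theorem omegaMinus_eq (C : FODC.{u} (Sphere N q)) (hq : q ≠ 0) : C.omegaMinus =
    ((q : ℂ) ^ 2)⁻¹ • ∑ i, ((wt q i)⁻¹ • zs q i) • C.d (z q i) := by
  simp only [omegaMinus, zpow_weight hq, Finset.smul_sum, smul_assoc, mul_smul]

theorem sum_wt_inv_smul (hq : q ≠ 0) (w : C.form) :
    ∑ i : Fin N, ((wt q i)⁻¹ • zs q i) • (z q i • w) = w := by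
  simp only [← mul_smul, ← Finset.sum_smul, smul_mul_assoc, sum_wt_inv_zs_mul_z hq, one_smul]

theorem HasBimoduleStructure.omegaMinus_mul_z (h : C.HasBimoduleStructure κ) (hq : q ≠ 0)
    (l : Fin N) : op (z q l) • C.omegaMinus =
      (((q : ℂ) ^ 2)⁻¹ * κ.c1) • (z q l • C.omegaPlus) +
        ((q : ℂ)⁻¹ * κ.a1 + ((q : ℂ) ^ 2)⁻¹ * κ.e1) • (z q l • C.omegaMinus) +
        (((q : ℂ) ^ 2)⁻¹ * κ.b1) • C.d (z q l) := by
  have h1 : ∑ i, ((wt q i)⁻¹ • zs q i) • ∑ s, ∑ t, rInv q s t i l • (z q s • C.d (z q t)) =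
      ((q : ℂ)⁻¹ * (q : ℂ) ^ 2) • (z q l • C.omegaMinus) := by
    have hq' : (q : ℂ) ^ 2 ≠ 0 := pow_ne_zero _ (by exact_mod_cast hq)
    rw [sum_smul_sum C (fun i => (wt q i)⁻¹ • zs q i) (fun s => z q s) (fun t => C.d (z q t))]
    rw [omegaMinus_eq C hq, smul_csmul, smul_smul, mul_assoc, mul_inv_cancel₀ hq', mul_one]
    simp only [sum_rInv_zs_mul_z hq, Finset.smul_sum, smul_assoc, smul_csmul, mul_smul]
  have h3 := sum_wt_inv_smul (C := C) hq
  have h4 : ∀ w : C.form, ∑ i : Fin N, ((wt q i)⁻¹ • zs q i) • (z q i * z q l) • w =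
      z q l • w := by
    intro w
    simp only [mul_smul, h3]
  conv_lhs => rw [omegaMinus_eq C hq]
  simp only [Finset.smul_sum, op_smul_smul, op_smul_csmul, h.rel_zz]
  simp only [← Finset.smul_sum]
  simp only [smul_add, smul_csmul, Finset.sum_add_distrib, ← Finset.smul_sum, h1, h3, h4]
  have hq' : (q : ℂ) ≠ 0 := by exact_mod_cast hq
  generalize z q l • C.omegaPlus = u
  generalize z q l • C.omegaMinus = v
  match_scalars <;> field_simp

theorem HasBimoduleStructure.omegaMinus_mul_zs (h : C.HasBimoduleStructure κ) (hq : q ≠ 0)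
    (l : Fin N) : op (zs q l) • C.omegaMinus =
      (((q : ℂ) ^ 2)⁻¹ * κ.c3 + κ.d3) • (zs q l • C.omegaPlus) +
        ((q : ℂ)⁻¹ * κ.a3 + ((q : ℂ) ^ 2)⁻¹ * κ.e3 + κ.f3) • (zs q l • C.omegaMinus) +
        (((q : ℂ) ^ 2)⁻¹ * κ.b3) • C.d (zs q l) := by
  have h1 : ∑ i, ((wt q i)⁻¹ • zs q i) • ∑ s, ∑ t, rLeftInv q s t i l • (zs q s • C.d (z q t)) =
      ((q : ℂ)⁻¹ * (q : ℂ) ^ 2) • (zs q l • C.omegaMinus) := by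
    have hq' : (q : ℂ) ^ 2 ≠ 0 := pow_ne_zero _ (by exact_mod_cast hq)
    rw [sum_smul_sum C (fun i => (wt q i)⁻¹ • zs q i) (fun s => zs q s) (fun t => C.d (z q t))]
    rw [omegaMinus_eq C hq, smul_csmul, smul_smul, mul_assoc, mul_inv_cancel₀ hq', mul_one]
    simp only [sum_rLeftInv_zs_mul_zs hq, Finset.smul_sum, smul_assoc, smul_csmul, mul_smul]
  have h3 := sum_wt_inv_smul (C := C) hq
  have h4 : ∀ w : C.form, ∑ i : Fin N, ((wt q i)⁻¹ • zs q i) • (z q i * zs q l) • w =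
      zs q l • w := by
    intro w
    simp only [mul_smul, h3]
  have hl : (wt q l) ≠ 0 := wt_ne_zero hq l
  conv_lhs => rw [omegaMinus_eq C hq]
  simp only [Finset.smul_sum, op_smul_smul, op_smul_csmul, h.rel_zs]
  simp only [← Finset.smul_sum]
  simp only [smul_add, smul_csmul, Finset.sum_add_distrib, ← Finset.smul_sum, h1, h3, h4, ite_smul,
    one_smul, zero_smul, smul_ite, smul_zero, Finset.sum_ite_eq', Finset.mem_univ, if_true]
  have hq' : (q : ℂ) ≠ 0 := by exact_mod_cast hq
  simp only [smul_assoc]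
  generalize zs q l • C.omegaPlus = u
  generalize zs q l • C.omegaMinus = v
  rw [mul_add, pow_add, mul_one, show (q : ℂ) ^ (2 * (l : ℕ)) = wt q l from rfl]
  match_scalars <;> field_simp

end FODC

theorem Sphere.induction {p : Sphere N q → Prop} (hc : ∀ c : ℂ, p (algebraMap ℂ _ c))
    (hg : ∀ g, p (Sphere.gen N q g)) (hmul : ∀ x y, p x → p y → p (x * y))
    (hadd : ∀ x y, p x → p y → p (x + y)) (x : Sphere N q) : p x := by
  obtain ⟨a, rfl⟩ : ∃ a, Sphere.mk N q a = x := RingQuot.mkAlgHom_surjective ℂ _ x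
  induction a using FreeAlgebra.induction with
  | grade0 r => simpa only [AlgHom.commutes] using hc r
  | grade1 g => exact hg g
  | mul a b ha hb => rw [map_mul]; exact hmul _ _ ha hb
  | add a b ha hb => rw [map_add]; exact hadd _ _ ha hb

/-! ### Calculi presented by generators, one relation and a commutation table. -/

namespace FODC

section General

variable {X : Type v} [Ring X] [Algebra ℂ X] (C : FODC.{u} X)

theorem d_one : C.d 1 = 0 := by
  have h := C.leibniz 1 1
  rw [mul_one, op_one, one_smul, one_smul] at h
  exact left_eq_add.1 h

theorem d_algebraMap (c : ℂ) : C.d (algebraMap ℂ X c) = 0 := by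
  rw [Algebra.algebraMap_eq_smul_one, map_smul, d_one, smul_zero]

theorem op_algebraMap_smul (c : ℂ) (w : C.form) : op (algebraMap ℂ X c) • w = c • w := by
  rw [Algebra.algebraMap_eq_smul_one, op_csmul_smul, op_one, one_smul]

/-- The projection onto the factor calculus. -/
def toFactor (ω : C.form) : C.form →ₗ[X] (C.factor ω).form := (C.subBimodule ω).mkQ

theorem toFactor_surjective (ω : C.form) : Function.Surjective (C.toFactor ω) :=
  Submodule.mkQ_surjective (C.subBimodule ω)

theorem toFactor_op_smul (ω : C.form) (y : X) (w : C.form) :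
    C.toFactor ω (op y • w) = op y • C.toFactor ω w := rfl

theorem toFactor_csmul (ω : C.form) (c : ℂ) (w : C.form) :
    C.toFactor ω (c • w) = c • C.toFactor ω w := rfl

theorem toFactor_d (ω : C.form) (x : X) : C.toFactor ω (C.d x) = (C.factor ω).d x := rfl

theorem toFactor_eq_zero (ω w : C.form) : C.toFactor ω w = 0 ↔ w ∈ C.subBimodule ω :=
  Submodule.Quotient.mk_eq_zero _

end General

open Sphere

variable {C D : FODC.{u} (Sphere N q)} {κ κ' : Coeffs} {μ ν : ℂ}

/-- A calculus with bimodule structure `κ` which is generated by `dz_i, dz_i^*` with the single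
relation `μ Ω₊ + ν Ω₋ = 0`. -/
structure IsPresented (C : FODC.{u} (Sphere N q)) (μ ν : ℂ) (κ : Coeffs) : Prop where
  span_dgen : Submodule.span (Sphere N q) (Set.range C.dgen) = ⊤
  relations : LinearMap.ker (Fintype.linearCombination (Sphere N q) C.dgen) =
    Submodule.span (Sphere N q) {omegaVec N q μ ν}
  bimodule : C.HasBimoduleStructure κ

theorem IsOneRelationCalculus.isPresented (h : C.IsOneRelationCalculus μ ν κ) :
    C.IsPresented μ ν κ := ⟨h.span_dgen, h.relations, h.bimodule⟩

theorem linearCombination_omegaVec (C : FODC.{u} (Sphere N q)) (μ ν : ℂ) :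
    Fintype.linearCombination (Sphere N q) C.dgen (omegaVec N q μ ν) = C.omega μ ν := by
  rw [Fintype.linearCombination_apply, Fintype.sum_sum_type, omega, omegaPlus, omegaMinus,
    add_comm]
  simp only [omegaVec, Finset.smul_sum, smul_assoc, mul_smul, dgen]
  rfl

theorem IsPresented.omega_eq_zero (h : C.IsPresented μ ν κ) : C.omega μ ν = 0 := by
  rw [← linearCombination_omegaVec, ← LinearMap.mem_ker, h.relations]
  exact Submodule.mem_span_singleton_self _

theorem linearCombination_surjective
    (h : Submodule.span (Sphere N q) (Set.range C.dgen) = ⊤) :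
    Function.Surjective (Fintype.linearCombination (Sphere N q) C.dgen) := by
  rw [← LinearMap.range_eq_top, Fintype.range_linearCombination, h]

/-! ### Uniqueness -/

/-- Both modules are the same quotient of the free left module, so a left isomorphism matching the
generators exists. Compatibility with the right action needs checking only on differentials of
generators, where both tables are the same, and then d is matched by the Leibniz rule. -/
theorem IsPresented.isomorphic (hC : C.IsPresented μ ν κ) (hD : D.IsPresented μ ν κ) :
    C.Isomorphic D := by
  let fC := Fintype.linearCombination (Sphere N q) C.dgen
  let fD := Fintype.linearCombination (Sphere N q) D.dgen
  let e : C.form ≃ₗ[Sphere N q] D.form :=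
    (fC.quotKerEquivOfSurjective (linearCombination_surjective hC.span_dgen)).symm ≪≫ₗ
      (Submodule.quotEquivOfEq _ _ (hC.relations.trans hD.relations.symm)) ≪≫ₗ
      fD.quotKerEquivOfSurjective (linearCombination_surjective hD.span_dgen)
  have he : ∀ c, e (fC c) = fD c := by
    intro c
    have h1 : (fC.quotKerEquivOfSurjective (linearCombination_surjective hC.span_dgen)).symm
        (fC c) = Submodule.Quotient.mk c := by
      rw [LinearEquiv.symm_apply_eq]; rfl
    simp only [e, LinearEquiv.trans_apply, h1]
    rfl
  have hgen : ∀ g, e (C.d (gen N q g)) = D.d (gen N q g) := by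
    intro g
    have h := he (Pi.single g 1)
    simpa only [fC, fD, Fintype.linearCombination_apply_single, one_smul, dgen] using h
  have hz : ∀ i, e (C.d (z q i)) = D.d (z q i) := fun i => hgen _
  have hzs : ∀ i, e (C.d (zs q i)) = D.d (zs q i) := fun i => hgen _
  have hsm : ∀ (c : ℂ) w, e (c • w) = c • e w := fun c w =>
    (e.toLinearMap.restrictScalars ℂ).map_smul c w
  have hp : e C.omegaPlus = D.omegaPlus := by
    simp only [omegaPlus, map_sum, map_smul, hzs]
  have hm : e C.omegaMinus = D.omegaMinus := by
    simp only [omegaMinus, map_sum, map_smul, hsm, hz]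
  have hop : ∀ g h, e (op (gen N q h) • C.d (gen N q g)) =
      op (gen N q h) • D.d (gen N q g) := by
    rintro (k | k) (l | l)
    · have h1 := hC.bimodule.rel_zz k l
      have h2 := hD.bimodule.rel_zz k l
      simp only [z, zs] at h1 h2 hz hzs
      rw [h1, h2]
      simp only [map_add, map_sum, hsm, map_smul, hz, hzs, hp, hm]
    · have h1 := hC.bimodule.rel_zs k l
      have h2 := hD.bimodule.rel_zs k l
      simp only [z, zs] at h1 h2 hz hzs
      rw [h1, h2]
      simp only [map_add, map_sum, hsm, map_smul, hz, hzs, hp, hm]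
    · have h1 := hC.bimodule.rel_sz k l
      have h2 := hD.bimodule.rel_sz k l
      simp only [z, zs] at h1 h2 hz hzs
      rw [h1, h2]
      simp only [map_add, map_sum, hsm, map_smul, hz, hzs, hp, hm]
    · have h1 := hC.bimodule.rel_ss k l
      have h2 := hD.bimodule.rel_ss k l
      simp only [z, zs] at h1 h2 hz hzs
      rw [h1, h2]
      simp only [map_add, map_sum, hsm, map_smul, hz, hzs, hp, hm]
  have hopg : ∀ h w, e (op (gen N q h) • w) = op (gen N q h) • e w := by
    intro h w
    have hw : w ∈ Submodule.span (Sphere N q) (Set.range C.dgen) := hC.span_dgen ▸ trivial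
    induction hw using Submodule.span_induction with
    | mem w hw =>
      obtain ⟨g, rfl⟩ := hw
      rw [dgen, hop, hgen]
    | zero => simp only [smul_zero, map_zero]
    | add w w' _ _ h1 h2 => simp only [smul_add, map_add, h1, h2]
    | smul x w _ h1 => simp only [op_smul_smul, map_smul, h1]
  have hop' : ∀ (y : Sphere N q) (w : C.form), e (op y • w) = op y • e w := by
    intro y
    induction y using Sphere.induction with
    | hc c => intro w; simp only [op_algebraMap_smul, hsm]
    | hg g => exact hopg g
    | hmul x y hx hy => intro w; simp only [op_mul_smul, hx, hy]
    | hadd x y hx hy => intro w; simp only [op_add, add_smul, map_add, hx, hy]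
  refine ⟨e, hop', fun x => ?_⟩
  induction x using Sphere.induction with
  | hc c => simp only [d_algebraMap, map_zero]
  | hg g => exact hgen g
  | hmul x y hx hy => simp only [leibniz, map_add, map_smul, hop', hx, hy]
  | hadd x y hx hy => simp only [map_add, hx, hy]

/-! ### Factor calculi of free calculi -/

theorem HasBimoduleStructure.factor (h : C.HasBimoduleStructure κ) (ω : C.form) :
    (C.factor ω).HasBimoduleStructure κ := by
  have hp : C.toFactor ω C.omegaPlus = (C.factor ω).omegaPlus := by
    simp only [omegaPlus, map_sum, map_smul, toFactor_d]
  have hm : C.toFactor ω C.omegaMinus = (C.factor ω).omegaMinus := by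
    simp only [omegaMinus, map_sum, map_smul, toFactor_csmul, toFactor_d]
  constructor
  · intro k l
    have h1 := congrArg (C.toFactor ω) (h.rel_zz k l)
    simpa only [map_add, map_sum, toFactor_csmul, map_smul, toFactor_op_smul, toFactor_d, hp, hm]
      using h1
  · intro k l
    have h1 := congrArg (C.toFactor ω) (h.rel_ss k l)
    simpa only [map_add, map_sum, toFactor_csmul, map_smul, toFactor_op_smul, toFactor_d, hp, hm]
      using h1
  · intro k l
    have h1 := congrArg (C.toFactor ω) (h.rel_zs k l)
    simpa only [map_add, map_sum, toFactor_csmul, map_smul, toFactor_op_smul, toFactor_d, hp, hm]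
      using h1
  · intro k l
    have h1 := congrArg (C.toFactor ω) (h.rel_sz k l)
    simpa only [map_add, map_sum, toFactor_csmul, map_smul, toFactor_op_smul, toFactor_d, hp, hm]
      using h1

theorem toFactor_dgen (ω : C.form) (g : Gen N) :
    (C.factor ω).dgen g = C.toFactor ω (C.dgen g) := rfl

theorem span_dgen_factor (h : Submodule.span (Sphere N q) (Set.range C.dgen) = ⊤) (ω : C.form) :
    Submodule.span (Sphere N q) (Set.range (C.factor ω).dgen) = ⊤ := by
  have h1 : Set.range (C.factor ω).dgen = C.toFactor ω '' Set.range C.dgen := by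
    rw [← Set.range_comp]; rfl
  rw [h1, ← Submodule.map_span, h, Submodule.map_top, LinearMap.range_eq_top]
  exact C.toFactor_surjective ω

/-- The left module generated by `ω` is a sub-bimodule if `ω z_i` and `ω z_i^*` are multiples of
`ω`. -/
theorem subBimodule_eq_span {ω : C.form}
    (h : ∀ g, op (gen N q g) • ω ∈ Submodule.span (Sphere N q) {ω}) :
    C.subBimodule ω = Submodule.span (Sphere N q) {ω} := by
  apply le_antisymm
  · refine Submodule.span_le.2 ?_
    rintro _ ⟨y, rfl⟩
    -- Stability is asserted for the whole span rather than for ω alone, so that the induction on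
    -- `y` passes through products.
    have key : ∀ w ∈ Submodule.span (Sphere N q) {ω}, op y • w ∈
        Submodule.span (Sphere N q) {ω} := by
      induction y using Sphere.induction with
      | hc c =>
        intro w hw
        rw [op_algebraMap_smul, ← algebraMap_smul (Sphere N q) c w]
        exact Submodule.smul_mem _ _ hw
      | hg g =>
        intro w hw
        obtain ⟨x, rfl⟩ := Submodule.mem_span_singleton.1 hw
        rw [op_smul_smul]
        exact Submodule.smul_mem _ _ (h g)
      | hmul x y hx hy => intro w hw; rw [op_mul_smul]; exact hy _ (hx _ hw)
      | hadd x y hx hy => intro w hw; rw [op_add, add_smul]; exact add_mem (hx _ hw) (hy _ hw)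
    exact key ω (Submodule.mem_span_singleton_self ω)
  · rw [Submodule.span_singleton_le_iff_mem]
    exact Submodule.subset_span ⟨1, one_smul (Sphere N q)ᵐᵒᵖ ω⟩

/-- Freeness makes the coefficient family of a form unique. The kernel of the projection consists of
the left multiples of Ω, so the relations in the quotient are exactly the left multiples of its
coefficient family. -/
theorem relations_factor (h : LinearIndependent (Sphere N q) C.dgen)
    (hω : ∀ g, op (gen N q g) • C.omega μ ν ∈ Submodule.span (Sphere N q) {C.omega μ ν}) :
    LinearMap.ker (Fintype.linearCombination (Sphere N q) (C.factor (C.omega μ ν)).dgen) =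
      Submodule.span (Sphere N q) {omegaVec N q μ ν} := by
  have h0 : ∀ c, Fintype.linearCombination (Sphere N q) (C.factor (C.omega μ ν)).dgen c =
      C.toFactor (C.omega μ ν) (Fintype.linearCombination (Sphere N q) C.dgen c) := by
    intro c
    simp only [Fintype.linearCombination_apply, toFactor_dgen, map_sum, map_smul]
  have hinj : Function.Injective (Fintype.linearCombination (Sphere N q) C.dgen) :=
    linearIndependent_iff_injective_fintypeLinearCombination.1 h
  ext c
  rw [LinearMap.mem_ker, h0, toFactor_eq_zero, subBimodule_eq_span hω,
    Submodule.mem_span_singleton, Submodule.mem_span_singleton]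
  refine exists_congr fun x => ?_
  rw [← linearCombination_omegaVec, ← map_smul]
  exact hinj.eq_iff

end FODC

/-! ### Forms with coefficients in a tensor product with an algebra. -/

namespace FODC

section Tensor

variable {X : Type v} [Ring X] [Algebra ℂ X] (C : FODC.{u} X) {A : Type*} [Ring A] [Algebra ℂ A]

theorem tensorActL_tmul (x : X) (a b : A) (w : C.form) :
    C.tensorActL A (x ⊗ₜ a) (w ⊗ₜ b) = (x • w) ⊗ₜ (a * b) := rfl

theorem tensorActR_tmul (x : X) (a b : A) (w : C.form) :
    C.tensorActR A (x ⊗ₜ a) (w ⊗ₜ b) = (op x • w) ⊗ₜ (b * a) := rfl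

theorem tensorActL_one (m : C.form ⊗[ℂ] A) : C.tensorActL A 1 m = m := by
  induction m with
  | zero => simp
  | tmul w b => rw [Algebra.TensorProduct.one_def, tensorActL_tmul, one_smul, one_mul]
  | add m n hm hn => rw [map_add, hm, hn]

theorem tensorActR_one (m : C.form ⊗[ℂ] A) : C.tensorActR A 1 m = m := by
  induction m with
  | zero => simp
  | tmul w b => rw [Algebra.TensorProduct.one_def, tensorActR_tmul, op_one, one_smul, mul_one]
  | add m n hm hn => rw [map_add, hm, hn]

theorem tensorActL_mul (s t : X ⊗[ℂ] A) (m : C.form ⊗[ℂ] A) :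
    C.tensorActL A (s * t) m = C.tensorActL A s (C.tensorActL A t m) := by
  induction s with
  | zero => simp
  | add s s' h h' => simp only [add_mul, map_add, LinearMap.add_apply, h, h']
  | tmul x a =>
    induction t with
    | zero => simp
    | add s s' h h' => simp only [mul_add, map_add, LinearMap.add_apply, h, h']
    | tmul y b =>
      induction m with
      | zero => simp
      | add m n hm hn => simp only [map_add, hm, hn]
      | tmul w c => simp only [Algebra.TensorProduct.tmul_mul_tmul, tensorActL_tmul, mul_smul,
          mul_assoc]

theorem tensorActR_mul (s t : X ⊗[ℂ] A) (m : C.form ⊗[ℂ] A) :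
    C.tensorActR A (s * t) m = C.tensorActR A t (C.tensorActR A s m) := by
  induction s with
  | zero => simp
  | add s s' h h' => simp only [add_mul, map_add, LinearMap.add_apply, h, h']
  | tmul x a =>
    induction t with
    | zero => simp
    | add s s' h h' => simp only [mul_add, map_add, LinearMap.add_apply, h, h']
    | tmul y b =>
      induction m with
      | zero => simp
      | add m n hm hn => simp only [map_add, hm, hn]
      | tmul w c => simp only [Algebra.TensorProduct.tmul_mul_tmul, tensorActR_tmul, op_mul_smul,
          mul_assoc]

theorem tensorActL_tensorActR (s t : X ⊗[ℂ] A) (m : C.form ⊗[ℂ] A) :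
    C.tensorActL A s (C.tensorActR A t m) = C.tensorActR A t (C.tensorActL A s m) := by
  induction s with
  | zero => simp
  | add s s' h h' => simp only [map_add, LinearMap.add_apply, h, h']
  | tmul x a =>
    induction t with
    | zero => simp
    | add s s' h h' => simp only [map_add, LinearMap.add_apply, h, h']
    | tmul y b =>
      induction m with
      | zero => simp
      | add m n hm hn => simp only [map_add, hm, hn]
      | tmul w c => simp only [tensorActL_tmul, tensorActR_tmul, op_smul_smul, mul_assoc]

theorem rTensor_d_mul (s t : X ⊗[ℂ] A) : LinearMap.rTensor A C.d (s * t) =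
    C.tensorActR A t (LinearMap.rTensor A C.d s) +
      C.tensorActL A s (LinearMap.rTensor A C.d t) := by
  induction s with
  | zero => simp
  | add s s' h h' => simp only [add_mul, map_add, LinearMap.add_apply, h, h']; abel
  | tmul x a =>
    induction t with
    | zero => simp
    | add s s' h h' => simp only [mul_add, map_add, LinearMap.add_apply, h, h']; abel
    | tmul y b =>
      simp only [Algebra.TensorProduct.tmul_mul_tmul, LinearMap.rTensor_tmul, tensorActL_tmul,
        tensorActR_tmul, leibniz, TensorProduct.add_tmul]

theorem counit_tensorActL (ε : A →ₐ[ℂ] ℂ) (s t : X ⊗[ℂ] A) :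
    TensorProduct.rid ℂ C.form (LinearMap.lTensor C.form ε.toLinearMap
      (C.tensorActL A s (LinearMap.rTensor A C.d t))) =
    TensorProduct.rid ℂ X (LinearMap.lTensor X ε.toLinearMap s) •
      C.d (TensorProduct.rid ℂ X (LinearMap.lTensor X ε.toLinearMap t)) := by
  induction s with
  | zero => simp
  | add s s' h h' => simp only [map_add, LinearMap.add_apply, h, h', add_smul]
  | tmul x a =>
    induction t with
    | zero => simp
    | add s s' h h' => simp only [map_add, h, h', smul_add]
    | tmul y b =>
      simp only [LinearMap.rTensor_tmul, tensorActL_tmul, LinearMap.lTensor_tmul,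
        AlgHom.toLinearMap_apply, map_mul, TensorProduct.rid_tmul, map_smul, smul_assoc,
        smul_csmul, smul_smul]

theorem comul_tensorActL (Δ : A →ₐ[ℂ] A ⊗[ℂ] A) (s t : X ⊗[ℂ] A) :
    LinearMap.lTensor C.form Δ.toLinearMap (C.tensorActL A s (LinearMap.rTensor A C.d t)) =
    C.tensorActL (A ⊗[ℂ] A) (LinearMap.lTensor X Δ.toLinearMap s)
      (LinearMap.rTensor (A ⊗[ℂ] A) C.d (LinearMap.lTensor X Δ.toLinearMap t)) := by
  induction s with
  | zero => simp
  | add s s' h h' => simp only [map_add, LinearMap.add_apply, h, h']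
  | tmul x a =>
    induction t with
    | zero => simp
    | add s s' h h' => simp only [map_add, h, h']
    | tmul y b =>
      simp only [LinearMap.rTensor_tmul, tensorActL_tmul, LinearMap.lTensor_tmul,
        AlgHom.toLinearMap_apply, map_mul]

theorem assoc_tensorActL_tmul (s t : X ⊗[ℂ] A) (a b : A) :
    TensorProduct.assoc ℂ C.form A A
      ((C.tensorActL A s (LinearMap.rTensor A C.d t)) ⊗ₜ (a * b)) =
    C.tensorActL (A ⊗[ℂ] A) (TensorProduct.assoc ℂ X A A (s ⊗ₜ a))
      (LinearMap.rTensor (A ⊗[ℂ] A) C.d (TensorProduct.assoc ℂ X A A (t ⊗ₜ b))) := by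
  induction s with
  | zero => simp
  | add s s' h h' => simp only [map_add, LinearMap.add_apply, TensorProduct.add_tmul, h, h']
  | tmul x a =>
    induction t with
    | zero => simp
    | add s s' h h' => simp only [map_add, TensorProduct.add_tmul, h, h']
    | tmul y b =>
      simp only [LinearMap.rTensor_tmul, tensorActL_tmul, TensorProduct.assoc_tmul,
        Algebra.TensorProduct.tmul_mul_tmul]

/-- Together with `comul_tensorActL` this reduces coassociativity on forms `x dy` to coassociativity
of the coaction on the algebra: both sides become one expression in the iterated coactions of `x`
and `y`. -/
theorem assoc_rTensor_tensorActL {δ : X →ₗ[ℂ] X ⊗[ℂ] A} {Φ : C.form →ₗ[ℂ] C.form ⊗[ℂ] A}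
    (hΦ : ∀ x y, Φ (x • C.d y) = C.tensorActL A (δ x) (LinearMap.rTensor A C.d (δ y)))
    (s t : X ⊗[ℂ] A) :
    TensorProduct.assoc ℂ C.form A A
      (LinearMap.rTensor A Φ (C.tensorActL A s (LinearMap.rTensor A C.d t))) =
    C.tensorActL (A ⊗[ℂ] A) (TensorProduct.assoc ℂ X A A (LinearMap.rTensor A δ s))
      (LinearMap.rTensor (A ⊗[ℂ] A) C.d
        (TensorProduct.assoc ℂ X A A (LinearMap.rTensor A δ t))) := by
  induction s with
  | zero => simp
  | add s s' h h' => simp only [map_add, LinearMap.add_apply, h, h']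
  | tmul x a =>
    induction t with
    | zero => simp
    | add s s' h h' => simp only [map_add, h, h']
    | tmul y b =>
      simp only [LinearMap.rTensor_tmul, tensorActL_tmul, hΦ, assoc_tensorActL_tmul]

/-- The right action is compatible with a coaction as soon as its normal ordering is given by
intertwining coefficients. -/
theorem coaction_normal_order {M : Type*} [AddCommGroup M] [Module ℂ M]
    {Φ : M →ₗ[ℂ] M ⊗[ℂ] A}
    {R : Fin N → Fin N → Fin N → Fin N → ℂ} {P P' : Fin N → Fin N → Fin N → Fin N → A}
    (hP : ∀ s t k l, ∑ a, ∑ b, R s t a b • P a b k l = ∑ a, ∑ b, R a b k l • P' s t a b)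
    {e f g h G : Fin N → Fin N → M} {θ : M} {w : Fin N → ℂ} {a b c d : ℂ}
    (hG : ∀ k l, G k l = a • ∑ s, ∑ t, R s t k l • e s t + b • f k l + c • g k l + d • h k l +
      (if k = l then w k else 0) • θ)
    (he : ∀ s t, Φ (e s t) = ∑ a, ∑ b, e a b ⊗ₜ P' a b s t)
    (hf : ∀ s t, Φ (f s t) = ∑ a, ∑ b, f a b ⊗ₜ P a b s t)
    (hg : ∀ s t, Φ (g s t) = ∑ a, ∑ b, g a b ⊗ₜ P a b s t)
    (hh : ∀ s t, Φ (h s t) = ∑ a, ∑ b, h a b ⊗ₜ P a b s t)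
    (hθ : Φ θ = θ ⊗ₜ 1)
    (hw : ∀ k l, θ ⊗ₜ[ℂ] ∑ a, w a • P a a k l = (if k = l then w k else 0) • θ ⊗ₜ[ℂ] 1)
    (k l : Fin N) : Φ (G k l) = ∑ a, ∑ b, G a b ⊗ₜ P a b k l := by
  have h1 := sum_tmul_intertwine hP e k l
  simp only [hG, map_add, map_smul, map_sum, he, hf, hg, hh, hθ, TensorProduct.add_tmul,
    Finset.sum_add_distrib, ← h1]
  congr 1
  · simp only [TensorProduct.smul_tmul', Finset.smul_sum]
  · rw [← hw]
    simp only [ite_smul, zero_smul, TensorProduct.ite_tmul, Finset.sum_ite_eq, Finset.mem_univ,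
      if_true, TensorProduct.tmul_sum, TensorProduct.smul_tmul]

end Tensor

end FODC

/-! ### Coaction axioms on the sphere. -/

namespace SUq

open Sphere

variable {Δ : SUq N q →ₐ[ℂ] SUq N q ⊗[ℂ] SUq N q} {ε : SUq N q →ₐ[ℂ] ℂ}
  {δ : Sphere N q →ₐ[ℂ] Sphere N q ⊗[ℂ] SUq N q}

theorem IsCoaction.counit (hδ : IsCoaction δ) (hε : IsCounit ε) (x : Sphere N q) :
    TensorProduct.rid ℂ _ (LinearMap.lTensor _ ε.toLinearMap (δ x)) = x := by
  let f : Sphere N q →ₐ[ℂ] Sphere N q :=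
    ((Algebra.TensorProduct.rid ℂ ℂ (Sphere N q)).toAlgHom.comp
      (Algebra.TensorProduct.map (AlgHom.id ℂ _) ε)).comp δ
  have hf : f = AlgHom.id ℂ _ := by
    apply Sphere.hom_ext
    rintro (i | i)
    · change f (z q i) = z q i
      simp [f, hδ.1, hε.1]
    · change f (zs q i) = zs q i
      simp [f, hδ.2, hε.2]
  have h2 : ∀ m : Sphere N q ⊗[ℂ] SUq N q,
      TensorProduct.rid ℂ _ (LinearMap.lTensor _ ε.toLinearMap m) =
      (Algebra.TensorProduct.rid ℂ ℂ (Sphere N q)).toAlgHom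
        (Algebra.TensorProduct.map (AlgHom.id ℂ _) ε m) := by
    intro m
    induction m with
    | zero => simp
    | add s t hs ht => simp only [map_add, hs, ht]
    | tmul x a => simp
  rw [h2]
  exact DFunLike.congr_fun hf x

theorem IsCoaction.coassoc (hδ : IsCoaction δ) (hΔ : IsComul Δ) (x : Sphere N q) :
    TensorProduct.assoc ℂ _ _ _ (LinearMap.rTensor (SUq N q) δ.toLinearMap (δ x)) =
      LinearMap.lTensor _ Δ.toLinearMap (δ x) := by
  let f : Sphere N q →ₐ[ℂ] Sphere N q ⊗[ℂ] (SUq N q ⊗[ℂ] SUq N q) :=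
    ((Algebra.TensorProduct.assoc ℂ ℂ ℂ (Sphere N q) (SUq N q) (SUq N q)).toAlgHom.comp
      (Algebra.TensorProduct.map δ (AlgHom.id ℂ _))).comp δ
  let g : Sphere N q →ₐ[ℂ] Sphere N q ⊗[ℂ] (SUq N q ⊗[ℂ] SUq N q) :=
    (Algebra.TensorProduct.map (AlgHom.id ℂ _) Δ).comp δ
  have hf : f = g := by
    apply Sphere.hom_ext
    rintro (i | i)
    · change f (z q i) = g (z q i)
      simp only [f, g, AlgHom.comp_apply, hδ.1, map_sum, Algebra.TensorProduct.map_tmul,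
        AlgHom.id_apply, hΔ.1, TensorProduct.sum_tmul, TensorProduct.tmul_sum]
      rw [Finset.sum_comm]
      rfl
    · change f (zs q i) = g (zs q i)
      simp only [f, g, AlgHom.comp_apply, hδ.2, map_sum, Algebra.TensorProduct.map_tmul,
        AlgHom.id_apply, hΔ.2, TensorProduct.sum_tmul, TensorProduct.tmul_sum]
      rw [Finset.sum_comm]
      rfl
  have h2 : ∀ m : Sphere N q ⊗[ℂ] SUq N q,
      TensorProduct.assoc ℂ _ _ _ (LinearMap.rTensor (SUq N q) δ.toLinearMap m) =
      (Algebra.TensorProduct.assoc ℂ ℂ ℂ (Sphere N q) (SUq N q) (SUq N q)).toAlgHom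
        (Algebra.TensorProduct.map δ (AlgHom.id ℂ _) m) := by
    intro m
    induction m with
    | zero => simp
    | add s t hs ht => simp only [map_add, hs, ht]
    | tmul x a => rfl
  have h3 : ∀ m : Sphere N q ⊗[ℂ] SUq N q, LinearMap.lTensor _ Δ.toLinearMap m =
      Algebra.TensorProduct.map (AlgHom.id ℂ _) Δ m := fun m => rfl
  rw [h2, h3]
  exact DFunLike.congr_fun hf x

end SUq

/-! ### Covariance of presented calculi. -/

namespace FODC

open Sphere

variable {C : FODC.{u} (Sphere N q)} {κ : Coeffs} {μ ν : ℂ}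

theorem sum_weight_mat_inv (hq : q ≠ 0) (k l : Fin N) :
    ∑ a : Fin N, (q : ℂ) ^ (2 * ((a : ℕ) + 1)) • (SUq.mat q a k * SUq.inv q l a) =
      if k = l then (q : ℂ) ^ (2 * ((k : ℕ) + 1)) • 1 else 0 := by
  have h := congrArg (fun x => (q : ℂ) ^ 2 • x) (SUq.sum_wt_mul_inv (N := N) hq k l)
  simp only [Finset.smul_sum, smul_smul, smul_ite, smul_zero] at h
  have h1 : ∀ a : Fin N, (q : ℂ) ^ (2 * ((a : ℕ) + 1)) = (q : ℂ) ^ 2 * wt q a := by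
    intro a; rw [wt]; ring
  simpa only [h1] using h

theorem sum_weight_inv_mat (hq : q ≠ 0) (a b : Fin N) :
    ∑ i : Fin N, (q : ℂ) ^ (-2 * ((i : ℤ) + 1)) • (SUq.inv q i a * SUq.mat q b i) =
      if a = b then (q : ℂ) ^ (-2 * ((a : ℤ) + 1)) • 1 else 0 := by
  have h := congrArg (fun x => ((q : ℂ) ^ 2)⁻¹ • x) (SUq.sum_wt_inv_mul_mat (N := N) hq a b)
  simp only [Finset.smul_sum, smul_smul, smul_ite, smul_zero] at h
  simpa only [zpow_weight hq] using h

theorem linearMap_apply_eq {X : Type v} [Ring X] [Algebra ℂ X] (C : FODC.{u} X) {U : Type*}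
    [AddCommGroup U] [Module ℂ U] (F G : C.form →ₗ[ℂ] U)
    (h : ∀ x y : X, F (x • C.d y) = G (x • C.d y)) (w : C.form) : F w = G w := by
  have h1 : F = G := by
    apply LinearMap.ext_on C.span_eq_top
    rintro _ ⟨p, rfl⟩
    exact h _ _
  rw [h1]

/-- A presented calculus is covariant. -/
theorem IsPresented.isCovariant (hC : C.IsPresented μ ν κ) (hq : q ≠ 0) : C.IsCovariant := by
  obtain ⟨Δ, hΔ⟩ := SUq.exists_comul N q
  obtain ⟨ε, hε⟩ := SUq.exists_counit N q
  obtain ⟨δ, hδ⟩ := Sphere.exists_coaction (N := N) hq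
  let A := SUq N q
  let L := C.tensorActL A
  let dT := LinearMap.rTensor A C.d
  let f := (Fintype.linearCombination (Sphere N q) C.dgen).restrictScalars ℂ
  -- The prospective coaction on coefficient families: `∑ x_g dg` goes to `∑ δ(x_g) (d ⊗ id) δ(g)`.
  let Ψ : (Gen N → Sphere N q) →ₗ[ℂ] C.form ⊗[ℂ] A :=
    ∑ g, (L.flip (dT (δ (gen N q g)))) ∘ₗ δ.toLinearMap ∘ₗ LinearMap.proj g
  have hΨ : ∀ c, Ψ c = ∑ g, L (δ (c g)) (dT (δ (gen N q g))) := by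
    intro c
    simp only [Ψ, LinearMap.sum_apply, LinearMap.comp_apply, LinearMap.flip_apply,
      AlgHom.toLinearMap_apply, LinearMap.proj_apply]
  have hΨs : ∀ (x : Sphere N q) c, Ψ (x • c) = L (δ x) (Ψ c) := by
    intro x c
    simp only [hΨ, Pi.smul_apply, smul_eq_mul, map_mul, L, tensorActL_mul, map_sum]
  have hdz : ∀ i, dT (δ (z q i)) = ∑ a, C.d (z q a) ⊗ₜ SUq.mat q a i := by
    intro i; simp only [hδ.1, map_sum, dT, LinearMap.rTensor_tmul]
  have hdzs : ∀ i, dT (δ (zs q i)) = ∑ a, C.d (zs q a) ⊗ₜ SUq.inv q i a := by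
    intro i; simp only [hδ.2, map_sum, dT, LinearMap.rTensor_tmul]
  have hLzs : ∀ i j, L (δ (z q i)) (dT (δ (zs q j))) =
      ∑ a, ∑ b, (z q a • C.d (zs q b)) ⊗ₜ (SUq.mat q a i * SUq.inv q j b) := by
    intro i j
    simp only [hdzs, hδ.1, map_sum, LinearMap.sum_apply, L, tensorActL_tmul]
    exact Finset.sum_comm
  have hLzz : ∀ i j, L (δ (z q i)) (dT (δ (z q j))) =
      ∑ a, ∑ b, (z q a • C.d (z q b)) ⊗ₜ (SUq.mat q a i * SUq.mat q b j) := by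
    intro i j
    simp only [hdz, hδ.1, map_sum, LinearMap.sum_apply, L, tensorActL_tmul]
    exact Finset.sum_comm
  have hLss : ∀ i j, L (δ (zs q i)) (dT (δ (zs q j))) =
      ∑ a, ∑ b, (zs q a • C.d (zs q b)) ⊗ₜ (SUq.inv q i a * SUq.inv q j b) := by
    intro i j
    simp only [hdzs, hδ.2, map_sum, LinearMap.sum_apply, L, tensorActL_tmul]
    exact Finset.sum_comm
  have hLsz : ∀ i j, L (δ (zs q i)) (dT (δ (z q j))) =
      ∑ a, ∑ b, (zs q a • C.d (z q b)) ⊗ₜ (SUq.inv q i a * SUq.mat q b j) := by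
    intro i j
    simp only [hdz, hδ.2, map_sum, LinearMap.sum_apply, L, tensorActL_tmul]
    exact Finset.sum_comm
  -- Coinvariance of Ω₊ comes from `u S(u) = 1`. For Ω₋ the factors occur in the order requiring the
  -- weighted identity `sum_weight_inv_mat`.
  have hplus : ∑ i, L (δ (z q i)) (dT (δ (zs q i))) = C.omegaPlus ⊗ₜ 1 := by
    simp only [hLzs]
    rw [Finset.sum_comm]
    have h1 : ∀ a : Fin N, ∑ i, ∑ b, (z q a • C.d (zs q b)) ⊗ₜ[ℂ]
        (SUq.mat q a i * SUq.inv q i b) = (z q a • C.d (zs q a)) ⊗ₜ 1 := by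
      intro a
      rw [Finset.sum_comm]
      simp only [← TensorProduct.tmul_sum, SUq.sum_mat_mul_inv, TensorProduct.tmul_ite,
        Finset.sum_ite_eq, Finset.mem_univ, if_true]
    simp only [h1, ← TensorProduct.sum_tmul, omegaPlus]
  have hminus : ∑ i : Fin N, (q : ℂ) ^ (-2 * ((i : ℤ) + 1)) •
      L (δ (zs q i)) (dT (δ (z q i))) = C.omegaMinus ⊗ₜ 1 := by
    simp only [hLsz, Finset.smul_sum]
    rw [Finset.sum_comm]
    have h1 : ∀ a : Fin N, ∑ i : Fin N, ∑ b, (q : ℂ) ^ (-2 * ((i : ℤ) + 1)) •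
        (zs q a • C.d (z q b)) ⊗ₜ[ℂ] (SUq.inv q i a * SUq.mat q b i) =
        ((q : ℂ) ^ (-2 * ((a : ℤ) + 1)) • (zs q a • C.d (z q a))) ⊗ₜ 1 := by
      intro a
      rw [Finset.sum_comm]
      simp only [← TensorProduct.tmul_smul, ← TensorProduct.tmul_sum, sum_weight_inv_mat hq,
        TensorProduct.tmul_ite, Finset.sum_ite_eq, Finset.mem_univ, if_true]
      rw [TensorProduct.tmul_smul, TensorProduct.smul_tmul']
    simp only [h1, ← TensorProduct.sum_tmul, omegaMinus]
  -- All relations are left multiples of one, and that one is sent to `Ω ⊗ 1`, which vanishes in the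
  -- calculus.
  have hker : ∀ c, f c = 0 → Ψ c = 0 := by
    intro c hc
    have h1 : c ∈ LinearMap.ker (Fintype.linearCombination (Sphere N q) C.dgen) := hc
    rw [hC.relations, Submodule.mem_span_singleton] at h1
    obtain ⟨x, rfl⟩ := h1
    have h2 : Ψ (omegaVec N q μ ν) = C.omega μ ν ⊗ₜ 1 := by
      have hz : ∀ i : Fin N, gen N q (Sum.inl i) = z q i := fun _ => rfl
      have hzs : ∀ i : Fin N, gen N q (Sum.inr i) = zs q i := fun _ => rfl
      rw [hΨ, Fintype.sum_sum_type]
      simp only [omegaVec, map_smul, LinearMap.smul_apply, hz, hzs]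
      rw [← Finset.smul_sum, hplus]
      simp only [mul_smul, ← Finset.smul_sum]
      rw [hminus, omega, TensorProduct.add_tmul, add_comm]
      rfl
    rw [hΨs, h2, hC.omega_eq_zero, TensorProduct.zero_tmul, map_zero]
  have hsurj : Function.Surjective f := linearCombination_surjective hC.span_dgen
  let Φ : C.form →ₗ[ℂ] C.form ⊗[ℂ] A :=
    (LinearMap.ker f).liftQ Ψ (fun c hc => hker c hc) ∘ₗ
      (f.quotKerEquivOfSurjective hsurj).symm.toLinearMap
  have hΦf : ∀ c, Φ (f c) = Ψ c := by
    intro c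
    have h1 : (f.quotKerEquivOfSurjective hsurj).symm (f c) = Submodule.Quotient.mk c := by
      rw [LinearEquiv.symm_apply_eq]; rfl
    simp only [Φ, LinearMap.comp_apply, LinearEquiv.coe_coe, h1]
    rfl
  have hΦs : ∀ (x : Sphere N q) w, Φ (x • w) = L (δ x) (Φ w) := by
    intro x w
    obtain ⟨c, rfl⟩ := hsurj w
    have h1 : x • f c = f (x • c) := ((Fintype.linearCombination _ C.dgen).map_smul x c).symm
    rw [h1, hΦf, hΦf, hΨs]
  have hΦg : ∀ g, Φ (C.d (gen N q g)) = dT (δ (gen N q g)) := by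
    intro g
    have h1 : C.d (gen N q g) = f (Pi.single g 1) := by
      simp only [f, LinearMap.restrictScalars_apply, Fintype.linearCombination_apply_single,
        one_smul, dgen]
    rw [h1, hΦf, hΨ, Finset.sum_eq_single g]
    · simp only [Pi.single_eq_same, map_one, L, tensorActL_one]
    · intro b _ hb
      simp only [Pi.single_eq_of_ne hb, map_zero, LinearMap.zero_apply]
    · simp
  have hΦz : ∀ i, Φ (C.d (z q i)) = dT (δ (z q i)) := fun i => hΦg _
  have hΦzs : ∀ i, Φ (C.d (zs q i)) = dT (δ (zs q i)) := fun i => hΦg _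
  have hΦp : Φ C.omegaPlus = C.omegaPlus ⊗ₜ 1 := by
    rw [← hplus]
    conv_lhs => rw [omegaPlus]
    simp only [map_sum, hΦs, hΦzs]
  have hΦm : Φ C.omegaMinus = C.omegaMinus ⊗ₜ 1 := by
    rw [← hminus]
    conv_lhs => rw [omegaMinus]
    simp only [map_sum, map_smul, hΦs, hΦz]
  have hzz2 : ∀ (ω : C.form), Φ ω = ω ⊗ₜ 1 → ∀ i j, Φ ((z q i * z q j) • ω) =
      ∑ a, ∑ b, ((z q a * z q b) • ω) ⊗ₜ (SUq.mat q a i * SUq.mat q b j) := by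
    intro ω hω i j
    rw [hΦs, hω]
    simp only [map_mul, hδ.1, Finset.sum_mul_sum, Algebra.TensorProduct.tmul_mul_tmul, map_sum,
      LinearMap.sum_apply, L, tensorActL_tmul, mul_one]
  have hss2 : ∀ (ω : C.form), Φ ω = ω ⊗ₜ 1 → ∀ i j, Φ ((zs q i * zs q j) • ω) =
      ∑ a, ∑ b, ((zs q a * zs q b) • ω) ⊗ₜ (SUq.inv q i a * SUq.inv q j b) := by
    intro ω hω i j
    rw [hΦs, hω]
    simp only [map_mul, hδ.2, Finset.sum_mul_sum, Algebra.TensorProduct.tmul_mul_tmul, map_sum,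
      LinearMap.sum_apply, L, tensorActL_tmul, mul_one]
  have hzs2 : ∀ (ω : C.form), Φ ω = ω ⊗ₜ 1 → ∀ i j, Φ ((z q i * zs q j) • ω) =
      ∑ a, ∑ b, ((z q a * zs q b) • ω) ⊗ₜ (SUq.mat q a i * SUq.inv q j b) := by
    intro ω hω i j
    rw [hΦs, hω]
    simp only [map_mul, hδ.1, hδ.2, Finset.sum_mul_sum, Algebra.TensorProduct.tmul_mul_tmul,
      map_sum, LinearMap.sum_apply, L, tensorActL_tmul, mul_one]
  have hsz2 : ∀ (ω : C.form), Φ ω = ω ⊗ₜ 1 → ∀ i j, Φ ((zs q i * z q j) • ω) =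
      ∑ a, ∑ b, ((zs q a * z q b) • ω) ⊗ₜ (SUq.inv q i a * SUq.mat q b j) := by
    intro ω hω i j
    rw [hΦs, hω]
    simp only [map_mul, hδ.1, hδ.2, Finset.sum_mul_sum, Algebra.TensorProduct.tmul_mul_tmul,
      map_sum, LinearMap.sum_apply, L, tensorActL_tmul, mul_one]
  have hΦpm : ∀ x y : ℂ, Φ (x • C.omegaPlus + y • C.omegaMinus) =
      (x • C.omegaPlus + y • C.omegaMinus) ⊗ₜ 1 := by
    intro x y
    simp only [map_add, map_smul, hΦp, hΦm, TensorProduct.add_tmul, TensorProduct.smul_tmul']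
  have hop : ∀ g h, Φ (op (gen N q h) • C.d (gen N q g)) =
      C.tensorActR A (δ (gen N q h)) (dT (δ (gen N q g))) := by
    rintro (k | k) (l | l)
    · change Φ (op (z q l) • C.d (z q k)) = C.tensorActR A (δ (z q l)) (dT (δ (z q k)))
      -- No Kronecker delta term occurs in this product, hence `θ = 0` and `w = 0`; the same holds
      -- for `dz_k^* z_l^*`.
      rw [coaction_normal_order (Φ := Φ) (R := rInv q)
        (e := fun s t => z q s • C.d (z q t)) (f := fun k l => z q k • C.d (z q l))
        (g := fun k l => (z q k * z q l) • C.omegaPlus) (h := fun k l => (z q k * z q l) • C.omegaMinus)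
        (G := fun k l => op (z q l) • C.d (z q k)) (θ := 0)
        (w := 0) SUq.rInv_intertwine
        (fun k l => by rw [hC.bimodule.rel_zz k l, smul_zero, add_zero])
        (fun s t => by rw [hΦs, hΦz, hLzz]) (fun s t => by rw [hΦs, hΦz, hLzz])
        (hzz2 _ hΦp) (hzz2 _ hΦm) (by rw [map_zero, TensorProduct.zero_tmul])
        (fun k l => by simp only [TensorProduct.zero_tmul, smul_zero])]
      rw [hdz]
      simp only [hδ.1, map_sum, LinearMap.sum_apply, tensorActR_tmul]
    · change Φ (op (zs q l) • C.d (z q k)) = C.tensorActR A (δ (zs q l)) (dT (δ (z q k)))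
      rw [coaction_normal_order (Φ := Φ) (R := rLeftInv q)
        (e := fun s t => zs q s • C.d (z q t)) (f := fun k l => z q k • C.d (zs q l))
        (g := fun k l => (z q k * zs q l) • C.omegaPlus) (h := fun k l => (z q k * zs q l) • C.omegaMinus)
        (G := fun k l => op (zs q l) • C.d (z q k))
        (SUq.rLeftInv_intertwine hq) hC.bimodule.rel_zs
        (fun s t => by rw [hΦs, hΦz, hLsz]) (fun s t => by rw [hΦs, hΦzs, hLzs])
        (hzs2 _ hΦp) (hzs2 _ hΦm) (hΦpm _ _)
        (fun k l => by
          rw [sum_weight_mat_inv hq]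
          split_ifs
          · rw [TensorProduct.tmul_smul]
          · rw [TensorProduct.tmul_zero, zero_smul])]
      rw [hdz]
      simp only [hδ.2, map_sum, LinearMap.sum_apply, tensorActR_tmul]
    · change Φ (op (z q l) • C.d (zs q k)) = C.tensorActR A (δ (z q l)) (dT (δ (zs q k)))
      rw [coaction_normal_order (Φ := Φ) (R := rRight q)
        (e := fun s t => z q s • C.d (zs q t)) (f := fun k l => zs q k • C.d (z q l))
        (g := fun k l => (zs q k * z q l) • C.omegaPlus) (h := fun k l => (zs q k * z q l) • C.omegaMinus)
        (G := fun k l => op (z q l) • C.d (zs q k))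
        SUq.rRight_intertwine hC.bimodule.rel_sz
        (fun s t => by rw [hΦs, hΦzs, hLzs]) (fun s t => by rw [hΦs, hΦz, hLsz])
        (hsz2 _ hΦp) (hsz2 _ hΦm) (hΦpm _ _)
        (fun k l => by
          have h1 : ∑ a, (1 : ℂ) • (SUq.inv q k a * SUq.mat q a l) = if k = l then 1 else 0 := by
            simp only [one_smul, SUq.sum_inv_mul_mat]
          refine (congrArg _ h1).trans ?_
          split_ifs
          · rw [one_smul]
          · rw [TensorProduct.tmul_zero, zero_smul])]
      rw [hdzs]
      simp only [hδ.1, map_sum, LinearMap.sum_apply, tensorActR_tmul]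
    · change Φ (op (zs q l) • C.d (zs q k)) = C.tensorActR A (δ (zs q l)) (dT (δ (zs q k)))
      rw [coaction_normal_order (Φ := Φ) (R := rConj q)
        (e := fun s t => zs q s • C.d (zs q t)) (f := fun k l => zs q k • C.d (zs q l))
        (g := fun k l => (zs q k * zs q l) • C.omegaPlus) (h := fun k l => (zs q k * zs q l) • C.omegaMinus)
        (G := fun k l => op (zs q l) • C.d (zs q k)) (θ := 0)
        (w := 0) SUq.rConj_intertwine
        (fun k l => by rw [hC.bimodule.rel_ss k l, smul_zero, add_zero])
        (fun s t => by rw [hΦs, hΦzs, hLss]) (fun s t => by rw [hΦs, hΦzs, hLss])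
        (hss2 _ hΦp) (hss2 _ hΦm) (by rw [map_zero, TensorProduct.zero_tmul])
        (fun k l => by simp only [TensorProduct.zero_tmul, smul_zero])]
      rw [hdzs]
      simp only [hδ.2, map_sum, LinearMap.sum_apply, tensorActR_tmul]
  have hopg : ∀ h (w : C.form), Φ (op (gen N q h) • w) =
      C.tensorActR A (δ (gen N q h)) (Φ w) := by
    intro h w
    have hw : w ∈ Submodule.span (Sphere N q) (Set.range C.dgen) := hC.span_dgen ▸ trivial
    induction hw using Submodule.span_induction with
    | mem w hw =>
      obtain ⟨g, rfl⟩ := hw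
      rw [dgen, hop, hΦg]
    | zero => simp only [smul_zero, map_zero]
    | add w w' _ _ h1 h2 => simp only [smul_add, map_add, h1, h2]
    | smul x w _ h1 => rw [op_smul_smul, hΦs, h1, hΦs, tensorActL_tensorActR]
  have hop' : ∀ (y : Sphere N q) (w : C.form), Φ (op y • w) = C.tensorActR A (δ y) (Φ w) := by
    intro y
    induction y using Sphere.induction with
    | hc c =>
      intro w
      rw [op_algebraMap_smul, map_smul, AlgHom.commutes, Algebra.algebraMap_eq_smul_one, map_smul,
        LinearMap.smul_apply, tensorActR_one]
    | hg g => exact hopg g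
    | hmul x y hx hy => intro w; rw [op_mul_smul, hy, hx, map_mul, tensorActR_mul]
    | hadd x y hx hy =>
      intro w; rw [op_add, add_smul, map_add, hx, hy, map_add, map_add, LinearMap.add_apply]
  have hd : ∀ x, Φ (C.d x) = dT (δ x) := by
    intro x
    induction x using Sphere.induction with
    | hc c =>
      rw [d_algebraMap, map_zero, AlgHom.commutes, Algebra.algebraMap_eq_smul_one, map_smul,
        Algebra.TensorProduct.one_def]
      simp only [dT, LinearMap.rTensor_tmul, d_one, TensorProduct.zero_tmul, smul_zero]
    | hg g => exact hΦg g
    | hmul x y hx hy =>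
      rw [leibniz, map_add, hop', hΦs, hx, hy, map_mul]
      exact (rTensor_d_mul C _ _).symm
    | hadd x y hx hy => simp only [map_add, hx, hy]
  have hxdy : ∀ x y, Φ (x • C.d y) = L (δ x) (dT (δ y)) := fun x y => by rw [hΦs, hd]
  refine ⟨Δ, ε, δ, Φ, hΔ, hε, hδ, ?_, ?_, ?_, hd⟩
  -- The comodule axioms for forms are tested on the spanning elements `x dy`, where they follow
  -- from those of the coaction on the algebra.
  · refine C.linearMap_apply_eq ((TensorProduct.assoc ℂ C.form A A).toLinearMap ∘ₗ LinearMap.rTensor A Φ ∘ₗ Φ)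
      (LinearMap.lTensor C.form Δ.toLinearMap ∘ₗ Φ) ?_
    intro x y
    simp only [LinearMap.comp_apply, LinearEquiv.coe_coe, hxdy, L, dT]
    rw [assoc_rTensor_tensorActL C (δ := δ.toLinearMap) hxdy, hδ.coassoc hΔ, hδ.coassoc hΔ,
      comul_tensorActL]
  · refine C.linearMap_apply_eq ((TensorProduct.rid ℂ C.form).toLinearMap ∘ₗ
      LinearMap.lTensor C.form ε.toLinearMap ∘ₗ Φ) LinearMap.id ?_
    intro x y
    simp only [LinearMap.comp_apply, LinearEquiv.coe_coe, hxdy, L, dT, LinearMap.id_apply]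
    rw [counit_tensorActL, hδ.counit hε, hδ.counit hε]
  · intro x y w
    rw [hΦs, hop']

end FODC

/-! ### Scalar conditions for the quotient by one invariant form. -/

/-- The relation `μ Ω₊ + ν Ω₋ = 0` makes the coefficients `κ` and `κ'` equivalent. -/
structure Coeffs.EquivMod (μ ν : ℂ) (κ κ' : Coeffs) : Prop where
  a1 : κ.a1 = κ'.a1
  b1 : κ.b1 = κ'.b1
  ce1 : (κ.c1 - κ'.c1) * ν = (κ.e1 - κ'.e1) * μ
  a2 : κ.a2 = κ'.a2
  b2 : κ.b2 = κ'.b2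
  ce2 : (κ.c2 - κ'.c2) * ν = (κ.e2 - κ'.e2) * μ
  a3 : κ.a3 = κ'.a3
  b3 : κ.b3 = κ'.b3
  ce3 : (κ.c3 - κ'.c3) * ν = (κ.e3 - κ'.e3) * μ
  df3 : (κ.d3 - κ'.d3) * ν = (κ.f3 - κ'.f3) * μ
  a4 : κ.a4 = κ'.a4
  b4 : κ.b4 = κ'.b4
  ce4 : (κ.c4 - κ'.c4) * ν = (κ.e4 - κ'.e4) * μ
  df4 : (κ.d4 - κ'.d4) * ν = (κ.f4 - κ'.f4) * μ

/-- The condition that `μ Ω₊ + ν Ω₋` generates a sub-bimodule as a left module. -/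
structure Coeffs.Generates (q : ℝ) (μ ν : ℂ) (κ : Coeffs) : Prop where
  dz : μ * κ.b4 + ν * (((q : ℂ) ^ 2)⁻¹ * κ.b1) = 0
  dzs : μ * κ.b2 + ν * (((q : ℂ) ^ 2)⁻¹ * κ.b3) = 0
  mul_z : (μ * (q * κ.a4 + κ.c4 + κ.d4) + ν * (((q : ℂ) ^ 2)⁻¹ * κ.c1)) * ν =
    (μ * (κ.e4 + κ.f4) + ν * ((q : ℂ)⁻¹ * κ.a1 + ((q : ℂ) ^ 2)⁻¹ * κ.e1)) * μ
  mul_zs : (μ * (q * κ.a2 + κ.c2) + ν * (((q : ℂ) ^ 2)⁻¹ * κ.c3 + κ.d3)) * ν =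
    (μ * κ.e2 + ν * ((q : ℂ)⁻¹ * κ.a3 + ((q : ℂ) ^ 2)⁻¹ * κ.e3 + κ.f3)) * μ

namespace FODC

open Sphere

variable {C : FODC.{u} (Sphere N q)} {κ κ' : Coeffs} {μ ν : ℂ}

/-- Proportional combinations of two vectors satisfying a linear relation. -/
theorem combination_eq {M : Type*} [AddCommGroup M] [Module ℂ M] {u v : M}
    (hμν : μ = 1 ∨ μ = 0 ∧ ν = 1) (h : μ • u + ν • v = 0) {c e c' e' : ℂ}
    (hce : (c - c') * ν = (e - e') * μ) : c • u + e • v = c' • u + e' • v := by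
  rcases hμν with rfl | ⟨rfl, rfl⟩
  · rw [one_smul] at h
    rw [eq_neg_of_add_eq_zero_left h]
    have he : e = e' + (c - c') * ν := by rw [hce]; ring
    rw [he]
    module
  · rw [zero_smul, zero_add, one_smul] at h
    have hc : c = c' := by linear_combination hce
    rw [h, hc, smul_zero, smul_zero]

/-- A table is determined only modulo the relation: two pairs of coefficients of Ω₊, Ω₋ give the
same form if their difference is proportional to (μ, ν). -/
theorem HasBimoduleStructure.change (h : C.HasBimoduleStructure κ)
    (hμν : μ = 1 ∨ μ = 0 ∧ ν = 1) (hω : C.omega μ ν = 0) (hκ : Coeffs.EquivMod μ ν κ κ') :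
    C.HasBimoduleStructure κ' := by
  have key : ∀ (x : Sphere N q) {c e c' e' : ℂ}, (c - c') * ν = (e - e') * μ →
      c • (x • C.omegaPlus) + e • (x • C.omegaMinus) =
        c' • (x • C.omegaPlus) + e' • (x • C.omegaMinus) := by
    intro x c e c' e' hce
    simpa only [smul_add, smul_csmul] using congrArg (x • ·) (combination_eq hμν hω hce)
  constructor
  · intro k l
    rw [h.rel_zz, hκ.a1, hκ.b1, add_assoc, add_assoc _ (κ'.c1 • _), key _ hκ.ce1]
  · intro k l
    rw [h.rel_ss, hκ.a2, hκ.b2, add_assoc, add_assoc _ (κ'.c2 • _), key _ hκ.ce2]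
  · intro k l
    rw [h.rel_zs, hκ.a3, hκ.b3, add_assoc _ (κ.c3 • _), add_assoc _ (κ'.c3 • _), key _ hκ.ce3,
      combination_eq hμν hω hκ.df3]
  · intro k l
    rw [h.rel_sz, hκ.a4, hκ.b4, add_assoc _ (κ.c4 • _), add_assoc _ (κ'.c4 • _), key _ hκ.ce4,
      combination_eq hμν hω hκ.df4]

/-- The hypothesis `c ν = e μ` says that (c, e) is a multiple of (μ, ν), given that the latter is
normalised to (1, ν) or (0, 1). -/
theorem combination_mem_span {M : Type*} [AddCommGroup M] [Module ℂ M] {X : Type*} [Ring X]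
    [Algebra ℂ X] [Module X M] [IsScalarTower ℂ X M] {u v : M} (hμν : μ = 1 ∨ μ = 0 ∧ ν = 1)
    {c e : ℂ} (hce : c * ν = e * μ) (x : X) :
    x • (c • u + e • v) ∈ Submodule.span X {μ • u + ν • v} := by
  refine Submodule.smul_mem _ _ ?_
  rcases hμν with rfl | ⟨rfl, rfl⟩
  · rw [mul_one] at hce
    have h1 : c • u + e • v = algebraMap ℂ X c • ((1 : ℂ) • u + ν • v) := by
      rw [algebraMap_smul, ← hce]; module
    rw [h1]
    exact Submodule.smul_mem _ _ (Submodule.mem_span_singleton_self _)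
  · have hc : c = 0 := by simpa using hce
    have h1 : c • u + e • v = algebraMap ℂ X e • ((0 : ℂ) • u + (1 : ℂ) • v) := by
      rw [algebraMap_smul, hc]; module
    rw [h1]
    exact Submodule.smul_mem _ _ (Submodule.mem_span_singleton_self _)

theorem HasBimoduleStructure.op_smul_omega_mem (h : C.HasBimoduleStructure κ) (hq : q ≠ 0)
    (hμν : μ = 1 ∨ μ = 0 ∧ ν = 1) (hκ : Coeffs.Generates q μ ν κ) (g : Gen N) :
    op (gen N q g) • C.omega μ ν ∈ Submodule.span (Sphere N q) {C.omega μ ν} := by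
  rcases g with l | l
  · have h1 : op (z q l) • C.omega μ ν = z q l • ((μ * (q * κ.a4 + κ.c4 + κ.d4) +
        ν * (((q : ℂ) ^ 2)⁻¹ * κ.c1)) • C.omegaPlus + (μ * (κ.e4 + κ.f4) +
        ν * ((q : ℂ)⁻¹ * κ.a1 + ((q : ℂ) ^ 2)⁻¹ * κ.e1)) • C.omegaMinus) := by
      rw [omega, smul_add, op_smul_csmul, op_smul_csmul, h.omegaPlus_mul_z hq,
        h.omegaMinus_mul_z hq, smul_add (z q l), smul_csmul, smul_csmul]
      generalize z q l • C.omegaPlus = A, z q l • C.omegaMinus = B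
      -- The form `dz_l` is not a multiple of Ω in general; its total coefficient is zero by
      -- `hκ.dz`.
      linear_combination (norm := module) hκ.dz • C.d (z q l)
    change op (z q l) • C.omega μ ν ∈ _
    rw [h1]
    exact combination_mem_span hμν hκ.mul_z _
  · have h1 : op (zs q l) • C.omega μ ν = zs q l • ((μ * (q * κ.a2 + κ.c2) +
        ν * (((q : ℂ) ^ 2)⁻¹ * κ.c3 + κ.d3)) • C.omegaPlus + (μ * κ.e2 +
        ν * ((q : ℂ)⁻¹ * κ.a3 + ((q : ℂ) ^ 2)⁻¹ * κ.e3 + κ.f3)) • C.omegaMinus) := by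
      rw [omega, smul_add, op_smul_csmul, op_smul_csmul, h.omegaPlus_mul_zs hq,
        h.omegaMinus_mul_zs hq, smul_add (zs q l), smul_csmul, smul_csmul]
      generalize zs q l • C.omegaPlus = A, zs q l • C.omegaMinus = B
      linear_combination (norm := module) hκ.dzs • C.d (zs q l)
    change op (zs q l) • C.omega μ ν ∈ _
    rw [h1]
    exact combination_mem_span hμν hκ.mul_zs _

theorem IsFreeCalculus.factor_isPresented (h : C.IsFreeCalculus κ) (hq : q ≠ 0)
    (hμν : μ = 1 ∨ μ = 0 ∧ ν = 1) (hg : Coeffs.Generates q μ ν κ)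
    (hκ : Coeffs.EquivMod μ ν κ κ') : (C.factor (C.omega μ ν)).IsPresented μ ν κ' := by
  have h1 : (C.factor (C.omega μ ν)).IsPresented μ ν κ :=
    ⟨span_dgen_factor h.span_dgen _,
      relations_factor h.linearIndependent (h.bimodule.op_smul_omega_mem hq hμν hg),
      h.bimodule.factor _⟩
  exact ⟨h1.span_dgen, h1.relations, h1.bimodule.change hμν h1.omega_eq_zero hκ⟩

theorem factorEq_of_isPresented (hq : q ≠ 0) (h : (C.factor (C.omega μ ν)).IsPresented μ ν κ) :
    C.FactorEq μ ν κ :=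
  ⟨⟨h.isCovariant hq, h.span_dgen, h.relations, h.bimodule⟩,
    fun _ hD => h.isomorphic hD.isPresented⟩

end FODC

/-! ### Star maps on presented calculi. -/

namespace FODC

open Sphere

variable {C : FODC.{u} (Sphere N q)} {κ κ' : Coeffs} {μ ν : ℂ}

/-- An additive map on one-forms with `J(x ω) = J(ω) x^*` and `J(d g) = d(g^*)` for the generators
`g`. -/
structure IsStarMap (C : FODC.{u} (Sphere N q)) (J : C.form →+ C.form) : Prop where
  smul : ∀ (x : Sphere N q) w, J (x • w) = op (star x) • J w
  dz : ∀ i, J (C.d (z q i)) = C.d (zs q i)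
  dzs : ∀ i, J (C.d (zs q i)) = C.d (z q i)

theorem star_algebraMap (c : ℂ) :
    star (algebraMap ℂ (Sphere N q) c) = algebraMap ℂ _ (starRingEnd ℂ c) := by
  rw [Algebra.algebraMap_eq_smul_one, star_smul, star_one, Algebra.algebraMap_eq_smul_one]
  rfl

theorem IsStarMap.csmul {J : C.form →+ C.form} (hJ : C.IsStarMap J) (c : ℂ) (w : C.form) :
    J (c • w) = starRingEnd ℂ c • J w := by
  rw [← algebraMap_smul (Sphere N q) c w, hJ.smul, star_algebraMap, op_algebraMap_smul]

/-- Differentiate `∑ z_i z_i^* = 1`. The left side is what the star should make of Ω₊, so this is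
the source of the sign in `J Ω₊ = -Ω₊`. -/
theorem sum_z_op_smul (C : FODC.{u} (Sphere N q)) :
    ∑ i, op (zs q i) • C.d (z q i) = -C.omegaPlus := by
  have h := congrArg C.d (sum_z_mul_zs N q)
  simp only [map_sum, leibniz, Finset.sum_add_distrib, d_one] at h
  exact eq_neg_of_add_eq_zero_left h

theorem sum_zs_op_smul (C : FODC.{u} (Sphere N q)) (hq : q ≠ 0) :
    ∑ i : Fin N, (q : ℂ) ^ (-2 * ((i : ℤ) + 1)) • (op (z q i) • C.d (zs q i)) =
      -C.omegaMinus := by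
  have h := congrArg (fun x => ((q : ℂ) ^ 2)⁻¹ • C.d x) (sum_wt_inv_zs_mul_z (N := N) hq)
  simp only [map_sum, map_smul, leibniz, smul_add, Finset.sum_add_distrib, d_one, smul_zero,
    Finset.smul_sum, smul_smul, ← zpow_weight hq] at h
  exact eq_neg_of_add_eq_zero_left h

theorem IsStarMap.omegaPlus {J : C.form →+ C.form} (hJ : C.IsStarMap J) :
    J C.omegaPlus = -C.omegaPlus := by
  rw [← sum_z_op_smul, FODC.omegaPlus]
  simp only [map_sum, hJ.smul, hJ.dzs, star_z]

theorem IsStarMap.omegaMinus {J : C.form →+ C.form} (hJ : C.IsStarMap J) (hq : q ≠ 0) :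
    J C.omegaMinus = -C.omegaMinus := by
  rw [← sum_zs_op_smul C hq, FODC.omegaMinus]
  simp only [map_sum, hJ.csmul, hJ.smul, hJ.dz, star_zs, map_zpow₀, Complex.conj_ofReal]

theorem IsPresented.exists_isStarMap (hC : C.IsPresented μ ν κ) (hq : q ≠ 0)
    (hμ : starRingEnd ℂ μ = μ) (hν : starRingEnd ℂ ν = ν) : ∃ J, C.IsStarMap J := by
  let f := Fintype.linearCombination (Sphere N q) C.dgen
  have hsurj : Function.Surjective f := linearCombination_surjective hC.span_dgen
  let Ψ : (Gen N → Sphere N q) →+ C.form :=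
    AddMonoidHom.mk' (fun c => ∑ g, op (star (c g)) • C.d (star (gen N q g))) (by
      intro c c'
      simp only [Pi.add_apply, star_add, op_add, add_smul, Finset.sum_add_distrib])
  have hΨ : ∀ c, Ψ c = ∑ g, op (star (c g)) • C.d (star (gen N q g)) := fun _ => rfl
  have hΨs : ∀ (x : Sphere N q) c, Ψ (x • c) = op (star x) • Ψ c := by
    intro x c
    simp only [hΨ, Pi.smul_apply, smul_eq_mul, star_mul, op_mul_smul, Finset.smul_sum]
  -- The relation is sent to `-(μ Ω₊ + ν Ω₋)`; reality of μ and ν is essential, since otherwise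
  -- their conjugates would appear.
  have hΨω : Ψ (omegaVec N q μ ν) = 0 := by
    have h0 : ∀ i : Fin N, star (gen N q (Sum.inl i)) = zs q i := star_z
    have h1 : ∀ i : Fin N, star (gen N q (Sum.inr i)) = z q i := star_zs
    rw [hΨ, Fintype.sum_sum_type]
    simp only [omegaVec, star_smul, h0, h1, star_z, star_zs, op_csmul_smul, RCLike.star_def,
      map_mul, hμ, hν, map_zpow₀, Complex.conj_ofReal, mul_smul]
    rw [← Finset.smul_sum, ← Finset.smul_sum, sum_zs_op_smul C hq, sum_z_op_smul]
    have h2 := hC.omega_eq_zero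
    rw [omega] at h2
    rw [smul_neg, smul_neg, ← neg_add, add_comm, h2, neg_zero]
  have hker : ∀ c c', f c = f c' → Ψ c = Ψ c' := by
    intro c c' h
    have h1 : c - c' ∈ LinearMap.ker f := by rw [LinearMap.mem_ker, map_sub, h, sub_self]
    rw [hC.relations, Submodule.mem_span_singleton] at h1
    obtain ⟨x, hx⟩ := h1
    rw [← sub_eq_zero, ← map_sub, ← hx, hΨs, hΨω, smul_zero]
  -- Ψ turns left multiplication into right multiplication by the star, so it is not left linear. It
  -- is transported to the forms through arbitrary preimages, which `hker` shows to be harmless.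
  have hinv := Function.surjInv_eq hsurj
  let J : C.form →+ C.form := AddMonoidHom.mk' (fun w => Ψ (Function.surjInv hsurj w)) (by
    intro w w'
    rw [← map_add]
    apply hker
    rw [map_add, hinv, hinv, hinv])
  have hJ : ∀ c, J (f c) = Ψ c := fun c => hker _ _ (hinv _)
  have hgen : ∀ g, J (C.d (gen N q g)) = C.d (star (gen N q g)) := by
    intro g
    have h1 : C.d (gen N q g) = f (Pi.single g 1) := by
      simp only [f, Fintype.linearCombination_apply_single, one_smul, dgen]
    rw [h1, hJ, hΨ, Finset.sum_eq_single g]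
    · simp only [Pi.single_eq_same, star_one, op_one, one_smul]
    · intro b _ hb
      simp only [Pi.single_eq_of_ne hb, star_zero, op_zero, zero_smul]
    · simp
  refine ⟨J, ?_, fun i => ?_, fun i => ?_⟩
  · intro x w
    obtain ⟨c, rfl⟩ := hsurj w
    rw [← map_smul, hJ, hJ, hΨs]
  · rw [← star_z]; exact hgen _
  · rw [← star_zs]; exact hgen _

/-- A star map which is compatible with the right multiplication of differentials of generators
makes the calculus a `*`-calculus. -/
theorem IsStarMap.isStarCalculus {J : C.form →+ C.form} (hJ : C.IsStarMap J)
    (hspan : Submodule.span (Sphere N q) (Set.range C.dgen) = ⊤)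
    (hzz : ∀ k l : Fin N, J (op (z q l) • C.d (z q k)) = zs q l • C.d (zs q k))
    (hss : ∀ k l : Fin N, J (op (zs q l) • C.d (zs q k)) = z q l • C.d (z q k))
    (hzs : ∀ k l : Fin N, J (op (zs q l) • C.d (z q k)) = z q l • C.d (zs q k))
    (hsz : ∀ k l : Fin N, J (op (z q l) • C.d (zs q k)) = zs q l • C.d (z q k)) :
    C.IsStarCalculus := by
  have hgen : ∀ g, J (C.d (gen N q g)) = C.d (star (gen N q g)) := by
    rintro (i | i)
    · exact (hJ.dz i).trans (congrArg C.d (star_z i).symm)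
    · exact (hJ.dzs i).trans (congrArg C.d (star_zs i).symm)
  have hop : ∀ g h, J (op (gen N q h) • C.d (gen N q g)) =
      star (gen N q h) • C.d (star (gen N q g)) := by
    have h0 : ∀ i : Fin N, star (gen N q (Sum.inl i)) = zs q i := star_z
    have h1 : ∀ i : Fin N, star (gen N q (Sum.inr i)) = z q i := star_zs
    rintro (k | k) (l | l)
    · rw [h0, h0]; exact hzz k l
    · rw [h0, h1]; exact hzs k l
    · rw [h0, h1]; exact hsz k l
    · rw [h1, h1]; exact hss k l
  have hopg : ∀ h w, J (op (gen N q h) • w) = star (gen N q h) • J w := by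
    intro h w
    have hw : w ∈ Submodule.span (Sphere N q) (Set.range C.dgen) := hspan ▸ trivial
    induction hw using Submodule.span_induction with
    | mem w hw =>
      obtain ⟨g, rfl⟩ := hw
      rw [dgen, hop, hgen]
    | zero => simp only [smul_zero, map_zero]
    | add w w' _ _ h1 h2 => simp only [smul_add, map_add, h1, h2]
    | smul x w _ h1 => rw [op_smul_smul, hJ.smul, h1, hJ.smul, op_smul_smul]
  have hop' : ∀ (y : Sphere N q) (w : C.form), J (op y • w) = star y • J w := by
    intro y
    induction y using Sphere.induction with
    | hc c => intro w; rw [op_algebraMap_smul, hJ.csmul, star_algebraMap, algebraMap_smul]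
    | hg g => exact hopg g
    | hmul x y hx hy => intro w; rw [op_mul_smul, hy, hx, star_mul, mul_smul]
    | hadd x y hx hy => intro w; rw [op_add, add_smul, map_add, hx, hy, star_add, add_smul]
  have hd : ∀ x, J (C.d x) = C.d (star x) := by
    intro x
    induction x using Sphere.induction with
    | hc c => rw [star_algebraMap, d_algebraMap, d_algebraMap, map_zero]
    | hg g => exact hgen g
    | hmul x y hx hy =>
      rw [leibniz, map_add, hop', hJ.smul, hx, hy, star_mul, leibniz, add_comm]
    | hadd x y hx hy => simp only [map_add, star_add, hx, hy]
  intro n x y h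
  have h1 := congrArg J h
  simpa only [map_sum, hJ.smul, hd, map_zero] using h1

/-- The bimodule structure of a calculus whose invariant one-forms are the multiples of `θ`; only
the coefficients `a, b, c, d` of `κ` are used. -/
structure HasThetaStructure (C : FODC.{u} (Sphere N q)) (θ : C.form) (κ : Coeffs)
    (x₁ y₁ x₂ y₂ : ℂ) : Prop where
  rel_zz : ∀ k l, op (z q l) • C.d (z q k) =
    κ.a1 • ∑ s, ∑ t, rInv q s t k l • (z q s • C.d (z q t))
      + κ.b1 • (z q k • C.d (z q l)) + κ.c1 • ((z q k * z q l) • θ)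
  rel_ss : ∀ k l, op (zs q l) • C.d (zs q k) =
    κ.a2 • ∑ s, ∑ t, rConj q s t k l • (zs q s • C.d (zs q t))
      + κ.b2 • (zs q k • C.d (zs q l)) + κ.c2 • ((zs q k * zs q l) • θ)
  rel_zs : ∀ k l, op (zs q l) • C.d (z q k) =
    κ.a3 • ∑ s, ∑ t, rLeftInv q s t k l • (zs q s • C.d (z q t))
      + κ.b3 • (z q k • C.d (zs q l)) + κ.c3 • ((z q k * zs q l) • θ)
      + (if k = l then (q : ℂ) ^ 2 * wt q k else 0) • (κ.d3 • θ)
  rel_sz : ∀ k l, op (z q l) • C.d (zs q k) =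
    κ.a4 • ∑ s, ∑ t, rRight q s t k l • (z q s • C.d (zs q t))
      + κ.b4 • (zs q k • C.d (z q l)) + κ.c4 • ((zs q k * z q l) • θ)
      + (if k = l then (1 : ℂ) else 0) • (κ.d4 • θ)
  theta_z : ∀ l, op (z q l) • θ = x₁ • (z q l • θ) + y₁ • C.d (z q l)
  theta_zs : ∀ l, op (zs q l) • θ = x₂ • (zs q l • θ) + y₂ • C.d (zs q l)

/-- The coefficients `a, b, c, d` are real. -/
structure _root_.QSphere.Coeffs.IsReal (κ : Coeffs) : Prop where
  a1 : starRingEnd ℂ κ.a1 = κ.a1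
  b1 : starRingEnd ℂ κ.b1 = κ.b1
  c1 : starRingEnd ℂ κ.c1 = κ.c1
  a2 : starRingEnd ℂ κ.a2 = κ.a2
  b2 : starRingEnd ℂ κ.b2 = κ.b2
  c2 : starRingEnd ℂ κ.c2 = κ.c2
  a3 : starRingEnd ℂ κ.a3 = κ.a3
  b3 : starRingEnd ℂ κ.b3 = κ.b3
  c3 : starRingEnd ℂ κ.c3 = κ.c3
  d3 : starRingEnd ℂ κ.d3 = κ.d3
  a4 : starRingEnd ℂ κ.a4 = κ.a4
  b4 : starRingEnd ℂ κ.b4 = κ.b4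
  c4 : starRingEnd ℂ κ.c4 = κ.c4
  d4 : starRingEnd ℂ κ.d4 = κ.d4

variable {θ : C.form} {x₁ y₁ x₂ y₂ : ℂ} {J : C.form →+ C.form}

theorem IsStarMap.op_z_smul_dz (hJ : C.IsStarMap J) (hq : q ≠ 0)
    (h : C.HasThetaStructure θ κ x₁ y₁ x₂ y₂) (hθ : J θ = -θ) (hκ : κ.IsReal)
    (c1 : κ.a1 * κ.b2 + (κ.b1 - κ.c1 * y₂) * κ.a2 = 0)
    (c2 : κ.a1 * κ.a2 + (κ.b1 - κ.c1 * y₂) * κ.b2 + bigQ q * (κ.b1 - κ.c1 * y₂) * κ.a2 -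
      κ.c1 * x₂ * y₂ = 1)
    (c3 : κ.a1 * κ.c2 * (q : ℂ)⁻¹ + (κ.b1 - κ.c1 * y₂) * κ.c2 - κ.c1 * x₂ ^ 2 = 0)
    (k l : Fin N) : J (op (z q l) • C.d (z q k)) = zs q l • C.d (zs q k) := by
  have hqq : (q : ℂ) * (q : ℂ)⁻¹ = 1 := mul_inv_cancel₀ (by exact_mod_cast hq)
  have hQ : bigQ q = q - (q : ℂ)⁻¹ := rfl
  have h1 : ∀ k l, op (zs q l) • C.d (zs q k) =
      κ.a2 • ((if k = l then (q : ℂ) else 1) • (zs q l • C.d (zs q k)) +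
        (if l < k then bigQ q else 0) • (zs q k • C.d (zs q l))) +
      κ.b2 • (zs q k • C.d (zs q l)) + κ.c2 • (zs q k • zs q l • θ) := by
    intro k l
    rw [h.rel_ss, sum_rConj, mul_smul]
  -- J sends `z_k z_l θ` to `-θ z_l^* z_k^*`, which is brought to normal order by moving θ past both
  -- factors.
  have h2 : op (zs q l * zs q k) • θ = x₂ • (zs q l • (x₂ • (zs q k • θ) + y₂ • C.d (zs q k))) +
      y₂ • (op (zs q k) • C.d (zs q l)) := by
    rw [op_mul_smul, h.theta_zs, smul_add, op_smul_csmul, op_smul_smul, op_smul_csmul, h.theta_zs]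
  rw [h.rel_zz, sum_rInv]
  simp only [map_add, hJ.csmul, hJ.smul, hJ.dz, star_z, star_mul, hθ, hκ.a1, hκ.b1, hκ.c1,
    apply_ite (starRingEnd ℂ), map_inv₀, Complex.conj_ofReal, map_one, map_zero, conj_bigQ,
    map_sub, smul_neg, h2]
  -- For `k ≠ l` the coefficients of `z_l^* dz_k^*`, `z_k^* dz_l^*` and of the reordered θ-term are
  -- compared separately. For `k = l` the first two forms coincide and only a combination of `c1`
  -- and `c2` is needed.
  rcases lt_trichotomy k l with hkl | rfl | hkl
  · have h3 : zs q l • zs q k • θ = (q : ℂ) • (zs q k • zs q l • θ) := by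
      rw [← mul_smul, zs_mul_zs hkl, smul_assoc, mul_smul]
    simp only [h1, hkl.ne, hkl.ne', hkl, hkl.not_gt, if_true, if_false, smul_add, smul_csmul, h3]
    generalize zs q l • C.d (zs q k) = A, zs q k • C.d (zs q l) = B, zs q k • zs q l • θ = D
    match_scalars
    · linear_combination c2
    · linear_combination c1
    · linear_combination q * c3 - κ.a1 * κ.c2 * hqq
  · simp only [h1, lt_irrefl, if_true, if_false, smul_add, smul_csmul]
    generalize zs q k • C.d (zs q k) = A, zs q k • zs q k • θ = D
    match_scalars
    · rw [hQ] at c2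
      linear_combination c2 + (q : ℂ)⁻¹ * c1 + κ.a1 * κ.a2 * hqq
    · linear_combination c3
  · have h3 : zs q k • zs q l • θ = (q : ℂ) • (zs q l • zs q k • θ) := by
      rw [← mul_smul, zs_mul_zs hkl, smul_assoc, mul_smul]
    simp only [h1, hkl.ne, hkl.ne', hkl, hkl.not_gt, if_true, if_false, smul_add, smul_csmul, h3]
    generalize zs q l • C.d (zs q k) = A, zs q k • C.d (zs q l) = B, zs q l • zs q k • θ = D
    match_scalars
    · linear_combination c2 - bigQ q * c1
    · linear_combination c1
    · rw [hQ]
      linear_combination c3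

end FODC

/-- The star reverses products and so exchanges the two indices of each pair; this symmetry restores
the original index order. -/
theorem rRight_swap (i j k l : Fin N) : rRight q i j k l = rRight q j i l k := by
  rw [rRight_eq, rRight_eq]
  grind

theorem rLeftInv_swap (hq : q ≠ 0) (i j k l : Fin N) :
    rLeftInv q i j k l = rLeftInv q j i l k := by
  rw [rLeftInv_eq hq, rLeftInv_eq hq]
  grind

section Sums

variable {M : Type*} [AddCommGroup M] [Module ℂ M]

theorem sum_smul_swap {c : Fin N → Fin N → Fin N → Fin N → ℂ}
    (hc : ∀ i j k l, c i j k l = c j i l k) (k l : Fin N) (f : Fin N → Fin N → M) :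
    ∑ s, ∑ t, c s t k l • f t s = ∑ s, ∑ t, c s t l k • f s t := by
  rw [Finset.sum_comm]
  simp only [hc _ _ k l]

theorem sum_smul_sum_smul {c c' : Fin N → Fin N → Fin N → Fin N → ℂ}
    (hc : ∀ k l s t, ∑ a, ∑ b, c a b k l * c' s t a b = if k = s ∧ l = t then 1 else 0)
    (k l : Fin N) (f : Fin N → Fin N → M) :
    ∑ s, ∑ t, c s t k l • ∑ a, ∑ b, c' a b s t • f a b = f k l := by
  simp only [Finset.smul_sum, smul_smul]
  rw [sum_comm_pair]
  simp only [← Finset.sum_smul, hc, ite_and, ite_smul, zero_smul, one_smul, Finset.sum_ite_eq,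
    Finset.mem_univ, if_true, Finset.sum_ite_irrel, Finset.sum_const_zero]

end Sums

theorem sum_rRight_wt (hq : q ≠ 0) (k l : Fin N) :
    ∑ s, rRight q s s k l * wt q s = if k = l then (q : ℂ)⁻¹ * (q : ℂ) ^ (2 * N) else 0 := by
  have h := sum_rRight (q := q) k l (fun s t => if s = t then wt q s else 0)
  simp only [smul_eq_mul, mul_ite, mul_zero, Finset.sum_ite_eq, Finset.mem_univ, if_true] at h
  rw [h]
  split_ifs with h1 h2
  · rw [sum_lt_bigQ_wt hq]; ring
  · exact absurd h2.symm h1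
  · rfl

namespace FODC

open Sphere

variable {C : FODC.{u} (Sphere N q)} {κ : Coeffs} {θ : C.form} {x₁ y₁ x₂ y₂ : ℂ}
  {J : C.form →+ C.form}

theorem IsStarMap.op_zs_smul_dzs (hJ : C.IsStarMap J) (hq : q ≠ 0)
    (h : C.HasThetaStructure θ κ x₁ y₁ x₂ y₂) (hθ : J θ = -θ) (hκ : κ.IsReal)
    (c1 : κ.a2 * κ.b1 + (κ.b2 - κ.c2 * y₁) * κ.a1 = 0)
    (c2 : κ.a1 * κ.a2 + (κ.b2 - κ.c2 * y₁) * κ.b1 - bigQ q * (κ.b2 - κ.c2 * y₁) * κ.a1 -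
      κ.c2 * x₁ * y₁ = 1)
    (c3 : κ.a2 * κ.c1 * q + (κ.b2 - κ.c2 * y₁) * κ.c1 - κ.c2 * x₁ ^ 2 = 0)
    (k l : Fin N) : J (op (zs q l) • C.d (zs q k)) = z q l • C.d (z q k) := by
  have hqq : (q : ℂ) * (q : ℂ)⁻¹ = 1 := mul_inv_cancel₀ (by exact_mod_cast hq)
  have hQ : bigQ q = q - (q : ℂ)⁻¹ := rfl
  have h1 : ∀ k l, op (z q l) • C.d (z q k) =
      κ.a1 • ((if k = l then (q : ℂ)⁻¹ else 1) • (z q l • C.d (z q k)) -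
        (if l < k then bigQ q else 0) • (z q k • C.d (z q l))) +
      κ.b1 • (z q k • C.d (z q l)) + κ.c1 • (z q k • z q l • θ) := by
    intro k l
    rw [h.rel_zz, sum_rInv, mul_smul]
  have h2 : op (z q l * z q k) • θ = x₁ • (z q l • (x₁ • (z q k • θ) + y₁ • C.d (z q k))) +
      y₁ • (op (z q k) • C.d (z q l)) := by
    rw [op_mul_smul, h.theta_z, smul_add, op_smul_csmul, op_smul_smul, op_smul_csmul, h.theta_z]
  rw [h.rel_ss, sum_rConj]
  simp only [map_add, hJ.csmul, hJ.smul, hJ.dzs, star_zs, star_mul, hθ, hκ.a2, hκ.b2, hκ.c2,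
    apply_ite (starRingEnd ℂ), map_inv₀, Complex.conj_ofReal, map_one, map_zero, conj_bigQ,
    map_sub, smul_neg, h2]
  rcases lt_trichotomy k l with hkl | rfl | hkl
  · have h3 : z q k • z q l • θ = (q : ℂ) • (z q l • z q k • θ) := by
      rw [← mul_smul, z_mul_z hkl, smul_assoc, mul_smul]
    simp only [h1, hkl.ne, hkl.ne', hkl, hkl.not_gt, if_true, if_false, smul_add, smul_sub,
      smul_csmul, h3]
    generalize z q l • C.d (z q k) = A, z q k • C.d (z q l) = B, z q l • z q k • θ = D
    match_scalars
    · linear_combination c2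
    · linear_combination c1
    · linear_combination c3
  · simp only [h1, lt_irrefl, if_true, if_false, smul_add, smul_sub, smul_csmul]
    generalize z q k • C.d (z q k) = A, z q k • z q k • θ = D
    match_scalars
    · rw [hQ] at c2
      linear_combination c2 + (q : ℂ) * c1 + κ.a1 * κ.a2 * hqq
    · linear_combination c3
  · have h3 : z q l • z q k • θ = (q : ℂ) • (z q k • z q l • θ) := by
      rw [← mul_smul, z_mul_z hkl, smul_assoc, mul_smul]
    simp only [h1, hkl.ne, hkl.ne', hkl, hkl.not_gt, if_true, if_false, smul_add, smul_sub,
      smul_csmul, h3]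
    generalize z q l • C.d (z q k) = A, z q k • C.d (z q l) = B, z q k • z q l • θ = D
    match_scalars
    · linear_combination c2 + bigQ q * c1
    · linear_combination c1
    · rw [hQ]
      linear_combination (q : ℂ) * c3 - κ.a2 * κ.c1 * hqq

theorem IsStarMap.op_z_smul_dzs (hJ : C.IsStarMap J) (hq : q ≠ 0)
    (h : C.HasThetaStructure θ κ x₁ y₁ x₂ y₂) (hθ : J θ = -θ) (hκ : κ.IsReal)
    (c1 : κ.b4 - κ.c4 * y₂ = -κ.b3) (c2 : κ.a3 * κ.a4 - κ.b3 * κ.b4 - κ.c4 * x₂ * y₁ = 1)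
    (c3 : κ.a4 * κ.c3 * q - κ.b3 * κ.c4 - κ.c4 * x₁ * x₂ = 0)
    (c4 : κ.a4 * κ.d3 * q * (q : ℂ) ^ (2 * N) = (1 + κ.b3) * κ.d4)
    (k l : Fin N) : J (op (z q l) • C.d (zs q k)) = zs q l • C.d (z q k) := by
  have hqq : (q : ℂ) * (q : ℂ)⁻¹ = 1 := mul_inv_cancel₀ (by exact_mod_cast hq)
  -- Normal ordering `dz_s z_t^*` introduces `rLeftInv`, the inverse of the outer `rRight`. The
  -- double sum therefore collapses to the single form `z_l^* dz_k`.
  have h1 : ∑ s, ∑ t, rRight q s t l k • (op (zs q t) • C.d (z q s)) =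
      κ.a3 • (zs q l • C.d (z q k)) +
      κ.b3 • ∑ s, ∑ t, rRight q s t l k • (z q s • C.d (zs q t)) +
      (κ.c3 * q) • (zs q l • z q k • θ) +
      (if l = k then (κ.d3 * q * (q : ℂ) ^ (2 * N)) • θ else 0) := by
    have h2 := sum_smul_sum_smul (sum_rRight_mul_rLeftInv hq) l k
      (fun s t => zs q s • C.d (z q t))
    have h3 := congrArg (· • θ) (sum_rRight_z_mul_zs hq l k)
    have h4 := sum_rRight_wt hq l k
    simp only [Finset.sum_smul, smul_assoc, mul_smul] at h3
    simp only [h.rel_zs, smul_add, Finset.sum_add_distrib]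
    congr 1
    · congr 1
      · congr 1
        · rw [← h2]
          simp only [Finset.smul_sum, smul_comm κ.a3]
        · simp only [Finset.smul_sum, smul_comm κ.b3]
      · rw [mul_smul κ.c3, ← h3]
        simp only [Finset.smul_sum, smul_comm κ.c3, mul_smul]
    · have h5 : ∀ s, rRight q s s l k • ((q : ℂ) ^ 2 * wt q s) • κ.d3 • θ =
          (rRight q s s l k * wt q s) • ((q : ℂ) ^ 2 * κ.d3) • θ := by
        intro s; module
      simp only [ite_smul, zero_smul, smul_ite, smul_zero, Finset.sum_ite_eq, Finset.mem_univ,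
        if_true, h5]
      rw [← Finset.sum_smul, h4]
      split_ifs
      · rw [smul_smul]
        congr 1
        linear_combination (q : ℂ) * (q : ℂ) ^ (2 * N) * κ.d3 * hqq
      · rw [zero_smul]
  have h6 : op (zs q l * z q k) • θ = x₂ • (zs q l • (x₁ • (z q k • θ) + y₁ • C.d (z q k))) +
      y₂ • (op (z q k) • C.d (zs q l)) := by
    rw [op_mul_smul, h.theta_zs, smul_add, op_smul_csmul, op_smul_smul, op_smul_csmul, h.theta_z]
  have h7 := h.rel_sz l k
  have h8 := sum_smul_swap (rRight_swap (q := q)) k l (fun s t => op (zs q t) • C.d (z q s))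
  have hr : ∀ s t k l : Fin N, starRingEnd ℂ (rRight q s t k l) = rRight q s t k l := by
    intro s t k l
    simp only [rRight_eq, apply_ite (starRingEnd ℂ), Complex.conj_ofReal, conj_bigQ, map_zero,
      map_one]
  rw [h.rel_sz]
  simp only [map_add, map_sum, hJ.csmul, hJ.smul, hJ.dzs, hJ.dz, star_zs, star_z, star_mul, hθ,
    hκ.a4, hκ.b4, hκ.c4, hκ.d4, hr, apply_ite (starRingEnd ℂ), map_one, map_zero, smul_neg, h6, h8,
    h1, h7]
  simp only [mul_smul (zs q l), smul_add, smul_csmul]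
  generalize zs q l • C.d (z q k) = A, zs q l • z q k • θ = D,
    ∑ s, ∑ t, rRight q s t l k • (z q s • C.d (zs q t)) = B
  rcases eq_or_ne k l with rfl | hkl
  · simp only [if_true]
    match_scalars
    · linear_combination c2 + κ.b4 * c1
    · linear_combination κ.a4 * c1
    · linear_combination c3 + κ.c4 * c1
    · linear_combination c4 + κ.d4 * c1
  · simp only [hkl, hkl.symm, if_false]
    match_scalars
    · linear_combination c2 + κ.b4 * c1
    · linear_combination κ.a4 * c1
    · linear_combination c3 + κ.c4 * c1
    · ring

theorem IsStarMap.op_zs_smul_dz (hJ : C.IsStarMap J) (hq : q ≠ 0)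
    (h : C.HasThetaStructure θ κ x₁ y₁ x₂ y₂) (hθ : J θ = -θ) (hκ : κ.IsReal)
    (c1 : κ.b3 - κ.c3 * y₁ = -κ.b4) (c2 : κ.a3 * κ.a4 - κ.b3 * κ.b4 - κ.c3 * x₁ * y₂ = 1)
    (c3 : κ.a3 * κ.c4 * (q : ℂ)⁻¹ - κ.b4 * κ.c3 - κ.c3 * x₁ * x₂ = 0)
    (c4 : κ.a3 * κ.d4 * (q * ((q : ℂ) ^ (2 * N))⁻¹) = (1 + κ.b4) * (q : ℂ) ^ 2 * κ.d3)
    (k l : Fin N) : J (op (zs q l) • C.d (z q k)) = z q l • C.d (zs q k) := by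
  -- The same collapse with the roles of the two inverse matrices exchanged; the Kronecker delta
  -- term is evaluated by the partial trace `sum_rLeftInv_lower`.
  have h1 : ∑ s, ∑ t, rLeftInv q s t l k • (op (z q t) • C.d (zs q s)) =
      κ.a4 • (z q l • C.d (zs q k)) +
      κ.b4 • ∑ s, ∑ t, rLeftInv q s t l k • (zs q s • C.d (z q t)) +
      (κ.c4 * (q : ℂ)⁻¹) • (z q l • zs q k • θ) +
      (if l = k then (κ.d4 * (q * ((q : ℂ) ^ (2 * N))⁻¹) * wt q l) • θ else 0) := by
    have h2 := sum_smul_sum_smul (sum_rLeftInv_mul_rRight hq) l k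
      (fun s t => z q s • C.d (zs q t))
    have h3 := congrArg (· • θ) (sum_rLeftInv_zs_mul_z hq l k)
    have h4 := sum_rLeftInv_lower hq l k
    simp only [Finset.sum_smul, smul_assoc, mul_smul] at h3
    simp only [h.rel_sz, smul_add, Finset.sum_add_distrib]
    congr 1
    · congr 1
      · congr 1
        · rw [← h2]
          simp only [Finset.smul_sum, smul_comm κ.a4]
        · simp only [Finset.smul_sum, smul_comm κ.b4]
      · rw [mul_smul κ.c4, ← h3]
        simp only [Finset.smul_sum, smul_comm κ.c4, mul_smul]
    · simp only [ite_smul, zero_smul, one_smul, smul_ite, smul_zero, Finset.sum_ite_eq,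
        Finset.mem_univ, if_true]
      rw [← Finset.sum_smul, h4]
      split_ifs
      · module
      · rw [zero_smul]
  have h6 : op (z q l * zs q k) • θ = x₁ • (z q l • (x₂ • (zs q k • θ) + y₂ • C.d (zs q k))) +
      y₁ • (op (zs q k) • C.d (z q l)) := by
    rw [op_mul_smul, h.theta_z, smul_add, op_smul_csmul, op_smul_smul, op_smul_csmul, h.theta_zs]
  have h7 := h.rel_zs l k
  have h8 := sum_smul_swap (rLeftInv_swap hq) k l (fun s t => op (z q t) • C.d (zs q s))
  have hw : ∀ k : Fin N, starRingEnd ℂ (wt q k) = wt q k := by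
    intro k; rw [wt, map_pow, Complex.conj_ofReal]
  have hr : ∀ s t k l : Fin N, starRingEnd ℂ (rLeftInv q s t k l) = rLeftInv q s t k l := by
    intro s t k l
    simp only [rLeftInv_eq hq, apply_ite (starRingEnd ℂ), Complex.conj_ofReal, conj_bigQ, map_zero,
      map_one, map_neg, map_mul, map_inv₀, hw]
  rw [h.rel_zs]
  simp only [map_add, map_sum, hJ.csmul, hJ.smul, hJ.dzs, hJ.dz, star_zs, star_z, star_mul, hθ,
    hκ.a3, hκ.b3, hκ.c3, hκ.d3, hr, hw, apply_ite (starRingEnd ℂ), map_mul, map_pow,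
    Complex.conj_ofReal, map_zero, smul_neg, h6, h8, h1, h7]
  simp only [mul_smul (z q l), smul_add, smul_csmul]
  generalize z q l • C.d (zs q k) = A, z q l • zs q k • θ = D,
    ∑ s, ∑ t, rLeftInv q s t l k • (zs q s • C.d (z q t)) = B
  rcases eq_or_ne k l with rfl | hkl
  · simp only [if_true]
    match_scalars
    · linear_combination c2 + κ.b3 * c1
    · linear_combination κ.a3 * c1
    · linear_combination c3 + κ.c3 * c1
    · linear_combination wt q k * (c4 + (q : ℂ) ^ 2 * κ.d3 * c1)
  · simp only [hkl, hkl.symm, if_false]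
    match_scalars
    · linear_combination c2 + κ.b3 * c1
    · linear_combination κ.a3 * c1
    · linear_combination c3 + κ.c3 * c1
    · ring

end FODC

/-- The conditions on the coefficients under which `θ ↦ -θ` extends to a star map. -/
structure Coeffs.IsStar (N : ℕ) (q : ℝ) (κ : Coeffs) (x₁ y₁ x₂ y₂ : ℂ) : Prop where
  zz₁ : κ.a1 * κ.b2 + (κ.b1 - κ.c1 * y₂) * κ.a2 = 0
  zz₂ : κ.a1 * κ.a2 + (κ.b1 - κ.c1 * y₂) * κ.b2 + bigQ q * (κ.b1 - κ.c1 * y₂) * κ.a2 -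
    κ.c1 * x₂ * y₂ = 1
  zz₃ : κ.a1 * κ.c2 * (q : ℂ)⁻¹ + (κ.b1 - κ.c1 * y₂) * κ.c2 - κ.c1 * x₂ ^ 2 = 0
  ss₁ : κ.a2 * κ.b1 + (κ.b2 - κ.c2 * y₁) * κ.a1 = 0
  ss₂ : κ.a1 * κ.a2 + (κ.b2 - κ.c2 * y₁) * κ.b1 - bigQ q * (κ.b2 - κ.c2 * y₁) * κ.a1 -
    κ.c2 * x₁ * y₁ = 1
  ss₃ : κ.a2 * κ.c1 * q + (κ.b2 - κ.c2 * y₁) * κ.c1 - κ.c2 * x₁ ^ 2 = 0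
  zs₁ : κ.b3 - κ.c3 * y₁ = -κ.b4
  zs₂ : κ.a3 * κ.a4 - κ.b3 * κ.b4 - κ.c3 * x₁ * y₂ = 1
  zs₃ : κ.a3 * κ.c4 * (q : ℂ)⁻¹ - κ.b4 * κ.c3 - κ.c3 * x₁ * x₂ = 0
  zs₄ : κ.a3 * κ.d4 * (q * ((q : ℂ) ^ (2 * N))⁻¹) = (1 + κ.b4) * (q : ℂ) ^ 2 * κ.d3
  sz₁ : κ.b4 - κ.c4 * y₂ = -κ.b3
  sz₂ : κ.a3 * κ.a4 - κ.b3 * κ.b4 - κ.c4 * x₂ * y₁ = 1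
  sz₃ : κ.a4 * κ.c3 * q - κ.b3 * κ.c4 - κ.c4 * x₁ * x₂ = 0
  sz₄ : κ.a4 * κ.d3 * q * (q : ℂ) ^ (2 * N) = (1 + κ.b3) * κ.d4

/-- The coefficients of `Ω₋` vanish. -/
structure Coeffs.NoOmegaMinus (κ : Coeffs) : Prop where
  e1 : κ.e1 = 0
  e2 : κ.e2 = 0
  e3 : κ.e3 = 0
  f3 : κ.f3 = 0
  e4 : κ.e4 = 0
  f4 : κ.f4 = 0

/-! ### The star property of the one-relation calculi. -/

namespace FODC

open Sphere

variable {C : FODC.{u} (Sphere N q)} {κ : Coeffs} {θ : C.form} {μ ν x₁ y₁ x₂ y₂ : ℂ}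

theorem IsStarMap.isStarCalculus_of_theta {J : C.form →+ C.form} (hJ : C.IsStarMap J)
    (hq : q ≠ 0) (hspan : Submodule.span (Sphere N q) (Set.range C.dgen) = ⊤)
    (h : C.HasThetaStructure θ κ x₁ y₁ x₂ y₂) (hθ : J θ = -θ) (hκ : κ.IsReal)
    (hs : κ.IsStar N q x₁ y₁ x₂ y₂) : C.IsStarCalculus :=
  hJ.isStarCalculus hspan (hJ.op_z_smul_dz hq h hθ hκ hs.zz₁ hs.zz₂ hs.zz₃)
    (hJ.op_zs_smul_dzs hq h hθ hκ hs.ss₁ hs.ss₂ hs.ss₃)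
    (hJ.op_zs_smul_dz hq h hθ hκ hs.zs₁ hs.zs₂ hs.zs₃ hs.zs₄)
    (hJ.op_z_smul_dzs hq h hθ hκ hs.sz₁ hs.sz₂ hs.sz₃ hs.sz₄)

theorem weight_eq (i : Fin N) : (q : ℂ) ^ (2 * ((i : ℕ) + 1)) = (q : ℂ) ^ 2 * wt q i := by
  rw [wt]; ring

theorem HasBimoduleStructure.hasThetaStructure_omegaPlus (h : C.HasBimoduleStructure κ)
    (hq : q ≠ 0) (h0 : κ.NoOmegaMinus) :
    C.HasThetaStructure C.omegaPlus κ (q * κ.a4 + κ.c4 + κ.d4) κ.b4 (q * κ.a2 + κ.c2) κ.b2 where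
  rel_zz k l := by rw [h.rel_zz, h0.e1, zero_smul, add_zero]
  rel_ss k l := by rw [h.rel_ss, h0.e2, zero_smul, add_zero]
  rel_zs k l := by
    rw [h.rel_zs, h0.e3, h0.f3, zero_smul, add_zero, zero_smul, add_zero, weight_eq]
  rel_sz k l := by
    rw [h.rel_sz, h0.e4, h0.f4, zero_smul, add_zero, zero_smul, add_zero]
  theta_z l := by
    rw [h.omegaPlus_mul_z hq, h0.e4, h0.f4, add_zero, zero_smul, add_zero]
  theta_zs l := by rw [h.omegaPlus_mul_zs hq, h0.e2, zero_smul, add_zero]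

/-- Needed for `λ = 0`, where Ω₊ vanishes: then Ω₋ serves as the remaining invariant form, and its
coefficients e, f take the places of c, d. -/
theorem HasBimoduleStructure.hasThetaStructure_omegaMinus (h : C.HasBimoduleStructure κ)
    (hq : q ≠ 0) (h0 : C.omegaPlus = 0) :
    C.HasThetaStructure C.omegaMinus
      { κ with c1 := κ.e1, c2 := κ.e2, c3 := κ.e3, d3 := κ.f3, c4 := κ.e4, d4 := κ.f4 }
      ((q : ℂ)⁻¹ * κ.a1 + ((q : ℂ) ^ 2)⁻¹ * κ.e1) (((q : ℂ) ^ 2)⁻¹ * κ.b1)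
      ((q : ℂ)⁻¹ * κ.a3 + ((q : ℂ) ^ 2)⁻¹ * κ.e3 + κ.f3) (((q : ℂ) ^ 2)⁻¹ * κ.b3) where
  rel_zz k l := by rw [h.rel_zz, h0, smul_zero, smul_zero, add_zero]
  rel_ss k l := by rw [h.rel_ss, h0, smul_zero, smul_zero, add_zero]
  rel_zs k l := by
    rw [h.rel_zs, h0, smul_zero, smul_zero, smul_zero, add_zero, zero_add, weight_eq]
  rel_sz k l := by
    rw [h.rel_sz, h0, smul_zero, smul_zero, smul_zero, add_zero, zero_add]
  theta_z l := by rw [h.omegaMinus_mul_z hq, h0, smul_zero, smul_zero, zero_add]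
  theta_zs l := by rw [h.omegaMinus_mul_zs hq, h0, smul_zero, smul_zero, zero_add]

theorem IsPresented.isStarCalculus_of_noOmegaMinus (h : C.IsPresented μ ν κ) (hq : q ≠ 0)
    (hμ : starRingEnd ℂ μ = μ) (hν : starRingEnd ℂ ν = ν) (h0 : κ.NoOmegaMinus) (hκ : κ.IsReal)
    (h₁ : q * κ.a4 + κ.c4 + κ.d4 = x₁) (h₂ : q * κ.a2 + κ.c2 = x₂)
    (hs : κ.IsStar N q x₁ κ.b4 x₂ κ.b2) : C.IsStarCalculus := by
  obtain ⟨J, hJ⟩ := h.exists_isStarMap hq hμ hν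
  subst h₁ h₂
  exact hJ.isStarCalculus_of_theta hq h.span_dgen (h.bimodule.hasThetaStructure_omegaPlus hq h0)
    hJ.omegaPlus hκ hs

variable {lam : ℂ}

theorem IsPresented.isStarCalculus_tilde (h : C.IsPresented 1 lam (coeffTilde q lam))
    (hq : q ≠ 0) (h0 : lam ≠ 0) (hlam : starRingEnd ℂ lam = lam) : C.IsStarCalculus := by
  have hq' : (q : ℂ) ≠ 0 := by exact_mod_cast hq
  -- The witnesses `x₁`, `x₂` are the simplified coefficients of `z_l Ω₊` in `Ω₊ z_l` and of `z_l^*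
  -- Ω₊` in `Ω₊ z_l^*`. The other families use their own values in the same way.
  refine h.isStarCalculus_of_noOmegaMinus (x₁ := 1) (x₂ := 1) hq (map_one _) hlam ?_ ?_ ?_ ?_ ?_
  · constructor <;> rfl
  · constructor <;> simp [coeffTilde, hlam]
  · simp only [coeffTilde]; field_simp; ring
  · simp only [coeffTilde]; field_simp; ring
  · constructor <;> simp only [coeffTilde, bigQ] <;> field_simp <;> ring

theorem IsPresented.isStarCalculus_tilde' (h : C.IsPresented 1 lam (coeffTilde' q lam))
    (hq : q ≠ 0) (h0 : lam ≠ 0) (hlam : starRingEnd ℂ lam = lam) : C.IsStarCalculus := by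
  have hq' : (q : ℂ) ≠ 0 := by exact_mod_cast hq
  refine h.isStarCalculus_of_noOmegaMinus (x₁ := q ^ 2 * lam⁻¹) (x₂ := ((q : ℂ) ^ 2)⁻¹ * lam)
    hq (map_one _) hlam ?_ ?_ ?_ ?_ ?_
  · constructor <;> rfl
  · constructor <;> simp [coeffTilde', hlam]
  · simp only [coeffTilde']; field_simp; ring
  · simp only [coeffTilde']; field_simp; ring
  · constructor <;> simp only [coeffTilde', bigQ] <;> field_simp <;> ring

/-- For `N ≥ 2` the number s is a nonempty sum of even powers of `q ≠ 0`; its inverse enters the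
table of Γ̃''. -/
theorem sPrime_pos (hN : 2 ≤ N) (hq : q ≠ 0) : 0 < sPrime N q := by
  obtain ⟨n, rfl⟩ := Nat.exists_eq_add_of_le' hN
  rw [sPrime, sPlus, Finset.sum_range_succ', mul_zero, pow_zero, add_sub_cancel_right]
  refine Finset.sum_pos (fun i _ => ?_) ⟨0, by simp⟩
  rw [pow_mul]
  positivity

theorem sPlus_eq (N : ℕ) (q : ℝ) : (sPlus N q : ℂ) = sPrime N q + 1 := by
  rw [sPrime]; push_cast; ring

/-- Geometric sum. It eliminates `q^{2N}` in favour of s, so that the scalar conditions become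
rational identities in q, s and the parameters. -/
theorem pow_two_mul_eq (N : ℕ) (q : ℝ) :
    (q : ℂ) ^ (2 * N) = q ^ 2 * (sPrime N q + 1) - sPrime N q := by
  have h : ∀ n : ℕ, q ^ 2 * sPlus n q - sPlus n q = q ^ (2 * n) - 1 := by
    intro n
    induction n with
    | zero => simp [sPlus]
    | succ n ih =>
      rw [sPlus] at *
      rw [Finset.sum_range_succ]
      linear_combination ih
  have h1 : q ^ (2 * N) = q ^ 2 * (sPrime N q + 1) - sPrime N q := by
    rw [sPrime]; linear_combination -h N
  exact_mod_cast h1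

theorem pow_two_mul_sub (hN : 2 ≤ N) (q : ℝ) :
    (q : ℂ) ^ (2 * N) = (q : ℂ) ^ 2 * (q : ℂ) ^ (2 * N - 2) := by
  rw [← pow_add]; congr 1; omega

theorem pow_two_mul_add (N : ℕ) (q : ℝ) :
    (q : ℂ) ^ (2 * N + 2) = (q : ℂ) ^ 2 * (q : ℂ) ^ (2 * N) := by
  ring

end FODC

namespace FODC

open Sphere

variable {C : FODC.{u} (Sphere N q)} {lam : ℂ}

theorem pow_two_mul_sub_eq (hN : 2 ≤ N) (hq : q ≠ 0) :
    (q : ℂ) ^ (2 * N - 2) = sPrime N q + 1 - sPrime N q * ((q : ℂ) ^ 2)⁻¹ := by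
  have hq' : (q : ℂ) ≠ 0 := by exact_mod_cast hq
  have h := pow_two_mul_eq N q
  rw [pow_two_mul_sub hN] at h
  field_simp
  linear_combination h

theorem IsPresented.isStarCalculus_tilde''Generic
    (h : C.IsPresented 1 lam (coeffTilde''Generic N q lam)) (hN : 2 ≤ N)
    (hq : q ≠ 0) (h0 : lam ≠ 0) (hlam : starRingEnd ℂ lam = lam) : C.IsStarCalculus := by
  have hq' : (q : ℂ) ≠ 0 := by exact_mod_cast hq
  have hs : (sPrime N q : ℂ) ≠ 0 := by exact_mod_cast (sPrime_pos hN hq).ne'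
  have hP := pow_two_mul_sub_eq hN hq
  refine h.isStarCalculus_of_noOmegaMinus (x₁ := ((q : ℂ) ^ 2)⁻¹) (x₂ := (q : ℂ) ^ 2)
    hq (map_one _) hlam ?_ ?_ ?_ ?_ ?_
  · constructor <;> rfl
  · constructor <;> simp [coeffTilde''Generic, hlam]
  · simp only [coeffTilde''Generic, pow_two_mul_add, pow_two_mul_sub hN, hP]
    field_simp
    ring
  · simp only [coeffTilde''Generic]; ring
  · constructor <;> simp only [coeffTilde''Generic, pow_two_mul_add, pow_two_mul_sub hN] <;>
      field_simp <;> ring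

theorem IsPresented.isStarCalculus_tilde''Inf
    (h : C.IsPresented 0 1 (coeffTilde''Inf N q)) (hN : 2 ≤ N) (hq : q ≠ 0) :
    C.IsStarCalculus := by
  have hq' : (q : ℂ) ≠ 0 := by exact_mod_cast hq
  have hs : (sPrime N q : ℂ) ≠ 0 := by exact_mod_cast (sPrime_pos hN hq).ne'
  have hP := pow_two_mul_sub_eq hN hq
  refine h.isStarCalculus_of_noOmegaMinus (x₁ := ((q : ℂ) ^ 2)⁻¹) (x₂ := (q : ℂ) ^ 2)
    hq (map_zero _) (map_one _) ?_ ?_ ?_ ?_ ?_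
  · constructor <;> rfl
  · constructor <;> simp [coeffTilde''Inf]
  · simp only [coeffTilde''Inf, hP]
    field_simp
    ring
  · simp only [coeffTilde''Inf]; ring
  · constructor <;> simp only [coeffTilde''Inf, pow_two_mul_sub hN] <;> field_simp <;> ring

theorem IsPresented.isStarCalculus_tilde''Zero
    (h : C.IsPresented 1 0 (coeffTilde''Zero N q)) (hN : 2 ≤ N) (hq : q ≠ 0) :
    C.IsStarCalculus := by
  have hq' : (q : ℂ) ≠ 0 := by exact_mod_cast hq
  have hs : (sPrime N q : ℂ) ≠ 0 := by exact_mod_cast (sPrime_pos hN hq).ne'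
  obtain ⟨J, hJ⟩ := h.exists_isStarMap hq (map_one _) (map_zero _)
  have h0 : C.omegaPlus = 0 := by
    simpa only [omega, one_smul, zero_smul, add_zero] using h.omega_eq_zero
  refine hJ.isStarCalculus_of_theta hq h.span_dgen
    (h.bimodule.hasThetaStructure_omegaMinus hq h0) (hJ.omegaMinus hq) ?_ ?_
  · constructor <;> simp [coeffTilde''Zero]
  -- This is the coefficient with which `z_l^*` passes Ω₋; simplifying it beforehand keeps the
  -- remaining identities manageable.
  · have hx : (q : ℂ)⁻¹ * q + ((q : ℂ) ^ 2)⁻¹ * (q ^ (2 * N + 2) * (sPrime N q : ℂ)⁻¹) +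
        -(q ^ 2 * (sPrime N q : ℂ)⁻¹) = (q : ℂ) ^ 2 := by
      rw [pow_two_mul_add, pow_two_mul_eq]
      field_simp
      ring
    constructor <;> simp only [coeffTilde''Zero, hx] <;>
      (try simp only [pow_two_mul_add, pow_two_mul_sub hN]) <;> field_simp <;> ring

/-! ### The factor calculi of the freely generated calculi -/

theorem IsFreeCalculus.factor_gamma {α τ : ℝ} (h : C.IsFreeCalculus (coeffGamma N q α τ))
    (hq : q ≠ 0) (hα : α ≠ 0) :
    (C.factor (C.omega 1 (α : ℂ)⁻¹)).IsPresented 1 (α : ℂ)⁻¹ (coeffTilde q (α : ℂ)⁻¹) := by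
  have hq' : (q : ℂ) ≠ 0 := by exact_mod_cast hq
  have hα' : (α : ℂ) ≠ 0 := by exact_mod_cast hα
  refine h.factor_isPresented hq (Or.inl rfl) ?_ ?_
  · constructor <;> simp only [coeffGamma, sPlus_eq, pow_two_mul_eq] <;> field_simp <;> ring
  · constructor <;> simp only [coeffGamma, coeffTilde, sPlus_eq, pow_two_mul_eq] <;> field_simp <;>
      ring

theorem IsFreeCalculus.factor_gamma' {α ω : ℝ} (h : C.IsFreeCalculus (coeffGamma' q α ω))
    (hq : q ≠ 0) (hα : α ≠ 0) (hω : ω ≠ 0) :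
    (C.factor (C.omega 1 (α : ℂ)⁻¹)).IsPresented 1 (α : ℂ)⁻¹ (coeffTilde q (α : ℂ)⁻¹) := by
  have hq' : (q : ℂ) ≠ 0 := by exact_mod_cast hq
  have hα' : (α : ℂ) ≠ 0 := by exact_mod_cast hα
  have hω' : (ω : ℂ) ≠ 0 := by exact_mod_cast hω
  refine h.factor_isPresented hq (Or.inl rfl) ?_ ?_
  · constructor <;> simp only [coeffGamma'] <;> field_simp <;> ring
  · constructor <;> simp only [coeffGamma', coeffTilde] <;> field_simp <;> ring

theorem IsFreeCalculus.factor_gamma'' {ω ψ : ℝ} (h : C.IsFreeCalculus (coeffGamma'' q ω ψ))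
    (hq : q ≠ 0) (hω : ω ≠ 0) (h0 : lam ≠ 0)
    (hlam : ((q : ℂ) ^ 4)⁻¹ * ω * lam ^ 2 - ((q : ℂ) ^ 2)⁻¹ * ω * ψ * lam + 1 = 0) :
    (C.factor (C.omega 1 lam)).IsPresented 1 lam (coeffTilde' q lam) := by
  have hq' : (q : ℂ) ≠ 0 := by exact_mod_cast hq
  have hω' : (ω : ℂ) ≠ 0 := by exact_mod_cast hω
  -- Since `λ ≠ 0`, the quadratic equation is linear in ψ and can be solved for it, which turns the
  -- conditions into rational identities in q, ω and λ.
  have hψ : (ψ : ℂ) = (q ^ 4 + ω * lam ^ 2) * (q ^ 2 * ω * lam)⁻¹ := by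
    field_simp at hlam ⊢
    linear_combination -hlam
  refine h.factor_isPresented hq (Or.inl rfl) ?_ ?_
  · constructor <;> simp only [coeffGamma'', hψ] <;> field_simp <;> ring
  · constructor <;> simp only [coeffGamma'', coeffTilde', hψ] <;> field_simp <;> ring

theorem IsFreeCalculus.factor_gamma'''_tilde' {ϱ τ : ℝ}
    (h : C.IsFreeCalculus (coeffGamma''' N q ϱ τ)) (hN : 2 ≤ N) (hq : q ≠ 0) (hϱ : ϱ ≠ 0)
    (hτ : τ ≠ 0) (hlam : lam = q ^ 2 * τ / ϱ) :
    (C.factor (C.omega 1 lam)).IsPresented 1 lam (coeffTilde' q lam) := by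
  have hq' : (q : ℂ) ≠ 0 := by exact_mod_cast hq
  have hϱ' : (ϱ : ℂ) ≠ 0 := by exact_mod_cast hϱ
  have hτ' : (τ : ℂ) ≠ 0 := by exact_mod_cast hτ
  have hP := pow_two_mul_sub_eq hN hq
  refine h.factor_isPresented hq (Or.inl rfl) ?_ ?_
  · constructor <;> simp only [coeffGamma''', sPlus_eq, pow_two_mul_eq, hP, hlam] <;>
      field_simp <;> ring
  · constructor <;> simp only [coeffGamma''', coeffTilde', sPlus_eq, pow_two_mul_eq, hP, hlam] <;>
      field_simp <;> ring

/-- The condition on λ is kept free of division, so that it covers both the second root for `sϱ ≠ 1`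
and the degenerate case in which both sides vanish and λ is arbitrary. -/
theorem IsFreeCalculus.factor_gamma'''_tilde'' {ϱ τ : ℝ}
    (h : C.IsFreeCalculus (coeffGamma''' N q ϱ τ)) (hN : 2 ≤ N) (hq : q ≠ 0) (hϱ : ϱ ≠ 0)
    (hτ : τ ≠ 0) (hlam : lam * (sPrime N q * ϱ - 1) = q ^ 2 * (sPrime N q * τ - q ^ 2)) :
    (C.factor (C.omega 1 lam)).IsPresented 1 lam (coeffTilde'' N q lam) := by
  have hq' : (q : ℂ) ≠ 0 := by exact_mod_cast hq
  have hϱ' : (ϱ : ℂ) ≠ 0 := by exact_mod_cast hϱ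
  have hτ' : (τ : ℂ) ≠ 0 := by exact_mod_cast hτ
  have hs : (sPrime N q : ℂ) ≠ 0 := by exact_mod_cast (sPrime_pos hN hq).ne'
  have hP := pow_two_mul_sub_eq hN hq
  refine h.factor_isPresented hq (Or.inl rfl) ?_ ?_
  · constructor <;> simp only [coeffGamma''', sPlus_eq, pow_two_mul_eq, hP] <;>
      field_simp <;> grind
  · rw [coeffTilde'']
    split_ifs with h0
    · subst h0
      constructor <;> simp only [coeffGamma''', coeffTilde''Zero, sPlus_eq, pow_two_mul_add,
        pow_two_mul_eq, hP] <;> field_simp <;> grind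
    · constructor <;> simp only [coeffGamma''', coeffTilde''Generic, sPlus_eq, pow_two_mul_add,
        pow_two_mul_eq, hP] <;> field_simp <;> grind

/-- At `sϱ = 1` the Ω₊-components of `Ω₋ z_l` and `Ω₋ z_l^*` carry the factor `sϱ - 1` and
disappear, so Ω₋ alone generates a sub-bimodule. -/
theorem IsFreeCalculus.factor_gamma'''_inf {ϱ τ : ℝ}
    (h : C.IsFreeCalculus (coeffGamma''' N q ϱ τ)) (hN : 2 ≤ N) (hq : q ≠ 0)
    (hϱ : ϱ = (sPrime N q)⁻¹) :
    (C.factor (C.omega 0 1)).IsPresented 0 1 (coeffTilde''Inf N q) := by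
  have hq' : (q : ℂ) ≠ 0 := by exact_mod_cast hq
  have hs : (sPrime N q : ℂ) ≠ 0 := by exact_mod_cast (sPrime_pos hN hq).ne'
  have hϱ' : (ϱ : ℂ) = (sPrime N q : ℂ)⁻¹ := by rw [hϱ]; push_cast; rfl
  refine h.factor_isPresented hq (Or.inr ⟨rfl, rfl⟩) ?_ ?_
  · constructor <;> simp only [coeffGamma''', sPlus_eq, hϱ', mul_inv_cancel₀ hs] <;>
      field_simp <;> ring
  · constructor <;> simp only [coeffGamma''', coeffTilde''Inf, sPlus_eq, hϱ',
      mul_inv_cancel₀ hs] <;> field_simp <;> ring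

theorem IsPresented.isStarCalculus_tilde'' (h : C.IsPresented 1 lam (coeffTilde'' N q lam))
    (hN : 2 ≤ N) (hq : q ≠ 0) (hlam : starRingEnd ℂ lam = lam) : C.IsStarCalculus := by
  rw [coeffTilde''] at h
  split_ifs at h with h0
  · subst h0
    exact h.isStarCalculus_tilde''Zero hN hq
  · exact h.isStarCalculus_tilde''Generic hN hq h0 hlam

end FODC

end QSphere

end

/-! ### Assembly of the five cases. -/

theorem mainTheorem8 (N : ℕ) (hN : 2 ≤ N) (q : ℝ) (hq0 : q ≠ 0) (hq1 : q ≠ 1) (hq2 : q ≠ -1) :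
    (∀ α : ℝ, α ≠ 0 → α ≠ (q ^ 2)⁻¹ →
      (∀ (τ : ℝ) (C : QSphere.FODC.{u} (QSphere.Sphere N q)),
        C.IsFreeCalculus (QSphere.coeffGamma N q α τ) →
        C.FactorEq 1 (α : ℂ)⁻¹ (QSphere.coeffTilde q (α : ℂ)⁻¹) ∧
        C.FactorStar 1 (α : ℂ)⁻¹) ∧
      (∀ (ω : ℝ), ω ≠ 0 → ∀ C : QSphere.FODC.{u} (QSphere.Sphere N q),
        C.IsFreeCalculus (QSphere.coeffGamma' q α ω) →
        C.FactorEq 1 (α : ℂ)⁻¹ (QSphere.coeffTilde q (α : ℂ)⁻¹) ∧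
        C.FactorStar 1 (α : ℂ)⁻¹) ∧
      (∀ (τ ω : ℝ), ω ≠ 0 → ∀ C C' : QSphere.FODC.{u} (QSphere.Sphere N q),
        C.IsFreeCalculus (QSphere.coeffGamma N q α τ) →
        C'.IsFreeCalculus (QSphere.coeffGamma' q α ω) →
        (C.factor (C.omega 1 (α : ℂ)⁻¹)).Isomorphic (C'.factor (C'.omega 1 (α : ℂ)⁻¹)))) ∧
    (∀ ω ψ : ℝ, ω ≠ 0 → ∀ C : QSphere.FODC.{u} (QSphere.Sphere N q),
      C.IsFreeCalculus (QSphere.coeffGamma'' q ω ψ) →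
      ∀ lam : ℂ, ((q : ℂ) ^ 4)⁻¹ * ω * lam ^ 2 - ((q : ℂ) ^ 2)⁻¹ * ω * ψ * lam + 1 = 0 →
        C.FactorEq 1 lam (QSphere.coeffTilde' q lam) ∧
        (lam.im = 0 → C.FactorStar 1 lam)) ∧
    (∀ ϱ τ : ℝ, ϱ ≠ 0 → ϱ ≠ (QSphere.sPrime N q)⁻¹ → τ ≠ 0 →
      ∀ C : QSphere.FODC.{u} (QSphere.Sphere N q),
      C.IsFreeCalculus (QSphere.coeffGamma''' N q ϱ τ) →
      ∀ lam₁ lam₂ : ℝ, lam₁ = q ^ 2 * τ / ϱ →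
        lam₂ = q ^ 2 * (QSphere.sPrime N q * τ - q ^ 2) / (QSphere.sPrime N q * ϱ - 1) →
        C.FactorEq 1 lam₁ (QSphere.coeffTilde' q lam₁) ∧ C.FactorStar 1 lam₁ ∧
        C.FactorEq 1 lam₂ (QSphere.coeffTilde'' N q lam₂) ∧ C.FactorStar 1 lam₂ ∧
        (τ = q ^ 2 * ϱ → lam₁ = q ^ 4 ∧ lam₂ = q ^ 4)) ∧
    (∀ ϱ τ : ℝ, ϱ = (QSphere.sPrime N q)⁻¹ → τ ≠ 0 → τ ≠ q ^ 2 * (QSphere.sPrime N q)⁻¹ →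
      ∀ C : QSphere.FODC.{u} (QSphere.Sphere N q),
      C.IsFreeCalculus (QSphere.coeffGamma''' N q ϱ τ) →
      ∀ lam₁ : ℝ, lam₁ = q ^ 2 * τ / ϱ →
        C.FactorEq 1 lam₁ (QSphere.coeffTilde' q lam₁) ∧ C.FactorStar 1 lam₁ ∧
        C.FactorEq 0 1 (QSphere.coeffTilde''Inf N q) ∧ C.FactorStar 0 1) ∧
    (∀ ϱ τ : ℝ, ϱ = (QSphere.sPrime N q)⁻¹ → (q ^ 2)⁻¹ * τ = (QSphere.sPrime N q)⁻¹ →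
      ∀ C : QSphere.FODC.{u} (QSphere.Sphere N q),
      C.IsFreeCalculus (QSphere.coeffGamma''' N q ϱ τ) →
      (∀ lam : ℝ, C.FactorEq 1 lam (QSphere.coeffTilde'' N q lam) ∧ C.FactorStar 1 lam) ∧
      C.FactorEq 0 1 (QSphere.coeffTilde''Inf N q) ∧ C.FactorStar 0 1) := by
  have hconj : ∀ x : ℝ, starRingEnd ℂ (x : ℂ) = x := Complex.conj_ofReal
  refine ⟨fun α hα _ => ⟨fun τ C hC => ?_, fun ω hω C hC => ?_, fun τ ω hω C C' hC hC' => ?_⟩,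
    fun ω ψ hω C hC lam hlam => ?_, fun ϱ τ hϱ hϱs hτ C hC lam₁ lam₂ h₁ h₂ => ?_,
    fun ϱ τ hϱ hτ _ C hC lam₁ h₁ => ?_, fun ϱ τ hϱ hτ C hC => ?_⟩
  · have h := hC.factor_gamma hq0 hα
    exact ⟨QSphere.FODC.factorEq_of_isPresented hq0 h, h.isStarCalculus_tilde hq0
      (inv_ne_zero (Complex.ofReal_ne_zero.2 hα)) (by rw [map_inv₀, hconj])⟩
  · have h := hC.factor_gamma' hq0 hα hω
    exact ⟨QSphere.FODC.factorEq_of_isPresented hq0 h, h.isStarCalculus_tilde hq0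
      (inv_ne_zero (Complex.ofReal_ne_zero.2 hα)) (by rw [map_inv₀, hconj])⟩
  · exact (hC.factor_gamma hq0 hα).isomorphic (hC'.factor_gamma' hq0 hα hω)
  -- Zero is not a root, the constant term of the quadratic equation being 1.
  · have h0 : lam ≠ 0 := by
      rintro rfl
      simp at hlam
    have h := hC.factor_gamma'' hq0 hω h0 hlam
    exact ⟨QSphere.FODC.factorEq_of_isPresented hq0 h,
      fun him => h.isStarCalculus_tilde' hq0 h0 (Complex.conj_eq_iff_im.2 him)⟩
  · have hs := (QSphere.FODC.sPrime_pos hN hq0).ne'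
    have hs1 : QSphere.sPrime N q * ϱ - 1 ≠ 0 := fun h0 =>
      hϱs (eq_inv_of_mul_eq_one_right (sub_eq_zero.1 h0))
    have h := hC.factor_gamma'''_tilde' (lam := lam₁) hN hq0 hϱ hτ (by rw [h₁]; push_cast; rfl)
    have h' := hC.factor_gamma'''_tilde'' (lam := lam₂) hN hq0 hϱ hτ (by
      have h3 : lam₂ * (QSphere.sPrime N q * ϱ - 1) = q ^ 2 * (QSphere.sPrime N q * τ - q ^ 2) := by
        rw [h₂, div_mul_cancel₀ _ hs1]
      exact_mod_cast h3)
    have h0 : lam₁ ≠ 0 := by rw [h₁]; positivity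
    refine ⟨QSphere.FODC.factorEq_of_isPresented hq0 h,
      h.isStarCalculus_tilde' hq0 (Complex.ofReal_ne_zero.2 h0) (hconj _),
      QSphere.FODC.factorEq_of_isPresented hq0 h', h'.isStarCalculus_tilde'' hN hq0 (hconj _),
      fun h4 => ⟨?_, ?_⟩⟩
    · rw [h₁, h4]
      field_simp
    · rw [h₂, h4, div_eq_iff hs1]
      ring
  · have hs := (QSphere.FODC.sPrime_pos hN hq0).ne'
    have hϱ0 : ϱ ≠ 0 := by rw [hϱ]; exact inv_ne_zero hs
    have h := hC.factor_gamma'''_tilde' (lam := lam₁) hN hq0 hϱ0 hτ (by rw [h₁]; push_cast; rfl)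
    have h' := hC.factor_gamma'''_inf hN hq0 hϱ
    have h0 : lam₁ ≠ 0 := by rw [h₁]; positivity
    exact ⟨QSphere.FODC.factorEq_of_isPresented hq0 h,
      h.isStarCalculus_tilde' hq0 (Complex.ofReal_ne_zero.2 h0) (hconj _),
      QSphere.FODC.factorEq_of_isPresented hq0 h', h'.isStarCalculus_tilde''Inf hN hq0⟩
  · have hs := (QSphere.FODC.sPrime_pos hN hq0).ne'
    have hϱ0 : ϱ ≠ 0 := by rw [hϱ]; exact inv_ne_zero hs
    have hτ' : τ = q ^ 2 * (QSphere.sPrime N q)⁻¹ := by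
      rw [← hτ, mul_inv_cancel_left₀ (pow_ne_zero 2 hq0)]
    have hτ0 : τ ≠ 0 := by rw [hτ']; positivity
    have h' := hC.factor_gamma'''_inf hN hq0 hϱ
    refine ⟨fun lam => ?_, QSphere.FODC.factorEq_of_isPresented hq0 h',
      h'.isStarCalculus_tilde''Inf hN hq0⟩
    have h := hC.factor_gamma'''_tilde'' (lam := lam) hN hq0 hϱ0 hτ0 (by
      -- Both sides are zero because `sϱ = 1` and `sτ = q²`, so λ is unrestricted.
      have h3 : lam * (QSphere.sPrime N q * ϱ - 1) =
          q ^ 2 * (QSphere.sPrime N q * τ - q ^ 2) := by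
        rw [hϱ, hτ']
        field_simp
        ring
      exact_mod_cast h3)
    exact ⟨QSphere.FODC.factorEq_of_isPresented hq0 h, h.isStarCalculus_tilde'' hN hq0 (hconj _)⟩
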